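/- Let $X_1,X_2,\dots$ be independent identically distributed real random variables with $\mathbf E X_1=0$, $\mathrm{Var}(X_1)=1$ and $\mathbf E|X_1|^s<\infty$ for an integer $s\ge 4$. Put $Z_n=(X_1+\dots+X_n)/\sqrt n$ and let $Z\sim N(0,1)$, with density $\varphi$. For a random variable $X$ with an absolutely continuous density $p$ let $$I(X)=\int_{\{p>0\}}\frac{p'(x)^2}{p(x)}\,dx,\qquad I(X\|Z)=\int_{\{p>0\}}\Big(\frac{p'(x)}{p(x)}-\frac{\varphi'(x)}{\varphi(x)}\Big)^2p(x)\,dx,$$ and let both be $+\infty$ if $X$ has no absolutely continuous density. For $r\le s$ let $$\gamma_r=i^{-r}\,\frac{d^r}{dt^r}\log \mathbf E\,e^{itX_1}\Big|_{t=0}$$ be the cumulants of $X_1$. Assume that $I(Z_{n_0})<+\infty$ for some $n_0\ge 1$ and that, for a given integer $k$ with $3\le k\le s$, $\gamma_j=0$ for all $3\le j<k$. Then $I(Z_n\|Z)$ is finite for all sufficiently large $n$ and, as $n\to\infty$, $$I(Z_n\|Z)=\frac{\gamma_k^2}{(k-1)!}\cdot\frac1{n^{k-2}}+O\Big(\frac1{n^{k-1}}\Big)+o\Big(\frac1{n^{(s-2)/2}(\log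 n)^{(s-3)/2}}\Big).$$ -/

import Mathlib

open MeasureTheory ProbabilityTheory Filter Asymptotics
open scoped ENNReal NNReal Topology

/-- `p` is an absolutely continuous probability density (with respect to Lebesgue measure) of the
law `ν` on the real line. Absolute continuity means absolute continuity on every compact interval. -/
structure IsACDensity (ν : Measure ℝ) (p : ℝ → ℝ) : Prop where
  nonneg : ∀ x, 0 ≤ p x
  absCont : ∀ a b : ℝ, AbsolutelyContinuousOnInterval p a b
  eq_withDensity : ν = volume.withDensity (fun x => ENNReal.ofReal (p x))

/-- The absolutely continuous density of a law is unique, if there is one. -/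
theorem IsACDensity.unique {ν : Measure ℝ} {p q : ℝ → ℝ}
    (hp : IsACDensity ν p) (hq : IsACDensity ν q) : p = q := by
  have cont : ∀ {r : ℝ → ℝ}, IsACDensity ν r → Continuous r := fun {r} hr => by
    refine continuous_iff_continuousAt.2 fun x => ?_
    have h := (hr.absCont (x - 1) (x + 1)).uniformContinuousOn.continuousOn
    rw [Set.uIcc_of_le (by linarith)] at h
    exact h.continuousAt (Icc_mem_nhds (by linarith) (by linarith))
  have hae : (fun x => ENNReal.ofReal (p x)) =ᵐ[volume] fun x => ENNReal.ofReal (q x) :=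
    (withDensity_eq_iff_of_sigmaFinite
      (cont hp).measurable.ennreal_ofReal.aemeasurable
      (cont hq).measurable.ennreal_ofReal.aemeasurable).1
      (hp.eq_withDensity.symm.trans hq.eq_withDensity)
  refine Continuous.ae_eq_iff_eq volume (cont hp) (cont hq) |>.1 ?_
  filter_upwards [hae] with x hx
  exact (ENNReal.ofReal_eq_ofReal_iff (hp.nonneg x) (hq.nonneg x)).1 hx

noncomputable section

/-- The Fisher information of a law `ν` on the line: `∫ p'² / p` over `{p > 0}` if `ν` has an
absolutely continuous density `p`, and `∞` otherwise. The infimum runs over at most one `p`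
(`IsACDensity.unique`) and is `∞` over the empty family. -/
def fisherInfo (ν : Measure ℝ) : ℝ≥0∞ :=
  ⨅ (p : ℝ → ℝ) (_ : IsACDensity ν p),
    ∫⁻ x in {x | 0 < p x}, ENNReal.ofReal (deriv p x ^ 2 / p x)

/-- The relative Fisher information of a law `ν` with respect to the normal law `N(a, v)`
with density `φ`: `∫ (p'/p - φ'/φ)² p` over `{p > 0}` if `ν` has an absolutely continuous
density `p`, and `∞` otherwise. -/
def relFisherInfo (ν : Measure ℝ) (a : ℝ) (v : ℝ≥0) : ℝ≥0∞ :=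
  ⨅ (p : ℝ → ℝ) (_ : IsACDensity ν p),
    ∫⁻ x in {x | 0 < p x}, ENNReal.ofReal
      ((deriv p x / p x - deriv (gaussianPDFReal a v) x / gaussianPDFReal a v x) ^ 2 * p x)

/-- The `r`-th cumulant `i⁻ʳ (dʳ/dtʳ) log E e^{itX} |_{t = 0}` of a law `ν` on the line.
The derivative is taken for the principal branch of the logarithm (the characteristic function is
close to `1` near `t = 0`); the number is real whenever the `r`-th absolute moment is finite. -/
def cumulant (ν : Measure ℝ) (r : ℕ) : ℝ :=
  ((Complex.I ^ r)⁻¹ * iteratedDeriv r (fun t : ℝ => Complex.log (charFun ν t)) 0).re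

/-- The normalized sum `Z_n = (X_1 + ⋯ + X_n) / √n`; the sequence is indexed from `0`, so that
`X i` is the variable `X_{i+1}`. -/
def normalizedSum {Ω : Type*} (X : ℕ → Ω → ℝ) (n : ℕ) (ω : Ω) : ℝ :=
  (∑ i ∈ Finset.range n, X i ω) / √(n : ℝ)

end

/-! Write `f` for the characteristic function of X_1 and ε = n^{-1/2}. Finite Fisher information of
one normalized sum makes the derivative of its density integrable, so |t| |f(t)|^{n₀} is bounded
(`exists_abs_mul_norm_charFun_le`). Hence |f| stays below some q < 1 off every neighbourhood of 0
(`exists_norm_charFun_le_lt_one`), and f(εt)^n is negligible for |t| ≥ δ√n. For smaller |t|, n log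
f(εt) = -t²/2 + A(t) + nR(εt), where A collects the cumulants of orders k to s and R vanishes at 0
together with its derivatives up to order s. Replacing exp(A) by a Taylor polynomial leaves an error
whose derivatives up to order s, even after multiplication by t², are o(ε^{s-2}) times a fixed
integrable function (`exists_jetBound_edgeworthDiff`). Fourier inversion then gives the density p =
φ(1 + Q) + E, where Q = ε^{k-2} B(ε, x) with B a polynomial, B(0, x) = (γ_k/k!) H_k(x), and E, E',
E'' are at most d/(1 + |x|^s) with d = o(ε^{s-2}) (`eventually_exists_isACDensity`).

Since φ'/φ = -x, the integrand of the relative Fisher information is (φQ' + E' + xE)²/p. For |x| ≤ T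
the Gaussian part dominates E, and the integrand is φQ'²(1 - Q) up to small errors. For |x| ≥ T
there is no lower bound on p; Landau's inequality for nonnegative functions
(`sq_deriv_le_of_nonneg`) controls p'²/p by p'' and x²p. The error E enters x²p as d/|x|^{s-2},
whose tail integral is of order d/T^{s-3}. With T of order √(log n) (`eventually_exists_cutoff`)
this is the little-o term, and all other errors fit below it or below n^{-(k-1)}
(`exists_abs_integral_fisher_sub_le`, `fisher_error_le`).

The main term ∫ φQ'²(1 - Q) is ε^{2(k-2)} times a polynomial in ε. The symmetry (ε, x) → (-ε, -x)
makes that polynomial even, so it differs from its value at 0 by O(ε²), whence O(n^{-(k-1)}). The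
value at 0 is (γ_k/k!)² ∫ φH_k'² = γ_k²/(k-1)! (`exists_abs_edgeworth_fisher_sub_le`). Keeping the
factor 1 - Q matters: for k = 3 the cubic term is of order ε³, and only parity removes it. -/

/-! ### Finite Fisher information and decay of the characteristic function. -/

theorem IsACDensity.continuous {ν : Measure ℝ} {p : ℝ → ℝ} (hp : IsACDensity ν p) :
    Continuous p := by
  refine continuous_iff_continuousAt.2 fun x => ?_
  have h := (hp.absCont (x - 1) (x + 1)).uniformContinuousOn.continuousOn
  rw [Set.uIcc_of_le (by linarith)] at h
  exact h.continuousAt (Icc_mem_nhds (by linarith) (by linarith))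

theorem IsACDensity.integrable {ν : Measure ℝ} [IsFiniteMeasure ν] {p : ℝ → ℝ}
    (hp : IsACDensity ν p) : Integrable p := by
  refine ⟨hp.continuous.aestronglyMeasurable, ?_⟩
  rw [hasFiniteIntegral_iff_ofReal (ae_of_all _ hp.nonneg)]
  have h : ν Set.univ = ∫⁻ x, ENNReal.ofReal (p x) := by
    conv_lhs => rw [hp.eq_withDensity]
    simp
  rw [← h]
  exact measure_lt_top ν _

theorem IsACDensity.deriv_eq_zero {ν : Measure ℝ} {p : ℝ → ℝ} (hp : IsACDensity ν p) {x : ℝ}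
    (hx : p x = 0) : deriv p x = 0 :=
  IsLocalMin.deriv_eq_zero (Eventually.of_forall fun y => by rw [hx]; exact hp.nonneg y)

/-- Where p > 0, |p'| ≤ p'²/p + p by the arithmetic-geometric mean inequality. Where p = 0 the point
is a minimum and p' = 0, so restricting the hypothesis to {p > 0} loses nothing. -/
theorem IsACDensity.integrable_deriv {ν : Measure ℝ} [IsFiniteMeasure ν] {p : ℝ → ℝ}
    (hp : IsACDensity ν p)
    (hfin : ∫⁻ x in {x | 0 < p x}, ENNReal.ofReal (deriv p x ^ 2 / p x) < ∞) :
    Integrable (deriv p) := by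
  have hmeas : Measurable (fun x => deriv p x ^ 2 / p x) :=
    ((measurable_deriv p).pow_const 2).div hp.continuous.measurable
  have hInt : Integrable (fun x => deriv p x ^ 2 / p x) := by
    refine ⟨hmeas.aestronglyMeasurable, ?_⟩
    rw [hasFiniteIntegral_iff_ofReal (ae_of_all _ fun x => div_nonneg (sq_nonneg _) (hp.nonneg x))]
    rwa [setLIntegral_eq_of_support_subset] at hfin
    intro x hx
    by_contra h
    have h0 : p x = 0 := le_antisymm (not_lt.1 h) (hp.nonneg x)
    simp [h0] at hx
  refine (hInt.add hp.integrable).mono' (measurable_deriv p).aestronglyMeasurable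
    (ae_of_all _ fun x => ?_)
  rcases (hp.nonneg x).eq_or_lt with h0 | h0
  · simp [hp.deriv_eq_zero h0.symm, ← h0]
  · simp only [Pi.add_apply, Real.norm_eq_abs]
    rw [← sq_abs]
    have h1 : |deriv p x| ^ 2 / p x * p x = |deriv p x| ^ 2 := by field_simp
    have h2 : 0 ≤ |deriv p x| ^ 2 / p x := by positivity
    nlinarith [abs_nonneg (deriv p x), sq_nonneg (|deriv p x| / p x - 1), h1, h2,
      sq_nonneg (|deriv p x| - p x), sq_nonneg (|deriv p x| ^ 2 / p x - p x)]

/-- The inequality p(x) ≤ p(y) + ∫|p'| is averaged over y in [0, 1]. -/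
theorem IsACDensity.le_of_integrable_deriv {ν : Measure ℝ} [IsFiniteMeasure ν] {p : ℝ → ℝ}
    (hp : IsACDensity ν p) (hd : Integrable (deriv p)) (x : ℝ) :
    p x ≤ (∫ y, p y) + ∫ y, |deriv p y| := by
  have hle : ∀ y, p x ≤ p y + ∫ y, |deriv p y| := fun y => by
    have h1 := (hp.absCont y x).integral_deriv_eq_sub
    have h2 : |∫ z in y..x, deriv p z| ≤ ∫ y, |deriv p y| := by
      rw [intervalIntegral.abs_intervalIntegral_eq]
      refine (abs_integral_le_integral_abs).trans ?_
      exact setIntegral_le_integral hd.abs (ae_of_all _ fun _ => abs_nonneg _)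
    rw [h1] at h2
    linarith [(abs_le.1 h2).2]
  have h3 : ∫ y in (0 : ℝ)..1, (p x - ∫ y, |deriv p y|) ≤ ∫ y in (0 : ℝ)..1, p y :=
    intervalIntegral.integral_mono_on zero_le_one (by simp)
      (hp.continuous.intervalIntegrable _ _) fun y _ => by linarith [hle y]
  have h4 : ∫ y in (0 : ℝ)..1, p y ≤ ∫ y, p y := by
    rw [intervalIntegral.integral_of_le zero_le_one]
    exact setIntegral_le_integral hp.integrable (ae_of_all _ hp.nonneg)
  simp at h3
  linarith

/-- Integration by parts on [-N, N]. The boundary terms are only bounded by the supremum of p, not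
shown to vanish: two of them and the remaining integral give the constants 2 and 3. -/
theorem IsACDensity.abs_integral_mul_deriv_le {ν : Measure ℝ} [IsFiniteMeasure ν] {p : ℝ → ℝ}
    (hp : IsACDensity ν p) (hd : Integrable (deriv p)) {g : ℝ → ℝ} {c : ℝ}
    (hg : ContDiff ℝ 1 g) (hgc : ∀ x, |g x| ≤ c) (hInt : Integrable fun x => p x * deriv g x) :
    |∫ x, p x * deriv g x| ≤ c * (2 * (∫ y, p y) + 3 * ∫ y, |deriv p y|) := by
  have hc : 0 ≤ c := (abs_nonneg _).trans (hgc 0)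
  have hlim := intervalIntegral_tendsto_integral hInt tendsto_neg_atTop_atBot tendsto_id
  refine le_of_tendsto hlim.abs (Eventually.of_forall fun N => ?_)
  rw [(hp.absCont _ _).integral_mul_deriv_eq_deriv_mul
    (hg.contDiffOn.absolutelyContinuousOnInterval)]
  have hb := hp.le_of_integrable_deriv hd
  have h1 : ∀ y, |p y * g y| ≤ c * ((∫ y, p y) + ∫ y, |deriv p y|) := fun y => by
    rw [abs_mul, abs_of_nonneg (hp.nonneg y), mul_comm]
    exact mul_le_mul (hgc y) (hb y) (hp.nonneg y) hc
  have h2 : |∫ x in -N..N, deriv p x * g x| ≤ c * ∫ y, |deriv p y| := by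
    rw [intervalIntegral.abs_intervalIntegral_eq]
    refine (abs_integral_le_integral_abs).trans ?_
    have hi : Integrable (fun x => deriv p x * g x) :=
      hd.mul_bdd (c := c) hg.continuous.aestronglyMeasurable (ae_of_all _ hgc)
    refine (setIntegral_le_integral hi.abs (ae_of_all _ fun _ => abs_nonneg _)).trans ?_
    rw [← integral_const_mul]
    refine integral_mono hi.abs (hd.abs.const_mul c) fun x => ?_
    simp only [abs_mul]
    rw [mul_comm]
    exact mul_le_mul_of_nonneg_right (hgc x) (abs_nonneg _)
  have h3 := h1 N
  have h4 := h1 (-N)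
  simp only [id]
  rw [abs_le] at *
  constructor <;> nlinarith

/-- A law with finite Fisher information has a characteristic function of order `1 / |t|`. -/
theorem exists_abs_mul_norm_charFun_le {ν : Measure ℝ} [IsProbabilityMeasure ν]
    (h : fisherInfo ν < ∞) : ∃ C : ℝ, ∀ t : ℝ, |t| * ‖charFun ν t‖ ≤ C := by
  simp only [fisherInfo, iInf_lt_iff] at h
  obtain ⟨p, hp, hfin⟩ := h
  have hd := hp.integrable_deriv hfin
  -- The real and imaginary parts each contribute one bound, with test functions sin(tx)/t and
  -- -cos(tx)/t of size 1/|t|.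
  refine ⟨2 * (2 * (∫ y, p y) + 3 * ∫ y, |deriv p y|), fun t => ?_⟩
  rcases eq_or_ne t 0 with rfl | ht
  · have h1 : 0 ≤ ∫ y, p y := integral_nonneg hp.nonneg
    have h2 : 0 ≤ ∫ y, |deriv p y| := integral_nonneg fun _ => abs_nonneg _
    simp only [abs_zero, zero_mul]; positivity
  have hcf : charFun ν t = ∫ x, (p x : ℂ) * Complex.exp (t * x * Complex.I) := by
    rw [charFun_apply_real]
    conv_lhs => rw [hp.eq_withDensity]
    rw [integral_withDensity_eq_integral_toReal_smul
      hp.continuous.measurable.ennreal_ofReal (ae_of_all _ fun _ => ENNReal.ofReal_lt_top)]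
    refine integral_congr_ae (ae_of_all _ fun x => ?_)
    simp [ENNReal.toReal_ofReal (hp.nonneg x)]
  have hI : Integrable fun x => (p x : ℂ) * Complex.exp (t * x * Complex.I) := by
    refine hp.integrable.ofReal.mul_bdd (c := 1) (by fun_prop) (ae_of_all _ fun x => ?_)
    have := Complex.norm_exp_ofReal_mul_I (t * x)
    push_cast at this
    rw [this]
  have hexp : ∀ x : ℝ, Complex.exp (t * x * Complex.I) = Real.cos (t * x) + Real.sin (t * x) * Complex.I := by
    intro x
    rw [Complex.exp_mul_I]
    push_cast
    rfl
  have hre : (charFun ν t).re = ∫ x, p x * Real.cos (t * x) := by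
    rw [hcf, ← RCLike.re_eq_complex_re, ← integral_re hI]
    refine integral_congr_ae (ae_of_all _ fun x => ?_)
    simp [hexp, -Complex.ofReal_cos, -Complex.ofReal_sin]
  have him : (charFun ν t).im = ∫ x, p x * Real.sin (t * x) := by
    rw [hcf, ← RCLike.im_eq_complex_im, ← integral_im hI]
    refine integral_congr_ae (ae_of_all _ fun x => ?_)
    simp [hexp, -Complex.ofReal_cos, -Complex.ofReal_sin]
  have hds : deriv (fun x => Real.sin (t * x) / t) = fun x => Real.cos (t * x) := by
    ext x
    have := (((hasDerivAt_id x).const_mul t).sin).div_const t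
    refine (this.deriv).trans ?_
    simp; field_simp
  have hdc : deriv (fun x => -Real.cos (t * x) / t) = fun x => Real.sin (t * x) := by
    ext x
    have := (((hasDerivAt_id x).const_mul t).cos).neg.div_const t
    refine (this.deriv).trans ?_
    simp; field_simp
  have ht' : 0 < |t| := abs_pos.2 ht
  have h1 := hp.abs_integral_mul_deriv_le hd (g := fun x => Real.sin (t * x) / t) (c := 1 / |t|)
    (by fun_prop) (fun x => by
      rw [abs_div]; gcongr; exact Real.abs_sin_le_one _) (by
      rw [hds]
      exact hp.integrable.mul_bdd (c := 1) (by fun_prop) (ae_of_all _ fun x => Real.abs_cos_le_one _))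
  have h2 := hp.abs_integral_mul_deriv_le hd (g := fun x => -Real.cos (t * x) / t) (c := 1 / |t|)
    (by fun_prop) (fun x => by
      rw [abs_div, abs_neg]; gcongr; exact Real.abs_cos_le_one _) (by
      rw [hdc]
      exact hp.integrable.mul_bdd (c := 1) (by fun_prop) (ae_of_all _ fun x => Real.abs_sin_le_one _))
  rw [hds, ← hre] at h1
  rw [hdc, ← him] at h2
  have h3 := Complex.norm_le_abs_re_add_abs_im (charFun ν t)
  calc |t| * ‖charFun ν t‖ ≤ |t| * (1 / |t| * (2 * (∫ y, p y) + 3 * ∫ y, |deriv p y|)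
        + 1 / |t| * (2 * (∫ y, p y) + 3 * ∫ y, |deriv p y|)) := by gcongr; linarith
    _ = _ := by field_simp; ring

/-! ### Characteristic functions away from the origin. -/

/-- Pointwise, 1 - cos 2θ = 2(1 - cos θ)(1 + cos θ) ≤ 4(1 - cos θ). -/
theorem one_sub_re_charFun_two_mul_le (ν : Measure ℝ) [IsProbabilityMeasure ν] (t : ℝ) :
    1 - (charFun ν (2 * t)).re ≤ 4 * (1 - (charFun ν t).re) := by
  have hI : ∀ t : ℝ, Integrable (fun x : ℝ => Complex.exp (t * x * Complex.I)) ν := fun t => by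
    refine Integrable.of_bound (by fun_prop) 1 (ae_of_all _ fun x => ?_)
    have := Complex.norm_exp_ofReal_mul_I (t * x)
    push_cast at this
    rw [this]
  have hre : ∀ t : ℝ, (charFun ν t).re = ∫ x, Real.cos (t * x) ∂ν := fun t => by
    rw [charFun_apply_real, ← RCLike.re_eq_complex_re, ← integral_re (hI t)]
    refine integral_congr_ae (ae_of_all _ fun x => ?_)
    have : Complex.exp (t * x * Complex.I) = Real.cos (t * x) + Real.sin (t * x) * Complex.I := by
      rw [Complex.exp_mul_I]
      push_cast
      rfl
    simp [this, -Complex.ofReal_cos, -Complex.ofReal_sin]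
  have hc : ∀ t : ℝ, Integrable (fun x : ℝ => Real.cos (t * x)) ν := fun t =>
    Integrable.of_bound (by fun_prop) 1 (ae_of_all _ fun x => Real.abs_cos_le_one _)
  have h1 : ∫ x, (1 - Real.cos (2 * t * x)) ∂ν ≤ ∫ x, 4 * (1 - Real.cos (t * x)) ∂ν := by
    refine integral_mono ((integrable_const _).sub (hc _))
      (((integrable_const _).sub (hc _)).const_mul 4) fun x => ?_
    have : Real.cos (2 * t * x) = 2 * Real.cos (t * x) ^ 2 - 1 := by
      rw [mul_assoc, Real.cos_two_mul]
    simp only [this]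
    nlinarith [sq_nonneg (1 - Real.cos (t * x))]
  rw [integral_const_mul, integral_sub (integrable_const _) (hc _),
    integral_sub (integrable_const _) (hc _)] at h1
  simp at h1
  rw [hre, hre]
  linarith

/-- Symmetrization: |f|² is the characteristic function of the difference of two independent copies,
and the previous inequality applies to it. -/
theorem one_sub_norm_charFun_sq_two_mul_le (μ : Measure ℝ) [IsProbabilityMeasure μ] (t : ℝ) :
    1 - ‖charFun μ (2 * t)‖ ^ 2 ≤ 4 * (1 - ‖charFun μ t‖ ^ 2) := by
  have : IsProbabilityMeasure (μ.map (fun x => -1 * x)) :=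
    Measure.isProbabilityMeasure_map (by fun_prop)
  have h : ∀ t : ℝ, (charFun (μ ∗ μ.map (fun x => -1 * x)) t).re = ‖charFun μ t‖ ^ 2 := fun t => by
    rw [charFun_conv, charFun_map_mul, neg_one_mul, charFun_neg, Complex.mul_conj,
      Complex.normSq_eq_norm_sq]
    exact Complex.ofReal_re _
  rw [← h, ← h]
  exact one_sub_re_charFun_two_mul_le _ _

/-- A characteristic function with decay at infinity is bounded away from `1` in modulus off any
neighbourhood of the origin. -/
theorem exists_norm_charFun_le_lt_one (μ : Measure ℝ) [IsProbabilityMeasure μ] {m : ℕ} {C : ℝ}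
    (hC : ∀ t : ℝ, |t| * ‖charFun μ t‖ ^ m ≤ C) {δ : ℝ} (hδ : 0 < δ) :
    ∃ q : ℝ, 0 < q ∧ q < 1 ∧ ∀ t : ℝ, δ ≤ |t| → ‖charFun μ t‖ ≤ q := by
  have hC0 : 0 ≤ C := by simpa using hC 0
  -- After k doublings every |t| ≥ δ is so large that the decay hypothesis forces modulus at most
  -- 1/2; the doubling inequality then carries this back to t.
  obtain ⟨k, hk⟩ := pow_unbounded_of_one_lt (C * 2 ^ m / δ) (one_lt_two)
  have hiter : ∀ (j : ℕ) (t : ℝ),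
      1 - ‖charFun μ (2 ^ j * t)‖ ^ 2 ≤ 4 ^ j * (1 - ‖charFun μ t‖ ^ 2) := by
    intro j
    induction j with
    | zero => intro t; simp
    | succ j ih =>
      intro t
      have h1 := one_sub_norm_charFun_sq_two_mul_le μ (2 ^ j * t)
      have h2 := ih t
      rw [show (2 : ℝ) ^ (j + 1) * t = 2 * (2 ^ j * t) by ring]
      calc _ ≤ _ := h1
        _ ≤ 4 * (4 ^ j * (1 - ‖charFun μ t‖ ^ 2)) := by gcongr
        _ = _ := by ring
  have hsmall : ∀ t : ℝ, δ ≤ |t| → ‖charFun μ (2 ^ k * t)‖ ≤ 1 / 2 := fun t ht => by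
    by_contra hlt
    push Not at hlt
    have h1 := hC (2 ^ k * t)
    rw [abs_mul, abs_of_pos (by positivity : (0 : ℝ) < 2 ^ k)] at h1
    have h2 : (1 / 2 : ℝ) ^ m ≤ ‖charFun μ (2 ^ k * t)‖ ^ m := by gcongr
    have h3 : 2 ^ k * δ * (1 / 2) ^ m ≤ C := by
      refine le_trans ?_ h1
      gcongr
    rw [div_lt_iff₀ hδ] at hk
    have h4 : (2 : ℝ) ^ m * (1 / 2) ^ m = 1 := by rw [← mul_pow]; norm_num
    have h5 : (0 : ℝ) < (1 / 2) ^ m := by positivity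
    nlinarith
  -- From |f(2^k t)|² ≤ 1/4 and k doublings, 3/4 ≤ 4^k (1 - |f(t)|²).
  refine ⟨√(1 - 3 / 4 / 4 ^ k), ?_, ?_, fun t ht => ?_⟩
  · apply Real.sqrt_pos.2
    have : (1 : ℝ) ≤ 4 ^ k := one_le_pow₀ (by norm_num)
    have : 3 / 4 / (4 : ℝ) ^ k ≤ 3 / 4 := div_le_self (by norm_num) this
    linarith
  · rw [Real.sqrt_lt' one_pos]
    have : 0 < 3 / 4 / (4 : ℝ) ^ k := by positivity
    linarith
  · apply Real.le_sqrt_of_sq_le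
    have h1 := hiter k t
    have h2 := hsmall t ht
    have h3 : ‖charFun μ (2 ^ k * t)‖ ^ 2 ≤ 1 / 4 := by
      calc _ ≤ (1 / 2 : ℝ) ^ 2 := by gcongr
        _ = 1 / 4 := by norm_num
    have h4 : 3 / 4 / (4 : ℝ) ^ k ≤ 1 - ‖charFun μ t‖ ^ 2 := by
      rw [div_le_iff₀' (by positivity)]
      linarith
    linarith

/-! ### A calculus of derivative bounds at a point, and its uniform version. -/

/-- The derivatives of `f` at `t` up to order `m` are bounded by `a`. -/
def JetBound (m : ℕ) (f : ℝ → ℂ) (t a : ℝ) : Prop :=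
  ∀ j ≤ m, ‖iteratedDeriv j f t‖ ≤ a

namespace JetBound

variable {m : ℕ} {f g : ℝ → ℂ} {t a b : ℝ}

theorem nonneg (h : JetBound m f t a) : 0 ≤ a := (norm_nonneg _).trans (h 0 (Nat.zero_le _))

theorem norm_le (h : JetBound m f t a) : ‖f t‖ ≤ a := by
  simpa using h 0 (Nat.zero_le _)

theorem mono (h : JetBound m f t a) (hab : a ≤ b) : JetBound m f t b :=
  fun j hj => (h j hj).trans hab

theorem mono_order {k : ℕ} (h : JetBound m f t a) (hk : k ≤ m) : JetBound k f t a :=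
  fun j hj => h j (hj.trans hk)

theorem deriv (h : JetBound (m + 1) f t a) : JetBound m (deriv f) t a := fun j hj => by
  rw [← iteratedDeriv_succ']
  exact h (j + 1) (by omega)

theorem add (hf : ContDiff ℝ m f) (hg : ContDiff ℝ m g) (h : JetBound m f t a)
    (h' : JetBound m g t b) : JetBound m (fun u => f u + g u) t (a + b) := fun j hj => by
  have hj' : (j : WithTop ℕ∞) ≤ m := by exact_mod_cast hj
  rw [iteratedDeriv_fun_add (hf.of_le hj').contDiffAt (hg.of_le hj').contDiffAt]
  exact (norm_add_le _ _).trans (add_le_add (h j hj) (h' j hj))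

theorem sub (hf : ContDiff ℝ m f) (hg : ContDiff ℝ m g) (h : JetBound m f t a)
    (h' : JetBound m g t b) : JetBound m (fun u => f u - g u) t (a + b) := fun j hj => by
  have hj' : (j : WithTop ℕ∞) ≤ m := by exact_mod_cast hj
  rw [iteratedDeriv_fun_sub (hf.of_le hj').contDiffAt (hg.of_le hj').contDiffAt]
  exact (norm_sub_le _ _).trans (add_le_add (h j hj) (h' j hj))

theorem const_mul (c : ℂ) (h : JetBound m f t a) :
    JetBound m (fun u => c * f u) t (‖c‖ * a) := fun j hj => by
  rw [iteratedDeriv_const_mul_field, norm_mul]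
  exact mul_le_mul_of_nonneg_left (h j hj) (norm_nonneg _)

theorem mul (hf : ContDiff ℝ m f) (hg : ContDiff ℝ m g) (h : JetBound m f t a)
    (h' : JetBound m g t b) : JetBound m (fun u => f u * g u) t (2 ^ m * a * b) := fun j hj => by
  have hj' : (j : WithTop ℕ∞) ≤ m := by exact_mod_cast hj
  rw [iteratedDeriv_fun_mul (hf.of_le hj').contDiffAt (hg.of_le hj').contDiffAt]
  refine (norm_sum_le _ _).trans ?_
  calc ∑ i ∈ Finset.range (j + 1),
        ‖(j.choose i : ℂ) * iteratedDeriv i f t * iteratedDeriv (j - i) g t‖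
      ≤ ∑ i ∈ Finset.range (j + 1), (j.choose i : ℝ) * (a * b) := by
        refine Finset.sum_le_sum fun i hi => ?_
        rw [norm_mul, norm_mul, mul_assoc, Complex.norm_natCast]
        have hi' : i ≤ j := by simpa [Nat.lt_succ_iff] using hi
        exact mul_le_mul_of_nonneg_left (mul_le_mul (h i (hi'.trans hj))
          (h' (j - i) ((Nat.sub_le _ _).trans hj)) (norm_nonneg _) h.nonneg) (Nat.cast_nonneg _)
    _ = 2 ^ j * (a * b) := by
        rw [← Finset.sum_mul]
        congr 1
        exact_mod_cast Nat.sum_range_choose j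
    _ ≤ 2 ^ m * (a * b) := by
        have := mul_nonneg h.nonneg h'.nonneg
        gcongr
        norm_num
    _ = _ := by ring

theorem one (m : ℕ) (t : ℝ) : JetBound m (fun _ => 1) t 1 := fun j _ => by
  rw [iteratedDeriv_const]
  split <;> simp

theorem pow (hf : ContDiff ℝ m f) (h : JetBound m f t a) (n : ℕ) :
    JetBound m (fun u => f u ^ n) t ((2 ^ m * a) ^ n) := by
  induction n with
  | zero => simpa using one m t
  | succ n ih =>
    have := ih.mul (hf.pow n) hf h
    simp only [pow_succ]
    exact this.mono (le_of_eq (by ring))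

theorem ofReal (m : ℕ) (t : ℝ) : JetBound m (fun u : ℝ => (u : ℂ)) t (1 + |t|) := fun j _ => by
  rcases j with _ | _ | j
  · simp
  · have : _root_.deriv (fun u : ℝ => (u : ℂ)) t = 1 := (Complex.ofRealCLM.hasDerivAt).deriv
    rw [iteratedDeriv_one, this]
    simp
  · have : _root_.deriv (fun u : ℝ => (u : ℂ)) = fun _ => 1 := by
      ext t
      exact (Complex.ofRealCLM.hasDerivAt).deriv
    rw [iteratedDeriv_succ', this, iteratedDeriv_const]
    simp; positivity

/-- Derivative bounds for a solution of a first order linear equation. -/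
theorem of_deriv_eq {y c w : ℝ → ℂ} (hy : ContDiff ℝ m y) (hc : ContDiff ℝ m c)
    (hw : ContDiff ℝ m w) (heq : _root_.deriv y =ᶠ[𝓝 t] fun u => c u * y u + w u)
    (h : JetBound m c t a) (h' : JetBound m w t b) :
    JetBound (m + 1) y t ((1 + 2 ^ m * a) ^ (m + 1) * (‖y t‖ + b)) := by
  have ha := h.nonneg
  have hb := h'.nonneg
  have hone : 1 ≤ 1 + 2 ^ m * a := by
    have : 0 ≤ 2 ^ m * a := by positivity
    linarith
  -- Each differentiation of y' = cy + w expresses one more derivative of y through lower ones, at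
  -- the cost of one factor 1 + 2^m a. Only the value of y at t enters as initial information.
  have key : ∀ j ≤ m + 1, JetBound j y t ((1 + 2 ^ m * a) ^ j * (‖y t‖ + b)) := by
    intro j
    induction j with
    | zero =>
      intro _ i hi
      obtain rfl : i = 0 := by omega
      simpa using hb
    | succ j ih =>
      intro hj i hi
      have ih' := ih (by omega)
      have hjm : j ≤ m := by omega
      have hj' : (j : WithTop ℕ∞) ≤ m := by exact_mod_cast hjm
      rcases i with _ | i
      · refine (ih' 0 (Nat.zero_le _)).trans ?_
        gcongr
        omega
      · have h1 := ((h.mono_order hjm).mul (hc.of_le hj') (hy.of_le hj') ih').add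
          ((hc.of_le hj').mul (hy.of_le hj')) (hw.of_le hj') (h'.mono_order hjm)
        rw [iteratedDeriv_succ', heq.iteratedDeriv_eq]
        refine (h1 i (by omega)).trans ?_
        have h2 : b ≤ (1 + 2 ^ m * a) ^ j * (‖y t‖ + b) := by
          have : 1 ≤ (1 + 2 ^ m * a) ^ j := one_le_pow₀ hone
          nlinarith [norm_nonneg (y t)]
        have h3 : (2 : ℝ) ^ j * a * ((1 + 2 ^ m * a) ^ j * (‖y t‖ + b)) ≤
            2 ^ m * a * ((1 + 2 ^ m * a) ^ j * (‖y t‖ + b)) := by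
          gcongr
          norm_num
        calc _ ≤ 2 ^ m * a * ((1 + 2 ^ m * a) ^ j * (‖y t‖ + b))
              + (1 + 2 ^ m * a) ^ j * (‖y t‖ + b) := add_le_add h3 h2
          _ = _ := by ring
  exact key (m + 1) le_rfl

end JetBound

/-- Derivative bounds for the powers of a function of modulus at most one. -/
theorem JetBound.pow_of_norm_le_one {m : ℕ} {f : ℝ → ℂ} {t M : ℝ} (hf : ContDiff ℝ m f)
    (hM : JetBound m f t M) (hM1 : 1 ≤ M) (h1 : ‖f t‖ ≤ 1) :
    ∀ j ≤ m, ∀ n : ℕ, j < n →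
      JetBound j (fun u => f u ^ n) t ((2 ^ m * M * n) ^ j * ‖f t‖ ^ (n - j)) := by
  intro j
  induction j with
  | zero =>
    intro _ n _ i hi
    obtain rfl : i = 0 := by omega
    simp
  | succ j ih =>
    intro hj n hn
    obtain ⟨n, rfl⟩ : ∃ k, n = k + 1 := ⟨n - 1, by omega⟩
    have hc : (1 : ℝ) ≤ 2 ^ m * M * (n + 1 : ℕ) := by
      have h2 : (1 : ℝ) ≤ 2 ^ m := one_le_pow₀ (by norm_num)
      have h3 : (1 : ℝ) ≤ (n + 1 : ℕ) := by exact_mod_cast Nat.succ_le_succ (Nat.zero_le n)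
      exact one_le_mul_of_one_le_of_one_le (one_le_mul_of_one_le_of_one_le h2 hM1) h3
    have hc0 : (0 : ℝ) ≤ 2 ^ m * M * (n + 1 : ℕ) := zero_le_one.trans hc
    intro i hi
    rcases i with _ | i
    · simp only [iteratedDeriv_zero, norm_pow]
      calc ‖f t‖ ^ (n + 1) ≤ ‖f t‖ ^ (n + 1 - (j + 1)) :=
            pow_le_pow_of_le_one (norm_nonneg _) h1 (by omega)
        _ ≤ _ := le_mul_of_one_le_left (by positivity) (one_le_pow₀ hc)
    -- Each derivative of the power costs a factor proportional to n and one power of |f|; the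
    -- remaining powers keep the exponential smallness.
    · have hd : _root_.deriv (fun u => f u ^ (n + 1)) =
          fun u => ((n + 1 : ℕ) : ℂ) * (f u ^ n * _root_.deriv f u) := by
        ext u
        have hdf : HasDerivAt f (_root_.deriv f u) u :=
          (hf.differentiable (by exact_mod_cast (by omega : m ≠ 0)) u).hasDerivAt
        rw [(hdf.fun_pow (n + 1)).deriv]
        simp
        ring
      rw [iteratedDeriv_succ', hd]
      have hj1 : ((j + 1 : ℕ) : WithTop ℕ∞) ≤ m := by exact_mod_cast hj
      have hf1 : ContDiff ℝ ((j + 1 : ℕ) : WithTop ℕ∞) f := hf.of_le hj1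
      have hdf : ContDiff ℝ j (_root_.deriv f) := by
        have : ContDiff ℝ ((j : WithTop ℕ∞) + 1) f := by exact_mod_cast hf1
        exact ((contDiff_succ_iff_deriv).1 this).2.2
      have hfj : ContDiff ℝ j f := hf1.of_le (by exact_mod_cast Nat.le_succ j)
      have h2 := ((ih (by omega) n (by omega)).mul (hfj.pow n) hdf
        (hM.mono_order hj).deriv).const_mul ((n + 1 : ℕ) : ℂ)
      refine (h2 i (by omega)).trans ?_
      rw [Complex.norm_natCast]
      have hM0 : 0 ≤ M := hM.nonneg
      have e : n + 1 - (j + 1) = n - j := by omega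
      rw [e]
      calc ((n + 1 : ℕ) : ℝ) * (2 ^ j * ((2 ^ m * M * n) ^ j * ‖f t‖ ^ (n - j)) * M)
          ≤ ((n + 1 : ℕ) : ℝ) * (2 ^ m * ((2 ^ m * M * (n + 1 : ℕ)) ^ j * ‖f t‖ ^ (n - j)) * M) := by
            gcongr
            · norm_num
            · omega
            · omega
        _ = _ := by ring

/-- A family of functions has derivatives up to order `m`, at given points `t i`, that are bounded
by given numbers `θ i`, up to a constant and a power of `1 + |t i|`. -/
def JetO {ι : Type*} (m : ℕ) (F : ι → ℝ → ℂ) (t θ : ι → ℝ) : Prop :=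
  ∃ (K : ℝ) (D : ℕ), 0 ≤ K ∧ ∀ i, JetBound m (F i) (t i) (K * (1 + |t i|) ^ D * θ i)

namespace JetO

variable {ι : Type*} {m : ℕ} {F G : ι → ℝ → ℂ} {t θ θ' : ι → ℝ}

theorem mono (h : JetO m F t θ) (hθ : ∀ i, θ i ≤ θ' i) : JetO m F t θ' := by
  obtain ⟨K, D, hK, h⟩ := h
  exact ⟨K, D, hK, fun i => (h i).mono (by have := hθ i; gcongr)⟩

theorem mono_order {k : ℕ} (h : JetO m F t θ) (hk : k ≤ m) : JetO k F t θ := by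
  obtain ⟨K, D, hK, h⟩ := h
  exact ⟨K, D, hK, fun i => (h i).mono_order hk⟩

theorem deriv (h : JetO (m + 1) F t θ) : JetO m (fun i => deriv (F i)) t θ := by
  obtain ⟨K, D, hK, h⟩ := h
  exact ⟨K, D, hK, fun i => (h i).deriv⟩

theorem add (hF : ∀ i, ContDiff ℝ m (F i)) (hG : ∀ i, ContDiff ℝ m (G i)) (hθ : ∀ i, 0 ≤ θ i)
    (h : JetO m F t θ) (h' : JetO m G t θ) : JetO m (fun i u => F i u + G i u) t θ := by
  obtain ⟨K, D, hK, h⟩ := h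
  obtain ⟨K', D', hK', h'⟩ := h'
  refine ⟨K + K', max D D', by positivity, fun i => ((h i).add (hF i) (hG i) (h' i)).mono ?_⟩
  have h1 : (1 : ℝ) ≤ 1 + |t i| := by linarith [abs_nonneg (t i)]
  have := hθ i
  calc K * (1 + |t i|) ^ D * θ i + K' * (1 + |t i|) ^ D' * θ i
      ≤ K * (1 + |t i|) ^ (max D D') * θ i + K' * (1 + |t i|) ^ (max D D') * θ i := by
        gcongr
        · exact le_max_left _ _
        · exact le_max_right _ _
    _ = _ := by ring

theorem mul (hF : ∀ i, ContDiff ℝ m (F i)) (hG : ∀ i, ContDiff ℝ m (G i))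
    (h : JetO m F t θ) (h' : JetO m G t θ') :
    JetO m (fun i u => F i u * G i u) t (fun i => θ i * θ' i) := by
  obtain ⟨K, D, hK, h⟩ := h
  obtain ⟨K', D', hK', h'⟩ := h'
  refine ⟨2 ^ m * K * K', D + D', by positivity,
    fun i => ((h i).mul (hF i) (hG i) (h' i)).mono (le_of_eq ?_)⟩
  ring

theorem const_mul (c : ι → ℂ) (h : JetO m F t θ) :
    JetO m (fun i u => c i * F i u) t (fun i => ‖c i‖ * θ i) := by
  obtain ⟨K, D, hK, h⟩ := h
  exact ⟨K, D, hK, fun i => ((h i).const_mul (c i)).mono (le_of_eq (by ring))⟩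

theorem pow (hF : ∀ i, ContDiff ℝ m (F i)) (h : JetO m F t θ) (n : ℕ) :
    JetO m (fun i u => F i u ^ n) t (fun i => θ i ^ n) := by
  obtain ⟨K, D, hK, h⟩ := h
  exact ⟨(2 ^ m * K) ^ n, D * n, by positivity,
    fun i => ((h i).pow (hF i) n).mono (le_of_eq (by ring))⟩

theorem sum {κ : Type*} (s : Finset κ) {F : κ → ι → ℝ → ℂ} (hθ : ∀ i, 0 ≤ θ i)
    (hF : ∀ j ∈ s, ∀ i, ContDiff ℝ m (F j i)) (h : ∀ j ∈ s, JetO m (F j) t θ) :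
    JetO m (fun i u => ∑ j ∈ s, F j i u) t θ := by
  classical
  induction s using Finset.induction_on with
  | empty =>
    refine ⟨0, 0, le_rfl, fun i j _ => ?_⟩
    simp
  | insert a s ha ih =>
    simp only [Finset.sum_insert ha]
    exact add (hF a (Finset.mem_insert_self _ _))
      (fun i => ContDiff.sum fun j hj => hF j (Finset.mem_insert_of_mem hj) i) hθ
      (h a (Finset.mem_insert_self _ _))
      (ih (fun j hj => hF j (Finset.mem_insert_of_mem hj))
        fun j hj => h j (Finset.mem_insert_of_mem hj))

theorem ofReal : JetO m (fun (_ : ι) (u : ℝ) => (u : ℂ)) t (fun _ => 1) :=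
  ⟨1, 1, zero_le_one, fun i => by simpa using JetBound.ofReal m (t i)⟩

/-- The derivatives of c grow at most polynomially, so the loss (1 + 2^m a)^{m+1} is again
polynomial in 1 + |t| and the size θ passes through unchanged. A bound for the value of y thus
upgrades to all derivatives. -/
theorem of_deriv_eq {y c w : ι → ℝ → ℂ} (hy : ∀ i, ContDiff ℝ m (y i))
    (hc : ∀ i, ContDiff ℝ m (c i)) (hw : ∀ i, ContDiff ℝ m (w i))
    (heq : ∀ i, _root_.deriv (y i) =ᶠ[𝓝 (t i)] fun u => c i u * y i u + w i u)
    (h : JetO m c t (fun _ => 1)) (h' : JetO m w t θ) (hθ : ∀ i, 0 ≤ θ i)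
    (hval : ∃ (K : ℝ) (D : ℕ), 0 ≤ K ∧ ∀ i, ‖y i (t i)‖ ≤ K * (1 + |t i|) ^ D * θ i) :
    JetO (m + 1) y t θ := by
  obtain ⟨K, D, hK, h⟩ := h
  obtain ⟨K', D', hK', h'⟩ := h'
  obtain ⟨K'', D'', hK'', h''⟩ := hval
  refine ⟨(1 + 2 ^ m * K) ^ (m + 1) * (K'' + K'), D * (m + 1) + max D' D'', by positivity,
    fun i => (JetBound.of_deriv_eq (hy i) (hc i) (hw i) (heq i) (h i) (h' i)).mono ?_⟩
  have h1 : (1 : ℝ) ≤ 1 + |t i| := by linarith [abs_nonneg (t i)]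
  have hθi := hθ i
  have hA : 1 + 2 ^ m * (K * (1 + |t i|) ^ D * 1) ≤ (1 + 2 ^ m * K) * (1 + |t i|) ^ D := by
    have : (1 : ℝ) ≤ (1 + |t i|) ^ D := one_le_pow₀ h1
    nlinarith
  have hB : ‖y i (t i)‖ + K' * (1 + |t i|) ^ D' * θ i
      ≤ (K'' + K') * (1 + |t i|) ^ (max D' D'') * θ i := by
    calc _ ≤ K'' * (1 + |t i|) ^ D'' * θ i + K' * (1 + |t i|) ^ D' * θ i := by
          gcongr; exact h'' i
      _ ≤ K'' * (1 + |t i|) ^ (max D' D'') * θ i + K' * (1 + |t i|) ^ (max D' D'') * θ i := by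
        gcongr
        · exact le_max_right _ _
        · exact le_max_left _ _
      _ = _ := by ring
  calc (1 + 2 ^ m * (K * (1 + |t i|) ^ D * 1)) ^ (m + 1)
        * (‖y i (t i)‖ + K' * (1 + |t i|) ^ D' * θ i)
      ≤ ((1 + 2 ^ m * K) * (1 + |t i|) ^ D) ^ (m + 1)
        * ((K'' + K') * (1 + |t i|) ^ (max D' D'') * θ i) := by
        gcongr
    _ = _ := by rw [mul_pow, ← pow_mul]; ring

end JetO

/-! ### Taylor expansion of the logarithm of the characteristic function. -/

/-- The logarithm is smooth only where f avoids the slit, so it is multiplied by a bump function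
equal to 1 near 0. The result is defined and smooth on the whole line, and no domains have to be
carried along. -/
theorem exists_contDiff_eq_log {s : ℕ} {f : ℝ → ℂ} (hf : ContDiff ℝ s f) (h0 : f 0 = 1) :
    ∃ (Λ : ℝ → ℂ) (δ : ℝ), 0 < δ ∧ ContDiff ℝ s Λ ∧
      ∀ u, |u| < δ → Λ u = Complex.log (f u) ∧ f u = Complex.exp (Λ u) := by
  have hopen : IsOpen (f ⁻¹' Complex.slitPlane) := Complex.isOpen_slitPlane.preimage hf.continuous
  obtain ⟨r, hr, hball⟩ := Metric.isOpen_iff.1 hopen 0 (by simp [h0])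
  let χ : ContDiffBump (0 : ℝ) := ⟨r / 3, r / 2, by positivity, by linarith⟩
  refine ⟨fun u => (χ u : ℂ) * Complex.log (f u), r / 3, by positivity, ?_, fun u hu => ?_⟩
  · rw [contDiff_iff_contDiffAt]
    intro u
    by_cases hu : u ∈ Metric.ball (0 : ℝ) r
    · refine ContDiffAt.mul ?_ 
        (((Complex.contDiffAt_log (hball hu)).restrict_scalars ℝ).comp u hf.contDiffAt)
      exact Complex.ofRealCLM.contDiff.contDiffAt.comp u χ.contDiffAt
    · have : (fun u => (χ u : ℂ) * Complex.log (f u)) =ᶠ[𝓝 u] fun _ => 0 := by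
        have hu' : r / 2 < dist u 0 := by
          simp only [Metric.mem_ball, not_lt] at hu; linarith
        have : ∀ᶠ v in 𝓝 u, r / 2 < dist v 0 :=
          (continuous_id.dist continuous_const).continuousAt.eventually_const_lt hu'
        filter_upwards [this] with v hv
        rw [χ.zero_of_le_dist hv.le]
        simp
      exact contDiffAt_const.congr_of_eventuallyEq this
  · have h1 : χ u = 1 := χ.one_of_mem_closedBall (by simpa [χ] using hu.le)
    have h2 : f u ∈ Complex.slitPlane := hball (by simp; linarith)
    simp only [h1, Complex.ofReal_one, one_mul, true_and]
    rw [Complex.exp_log (Complex.slitPlane_ne_zero h2)]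

/-- Continuity bounds the top derivative by η near 0; the mean value inequality then descends one
order at a time, each gaining a factor |u|. -/
theorem exists_norm_iteratedDeriv_le_of_zero {s : ℕ} {R : ℝ → ℂ} (hR : ContDiff ℝ s R)
    (h0 : ∀ j ≤ s, iteratedDeriv j R 0 = 0) {η : ℝ} (hη : 0 < η) :
    ∃ δ > 0, ∀ u : ℝ, |u| < δ → ∀ j ≤ s, ‖iteratedDeriv j R u‖ ≤ η * |u| ^ (s - j) := by
  have hc := hR.continuous_iteratedDeriv s le_rfl
  obtain ⟨δ, hδ, hball⟩ := Metric.continuous_iff.1 hc 0 η hη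
  refine ⟨δ, hδ, ?_⟩
  have key : ∀ i ≤ s, ∀ u : ℝ, |u| < δ → ‖iteratedDeriv (s - i) R u‖ ≤ η * |u| ^ i := by
    intro i
    induction i with
    | zero =>
      intro _ u hu
      have := hball u (by simpa using hu)
      rw [h0 s le_rfl, dist_zero_right] at this
      simpa using this.le
    | succ i ih =>
      intro hi u hu
      have hlt : s - (i + 1) < s := by omega
      have hd : Differentiable ℝ (iteratedDeriv (s - (i + 1)) R) :=
        hR.differentiable_iteratedDeriv _ (by exact_mod_cast hlt)
      have hb : ∀ v ∈ Set.uIcc 0 u, ‖_root_.deriv (iteratedDeriv (s - (i + 1)) R) v‖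
          ≤ η * |u| ^ i := fun v hv => by
        have hv' : |v| ≤ |u| := by
          have := Set.abs_sub_left_of_mem_uIcc hv
          simpa using this
        rw [← iteratedDeriv_succ, show s - (i + 1) + 1 = s - i by omega]
        refine (ih (by omega) v (hv'.trans_lt hu)).trans ?_
        gcongr
      have := Convex.norm_image_sub_le_of_norm_deriv_le (s := Set.uIcc 0 u)
        (fun x _ => hd x) hb (convex_uIcc 0 u) Set.left_mem_uIcc Set.right_mem_uIcc
      rw [h0 _ (by omega), sub_zero, sub_zero, Real.norm_eq_abs] at this
      rw [pow_succ, ← mul_assoc]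
      exact this
  intro u hu j hj
  have := key (s - j) (by omega) u hu
  rwa [show s - (s - j) = j by omega] at this

theorem iteratedDeriv_const_mul_ofReal_pow (c : ℂ) (j m : ℕ) :
    iteratedDeriv m (fun u : ℝ => c * (u : ℂ) ^ j) =
      fun u : ℝ => c * (j.descFactorial m) * (u : ℂ) ^ (j - m) := by
  induction m with
  | zero => simp
  | succ m ih =>
    rw [iteratedDeriv_succ, ih]
    ext u
    have h := (((Complex.ofRealCLM.hasDerivAt (x := u)).fun_pow (j - m)).const_mul
      (c * (j.descFactorial m))).deriv
    simp only [Complex.ofRealCLM_apply] at h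
    rw [h, Nat.descFactorial_succ, Nat.sub_sub]
    push_cast
    simp
    ring

/-- Taylor expansion with a remainder all of whose derivatives vanish at the origin. -/
theorem iteratedDeriv_sub_taylor_zero {s : ℕ} {Λ : ℝ → ℂ} (hΛ : ContDiff ℝ s Λ) {m : ℕ}
    (hm : m ≤ s) :
    iteratedDeriv m (fun u : ℝ => Λ u - ∑ j ∈ Finset.range (s + 1),
      (iteratedDeriv j Λ 0 / j.factorial) * (u : ℂ) ^ j) 0 = 0 := by
  have hm' : (m : WithTop ℕ∞) ≤ s := by exact_mod_cast hm
  have hpow : ∀ (c : ℂ) (j : ℕ), ContDiff ℝ m (fun u : ℝ => c * (u : ℂ) ^ j) := fun c j =>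
    contDiff_const.mul (Complex.ofRealCLM.contDiff.pow j)
  rw [iteratedDeriv_fun_sub (hΛ.of_le hm').contDiffAt
    (ContDiff.sum fun j _ => hpow _ j).contDiffAt,
    iteratedDeriv_fun_sum fun j _ => (hpow _ j).contDiffAt]
  simp only [iteratedDeriv_const_mul_ofReal_pow]
  rw [Finset.sum_eq_single m]
  · have : ((m.factorial : ℕ) : ℂ) ≠ 0 := by exact_mod_cast m.factorial_ne_zero
    simp [Nat.descFactorial_self]
    field_simp
    ring
  · intro j _ hjm
    rcases lt_or_gt_of_ne hjm with h | h
    · simp [Nat.descFactorial_eq_zero_iff_lt.2 h]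
    · have : j - m ≠ 0 := by omega
      simp [this]
  · intro h
    simp at h
    omega

theorem iteratedDeriv_conj {f : ℝ → ℂ} {x : ℝ} {j : ℕ} (hf : ContDiffAt ℝ j f x) :
    iteratedDeriv j (fun u => (starRingEnd ℂ) (f u)) x =
      (starRingEnd ℂ) (iteratedDeriv j f x) := by
  have h := (Complex.conjCLE : ℂ →L[ℝ] ℂ).iteratedFDeriv_comp_left hf le_rfl
  have h2 : ((Complex.conjCLE : ℂ →L[ℝ] ℂ) ∘ f) = fun u => (starRingEnd ℂ) (f u) := by
    ext u; simp
  rw [h2] at h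
  rw [iteratedDeriv, h, iteratedDeriv]
  simp

section Cumulant

variable {μ : Measure ℝ} [IsProbabilityMeasure μ]

/-- The derivatives at `0` of the logarithm of the characteristic function. -/
theorem iteratedDeriv_log_charFun_eq {s : ℕ} (hmom : MemLp id s μ) {j : ℕ} (hj : j ≤ s) :
    iteratedDeriv j (fun t : ℝ => Complex.log (charFun μ t)) 0 =
      Complex.I ^ j * (cumulant μ j : ℂ) := by
  set g : ℝ → ℂ := fun t : ℝ => Complex.log (charFun μ t) with hg
  have hf : ContDiff ℝ s (charFun μ) := contDiff_charFun hmom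
  have hf0 : charFun μ 0 = 1 := by simp
  have hslit : ∀ᶠ u in 𝓝 (0 : ℝ), charFun μ u ∈ Complex.slitPlane := by
    refine hf.continuous.continuousAt.eventually_mem (Complex.isOpen_slitPlane.mem_nhds ?_)
    simp [hf0]
  have hgC : ContDiffAt ℝ j g 0 := by
    have h1 : ContDiffAt ℝ j Complex.log (charFun μ 0) :=
      (Complex.contDiffAt_log (by simp [hf0])).restrict_scalars ℝ
    exact h1.comp (0 : ℝ) (hf.of_le (by exact_mod_cast hj)).contDiffAt
  -- Since f(-u) is the conjugate of f(u), the j-th derivative of the logarithm at 0 is i^j times a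
  -- real number, so taking the real part in `cumulant` loses nothing.
  have hsymm : (fun u => g (-u)) =ᶠ[𝓝 0] fun u => (starRingEnd ℂ) (g u) := by
    filter_upwards [hslit] with u hu
    simp only [hg, charFun_neg]
    rw [Complex.log_conj _ (Complex.slitPlane_arg_ne_pi hu)]
  have h1 : (starRingEnd ℂ) (iteratedDeriv j g 0) = (-1) ^ j * iteratedDeriv j g 0 := by
    rw [← iteratedDeriv_conj hgC, ← hsymm.iteratedDeriv_eq, iteratedDeriv_comp_neg]
    simp
  have hreal : (starRingEnd ℂ) ((Complex.I ^ j)⁻¹ * iteratedDeriv j g 0) =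
      (Complex.I ^ j)⁻¹ * iteratedDeriv j g 0 := by
    rw [map_mul, map_inv₀, map_pow, Complex.conj_I, h1, neg_pow, mul_inv]
    have : ((-1 : ℂ) ^ j)⁻¹ * (-1) ^ j = 1 := inv_mul_cancel₀ (by simp)
    linear_combination (Complex.I ^ j)⁻¹ * iteratedDeriv j g 0 * this
  have h2 : (cumulant μ j : ℂ) = (Complex.I ^ j)⁻¹ * iteratedDeriv j g 0 :=
    Complex.conj_eq_iff_re.1 hreal
  rw [h2, mul_inv_cancel_left₀ (pow_ne_zero _ Complex.I_ne_zero)]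

/-- Expansion of the logarithm of the characteristic function of a standardized law. -/
theorem exists_log_charFun_expansion {s k : ℕ} (hk3 : 3 ≤ k) (hks : k ≤ s) (hmom : MemLp id s μ)
    (hmean : ∫ x, x ∂μ = 0) (hvar : ∫ x, x ^ 2 ∂μ = 1)
    (hcum : ∀ j, 3 ≤ j → j < k → cumulant μ j = 0) :
    ∃ (Λ R : ℝ → ℂ) (δ : ℝ), 0 < δ ∧ ContDiff ℝ s Λ ∧ ContDiff ℝ s R ∧
      (∀ u, |u| < δ → charFun μ u = Complex.exp (Λ u)) ∧
      (∀ u, Λ u = -(u : ℂ) ^ 2 / 2 + ∑ j ∈ Finset.Icc k s,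
        ((cumulant μ j / j.factorial : ℝ) : ℂ) * (Complex.I * u) ^ j + R u) ∧
      ∀ j ≤ s, iteratedDeriv j R 0 = 0 := by
  have hf : ContDiff ℝ s (charFun μ) := contDiff_charFun hmom
  have hf0 : charFun μ 0 = 1 := by simp
  obtain ⟨Λ, δ, hδ, hΛ, hlog⟩ := exists_contDiff_eq_log hf hf0
  have hnhds : ∀ᶠ u in 𝓝 (0 : ℝ), |u| < δ := by
    have := Metric.ball_mem_nhds (0 : ℝ) hδ
    filter_upwards [this] with u hu
    simpa using hu
  have hℓ : ∀ j ≤ s, iteratedDeriv j Λ 0 = Complex.I ^ j * (cumulant μ j : ℂ) := fun j hj => by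
    rw [← iteratedDeriv_log_charFun_eq hmom hj]
    refine Filter.EventuallyEq.iteratedDeriv_eq _ ?_
    filter_upwards [hnhds] with u hu using (hlog u hu).1
  -- The relation f' = Λ'f and its derivative at 0 turn mean 0 and variance 1 into Λ'(0) = 0 and
  -- Λ''(0) = -1.
  have hd1 : deriv (charFun μ) =ᶠ[𝓝 0] fun u => deriv Λ u * charFun μ u := by
    filter_upwards [hnhds.eventually_nhds] with u hu
    have he : charFun μ =ᶠ[𝓝 u] fun v => Complex.exp (Λ v) := by
      filter_upwards [hu] with v hv using (hlog v hv).2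
    have hdΛ : HasDerivAt Λ (deriv Λ u) u :=
      (hΛ.differentiable (by exact_mod_cast (by omega : s ≠ 0)) u).hasDerivAt
    rw [he.deriv_eq, hdΛ.cexp.deriv, he.eq_of_nhds, mul_comm]
  have hm1 : deriv (charFun μ) 0 = 0 := by
    rw [← iteratedDeriv_one, iteratedDeriv_charFun_zero
      (hmom.mono_exponent (by exact_mod_cast (by omega : 1 ≤ s)))]
    simp [hmean]
  have hm2 : deriv (deriv (charFun μ)) 0 = -1 := by
    have : iteratedDeriv 2 (charFun μ) 0 = deriv (deriv (charFun μ)) 0 := by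
      rw [iteratedDeriv_succ, iteratedDeriv_one]
    rw [← this, iteratedDeriv_charFun_zero
      (hmom.mono_exponent (by exact_mod_cast (by omega : 2 ≤ s)))]
    simp [hvar]
  have hΛ0 : Λ 0 = 0 := by rw [(hlog 0 (by simpa using hδ)).1, hf0, Complex.log_one]
  have hΛ1 : deriv Λ 0 = 0 := by
    have := hd1.eq_of_nhds
    rw [hm1, hf0, mul_one] at this
    exact this.symm
  have hΛ2 : deriv (deriv Λ) 0 = -1 := by
    have h1 := hd1.deriv_eq
    have hΛ' : DifferentiableAt ℝ (deriv Λ) 0 := by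
      have := hΛ.differentiable_iteratedDeriv 1 (by exact_mod_cast (by omega : 1 < s)) 0
      rwa [iteratedDeriv_one] at this
    have hfd : DifferentiableAt ℝ (charFun μ) 0 :=
      hf.differentiable (by exact_mod_cast (by omega : s ≠ 0)) 0
    rw [deriv_fun_mul hΛ' hfd, hm2, hm1, hf0] at h1
    simpa using h1.symm
  let R : ℝ → ℂ := fun u => Λ u - ∑ j ∈ Finset.range (s + 1),
      (iteratedDeriv j Λ 0 / j.factorial) * (u : ℂ) ^ j
  refine ⟨Λ, R, δ, hδ, hΛ, ?_, fun u hu => (hlog u hu).2, fun u => ?_,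
    fun j hj => iteratedDeriv_sub_taylor_zero hΛ hj⟩
  · exact hΛ.sub (ContDiff.sum fun j _ => contDiff_const.mul (Complex.ofRealCLM.contDiff.pow j))
  · have hsum : ∑ j ∈ Finset.range (s + 1), (iteratedDeriv j Λ 0 / j.factorial) * (u : ℂ) ^ j =
        -(u : ℂ) ^ 2 / 2 + ∑ j ∈ Finset.Icc k s,
        ((cumulant μ j / j.factorial : ℝ) : ℂ) * (Complex.I * u) ^ j := by
      rw [Finset.range_eq_Ico, Finset.sum_eq_sum_Ico_succ_bot (by omega),
        Finset.sum_eq_sum_Ico_succ_bot (by omega), Finset.sum_eq_sum_Ico_succ_bot (by omega)]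
      have h2 : iteratedDeriv 2 Λ 0 = -1 := by
        rw [iteratedDeriv_succ, iteratedDeriv_one, hΛ2]
      have hrest : ∑ j ∈ Finset.Ico (0 + 1 + 1 + 1) (s + 1),
          (iteratedDeriv j Λ 0 / j.factorial) * (u : ℂ) ^ j = ∑ j ∈ Finset.Icc k s,
          ((cumulant μ j / j.factorial : ℝ) : ℂ) * (Complex.I * u) ^ j := by
        rw [← Finset.sum_subset (s₁ := Finset.Icc k s)]
        · refine Finset.sum_congr rfl fun j hj => ?_
          rw [hℓ j (Finset.mem_Icc.1 hj).2]
          push_cast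
          ring
        · intro j hj
          simp only [Finset.mem_Icc, Finset.mem_Ico] at *
          omega
        · intro j hj hj'
          simp only [Finset.mem_Icc, Finset.mem_Ico] at *
          rw [hℓ j (by omega), hcum j (by omega) (by omega)]
          simp
      rw [hrest]
      simp [hΛ0, iteratedDeriv_one, hΛ1, h2]
      ring
    rw [← hsum]
    simp [R]

end Cumulant

/-! ### The Edgeworth approximation of the characteristic function. -/

noncomputable section

/-- The exponent `∑ aⱼ ε^{j-2} (it)^j` of the Edgeworth expansion. -/
def edgeworthExponent (k s : ℕ) (a : ℕ → ℝ) (ε t : ℝ) : ℂ :=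
  ∑ j ∈ Finset.Icc k s, ((a j * ε ^ (j - 2) : ℝ) : ℂ) * (Complex.I * t) ^ j

/-- The Taylor polynomial of the exponential function. -/
def expTrunc (N : ℕ) (z : ℂ) : ℂ := ∑ l ∈ Finset.range (N + 1), z ^ l / l.factorial

/-- The characteristic function of the Edgeworth approximation. -/
def edgeworthCharFun (k s N : ℕ) (a : ℕ → ℝ) (ε t : ℝ) : ℂ :=
  Complex.exp (-(t : ℂ) ^ 2 / 2) * expTrunc N (edgeworthExponent k s a ε t)

end

theorem contDiff_edgeworthExponent (k s : ℕ) (a : ℕ → ℝ) (ε : ℝ) {m : WithTop ℕ∞} :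
    ContDiff ℝ m (edgeworthExponent k s a ε) :=
  ContDiff.sum fun _ _ => contDiff_const.mul
    ((contDiff_const.mul Complex.ofRealCLM.contDiff).pow _)

theorem contDiff_expTrunc_comp {N : ℕ} {m : WithTop ℕ∞} {A : ℝ → ℂ} (hA : ContDiff ℝ m A) :
    ContDiff ℝ m (fun t => expTrunc N (A t)) :=
  ContDiff.sum fun _ _ => (hA.pow _).div_const _

theorem contDiff_gaussianCF {m : WithTop ℕ∞} :
    ContDiff ℝ m (fun t : ℝ => Complex.exp (-(t : ℂ) ^ 2 / 2)) :=
  (((Complex.ofRealCLM.contDiff (n := m)).pow 2).neg.div_const 2).cexp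

theorem contDiff_edgeworthCharFun (k s N : ℕ) (a : ℕ → ℝ) (ε : ℝ) {m : WithTop ℕ∞} :
    ContDiff ℝ m (edgeworthCharFun k s N a ε) :=
  contDiff_gaussianCF.mul (contDiff_expTrunc_comp (contDiff_edgeworthExponent k s a ε))

/-- Differentiation loses the top term of the truncated exponential. This defect is the truncation
part of the inhomogeneity in the differential equation for the approximation error. -/
theorem hasDerivAt_expTrunc_comp (N : ℕ) {A : ℝ → ℂ} {A' : ℂ} {t : ℝ} (hA : HasDerivAt A A' t) :
    HasDerivAt (fun t => expTrunc N (A t)) (A' * (expTrunc N (A t) - A t ^ N / N.factorial)) t := by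
  induction N with
  | zero => simpa [expTrunc] using hasDerivAt_const t (1 : ℂ)
  | succ N ih =>
    have h1 : (fun t => expTrunc (N + 1) (A t)) =
        fun t => expTrunc N (A t) + A t ^ (N + 1) / (N + 1).factorial := by
      ext t
      rw [expTrunc, Finset.sum_range_succ]
      rfl
    rw [h1]
    have h2 := (hA.fun_pow (N + 1)).div_const (((N + 1).factorial : ℕ) : ℂ)
    refine (ih.add h2).congr_deriv ?_
    rw [congrFun h1 t]
    have h3 : ((N.factorial : ℕ) : ℂ) ≠ 0 := by exact_mod_cast N.factorial_ne_zero
    have h4 : ((N : ℂ) + 1) ≠ 0 := by exact_mod_cast N.succ_ne_zero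
    rw [Nat.factorial_succ]
    push_cast
    simp
    field_simp
    ring

section JetBounds

variable {ι : Type*} {t ε : ι → ℝ} {k s : ℕ} {a : ℕ → ℝ} {m : ℕ}

/-- Every exponent j is at least 3, so each coefficient carries at least one factor ε. -/
theorem jetO_edgeworthExponent (hk : 3 ≤ k) (h0 : ∀ i, 0 ≤ ε i) (h1 : ∀ i, ε i ≤ 1) :
    JetO m (fun i => edgeworthExponent k s a (ε i)) t ε := by
  refine JetO.sum _ h0 (fun j _ i => contDiff_const.mul
    ((contDiff_const.mul Complex.ofRealCLM.contDiff).pow _)) fun j hj => ?_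
  have hj3 : 3 ≤ j := hk.trans (Finset.mem_Icc.1 hj).1
  have h2 : JetO m (fun (i : ι) (u : ℝ) => (Complex.I * (u : ℂ)) ^ j) t (fun _ => 1) := by
    have := (JetO.ofReal (m := m) (t := t)).const_mul (fun _ => Complex.I)
    simpa using this.pow (fun i => contDiff_const.mul Complex.ofRealCLM.contDiff) j
  obtain ⟨K, D, hK, h⟩ := h2.const_mul (fun i => ((a j * ε i ^ (j - 2) : ℝ) : ℂ))
  refine ⟨K * |a j|, D, by positivity, fun i => (h i).mono ?_⟩
  have h3 : ε i ^ (j - 2) ≤ ε i := by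
    calc ε i ^ (j - 2) ≤ ε i ^ 1 := pow_le_pow_of_le_one (h0 i) (h1 i) (by omega)
      _ = ε i := pow_one _
  have h4 := h0 i
  beta_reduce
  rw [Complex.norm_real, Real.norm_eq_abs, abs_mul, abs_of_nonneg (pow_nonneg h4 _), mul_one]
  calc K * (1 + |t i|) ^ D * (|a j| * ε i ^ (j - 2)) ≤ K * (1 + |t i|) ^ D * (|a j| * ε i) := by
        gcongr
    _ = _ := by ring

theorem JetO.expTrunc {A : ι → ℝ → ℂ} (hA : ∀ i, ContDiff ℝ m (A i))
    (h : JetO m A t (fun _ => 1)) (N : ℕ) :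
    JetO m (fun i u => expTrunc N (A i u)) t (fun _ => 1) := by
  refine JetO.sum _ (fun _ => zero_le_one) (fun l _ i => ((hA i).pow l).div_const _) fun l _ => ?_
  have h1 := (h.pow hA l).const_mul (fun _ => ((l.factorial : ℂ))⁻¹)
  simp only [div_eq_inv_mul]
  refine h1.mono fun i => ?_
  have : (1 : ℝ) ≤ l.factorial := by exact_mod_cast l.factorial_pos
  simpa using inv_le_one_of_one_le₀ this

/-- The Gaussian solves y' = -uy, so the bound for its value extends to all derivatives with
inhomogeneity 0. -/
theorem jetO_gaussianCF :
    JetO m (fun (_ : ι) (u : ℝ) => Complex.exp (-(u : ℂ) ^ 2 / 2)) t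
      (fun i => Real.exp (-(t i) ^ 2 / 2)) := by
  have h1 : JetO m (fun (_ : ι) (u : ℝ) => -1 * (u : ℂ)) t (fun _ => 1) := by
    simpa using (JetO.ofReal (m := m) (t := t)).const_mul (fun _ => -1)
  refine JetO.mono_order (JetO.of_deriv_eq (m := m) (w := fun _ _ => 0) (fun i => contDiff_gaussianCF)
    (fun i => contDiff_const.mul Complex.ofRealCLM.contDiff) (fun i => contDiff_const) (fun i => ?_)
    h1 ⟨0, 0, le_rfl, fun i j _ => by simp⟩ (fun i => (Real.exp_pos _).le)
    ⟨1, 0, zero_le_one, fun i => ?_⟩) (Nat.le_succ m)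
  · refine Eventually.of_forall fun u => ?_
    have h2 := ((((Complex.ofRealCLM.hasDerivAt (x := u)).fun_pow 2).fun_neg.div_const 2).cexp).deriv
    simp only [Complex.ofRealCLM_apply] at h2
    rw [h2]
    simp
    ring
  · rw [Complex.norm_exp]
    simp [← Complex.ofReal_pow]

theorem jetO_edgeworthCharFun (hk : 3 ≤ k) (N : ℕ) (h0 : ∀ i, 0 ≤ ε i) (h1 : ∀ i, ε i ≤ 1) :
    JetO m (fun i => edgeworthCharFun k s N a (ε i)) t (fun i => Real.exp (-(t i) ^ 2 / 2)) := by
  have hA := contDiff_edgeworthExponent k s a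
  have := (jetO_gaussianCF (m := m) (t := t)).mul (fun i => contDiff_gaussianCF)
    (fun i => contDiff_expTrunc_comp (hA (ε i)))
    (JetO.expTrunc (fun i => hA (ε i)) ((jetO_edgeworthExponent hk h0 h1).mono h1) N)
  simp only [mul_one] at this
  exact this

end JetBounds

noncomputable section

/-- The difference between the characteristic function of a normalized sum and its Edgeworth
approximation. -/
def edgeworthDiff (f : ℝ → ℂ) (k s N : ℕ) (a : ℕ → ℝ) (n : ℕ) (t : ℝ) : ℂ :=
  f ((√(n : ℝ))⁻¹ * t) ^ n - edgeworthCharFun k s N a (√(n : ℝ))⁻¹ t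

end

theorem contDiff_edgeworthDiff {f : ℝ → ℂ} {m : WithTop ℕ∞} (hf : ContDiff ℝ m f) (k s N : ℕ)
    (a : ℕ → ℝ) (n : ℕ) : ContDiff ℝ m (edgeworthDiff f k s N a n) :=
  ((hf.comp (contDiff_const.mul contDiff_id)).pow n).sub (contDiff_edgeworthCharFun k s N a _)

theorem inv_sqrt_natCast_bounds {n : ℕ} (hn : 1 ≤ n) :
    0 < (√(n : ℝ))⁻¹ ∧ (√(n : ℝ))⁻¹ ≤ 1 ∧ (n : ℝ) * (√(n : ℝ))⁻¹ ^ 2 = 1 := by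
  have h1 : (1 : ℝ) ≤ n := by exact_mod_cast hn
  have h2 : 1 ≤ √(n : ℝ) := Real.one_le_sqrt.2 h1
  refine ⟨by positivity, inv_le_one_of_one_le₀ h2, ?_⟩
  rw [inv_pow, Real.sq_sqrt (by positivity), mul_inv_cancel₀ (by positivity)]

/-- Since ε^{j-2}|t|^j = t²|εt|^{j-2}, the exponent is a small fraction of t² when |εt| is small, so
it cannot destroy the Gaussian factor. -/
theorem norm_edgeworthExponent_le {k s : ℕ} (hk : 3 ≤ k) (a : ℕ → ℝ) {ε t : ℝ} (hε : 0 ≤ ε)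
    (h1 : |ε * t| ≤ 1) :
    ‖edgeworthExponent k s a ε t‖ ≤ t ^ 2 * (|ε * t| * ∑ j ∈ Finset.Icc k s, |a j|) := by
  refine (norm_sum_le _ _).trans ?_
  rw [Finset.mul_sum, Finset.mul_sum]
  refine Finset.sum_le_sum fun j hj => ?_
  have hj3 : 3 ≤ j := hk.trans (Finset.mem_Icc.1 hj).1
  rw [norm_mul, norm_pow, norm_mul, Complex.norm_I, one_mul, Complex.norm_real, Complex.norm_real,
    Real.norm_eq_abs, Real.norm_eq_abs, abs_mul, abs_of_nonneg (pow_nonneg hε _)]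
  have h2 : |ε * t| ^ (j - 2) ≤ |ε * t| := by
    calc |ε * t| ^ (j - 2) ≤ |ε * t| ^ 1 := pow_le_pow_of_le_one (abs_nonneg _) h1 (by omega)
      _ = |ε * t| := pow_one _
  have h3 : ε ^ (j - 2) * |t| ^ j = t ^ 2 * |ε * t| ^ (j - 2) := by
    rw [abs_mul, abs_of_nonneg hε, mul_pow, ← sq_abs t,
      show |t| ^ j = |t| ^ 2 * |t| ^ (j - 2) by rw [← pow_add]; congr 1; omega]
    ring
  calc |a j| * ε ^ (j - 2) * |t| ^ j = |a j| * (t ^ 2 * |ε * t| ^ (j - 2)) := by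
        rw [← h3]; ring
    _ ≤ |a j| * (t ^ 2 * |ε * t|) := by gcongr
    _ = _ := by ring

/-- The difference is split as e^A(e^r - 1) plus the Taylor remainder of e^A. -/
theorem norm_exp_add_sub_expTrunc_le (N : ℕ) {A r : ℂ} {x : ℝ} (hA : ‖A‖ ≤ x) (hr : ‖r‖ ≤ x) :
    ‖Complex.exp (A + r) - expTrunc N A‖ ≤ (‖r‖ + ‖A‖ ^ (N + 1)) * Real.exp (2 * x) := by
  have hx : 0 ≤ x := (norm_nonneg _).trans hA
  have h1 : ‖Complex.exp A - expTrunc N A‖ ≤ ‖A‖ ^ (N + 1) * Real.exp ‖A‖ :=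
    Complex.norm_exp_sub_sum_le_norm_mul_exp A (N + 1)
  have h2 : ‖Complex.exp r - 1‖ ≤ ‖r‖ * Real.exp ‖r‖ := by
    simpa using Complex.norm_exp_sub_sum_le_norm_mul_exp r 1
  have h3 : ‖Complex.exp A‖ ≤ Real.exp x :=
    (Complex.norm_exp_le_exp_norm A).trans (Real.exp_le_exp.2 hA)
  have e : Complex.exp (A + r) - expTrunc N A =
      Complex.exp A * (Complex.exp r - 1) + (Complex.exp A - expTrunc N A) := by
    rw [Complex.exp_add]; ring
  rw [e]
  refine (norm_add_le _ _).trans ?_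
  rw [norm_mul]
  calc ‖Complex.exp A‖ * ‖Complex.exp r - 1‖ + ‖Complex.exp A - expTrunc N A‖
      ≤ Real.exp x * (‖r‖ * Real.exp x) + ‖A‖ ^ (N + 1) * Real.exp (2 * x) := by
        gcongr
        · exact h2.trans (by gcongr)
        · exact h1.trans (by gcongr; linarith)
    _ = _ := by rw [two_mul, Real.exp_add]; ring

/-- With nε² = 1, the j-th derivative is of size nε^j η|εt|^{s-j} = ηε^{s-2}|t|^{s-j}, so all orders
have the same power of ε. -/
theorem jetO_rescaled_remainder {ι : Type*} {s : ℕ} (hs : 2 ≤ s) {R : ℝ → ℂ} (hR : ContDiff ℝ s R)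
    {n : ι → ℕ} {t η : ι → ℝ} (hn : ∀ i, 1 ≤ n i) (hη : ∀ i, 0 ≤ η i)
    (h : ∀ i, ∀ j ≤ s, ‖iteratedDeriv j R ((√(n i : ℝ))⁻¹ * t i)‖ ≤
      η i * |(√(n i : ℝ))⁻¹ * t i| ^ (s - j)) :
    JetO s (fun i u => (n i : ℂ) * R ((√(n i : ℝ))⁻¹ * u)) t
      (fun i => η i * (√(n i : ℝ))⁻¹ ^ (s - 2)) := by
  refine ⟨1, s, zero_le_one, fun i j hj => ?_⟩
  obtain ⟨hε, hε1, hnε⟩ := inv_sqrt_natCast_bounds (hn i)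
  have hRj : ContDiff ℝ j R := hR.of_le (by exact_mod_cast hj)
  rw [iteratedDeriv_const_mul_field]
  have e : iteratedDeriv j (fun u => R ((√(n i : ℝ))⁻¹ * u)) (t i) =
      (√(n i : ℝ))⁻¹ ^ j • iteratedDeriv j R ((√(n i : ℝ))⁻¹ * t i) :=
    congrFun (iteratedDeriv_comp_const_smul hRj (√(n i : ℝ))⁻¹) (t i)
  rw [e, norm_mul, norm_smul, Complex.norm_natCast, Real.norm_eq_abs, abs_of_pos (by positivity)]
  have hi := h i j hj
  beta_reduce
  generalize (√(n i : ℝ))⁻¹ = ε at *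
  have hηi := hη i
  have h1 : ε ^ s = ε ^ 2 * ε ^ (s - 2) := by rw [← pow_add]; congr 1; omega
  have h2 : ε ^ s = ε ^ j * ε ^ (s - j) := by rw [← pow_add]; congr 1; omega
  have h3 : |t i| ^ (s - j) ≤ (1 + |t i|) ^ s := by
    calc |t i| ^ (s - j) ≤ (1 + |t i|) ^ (s - j) := by gcongr; linarith
      _ ≤ (1 + |t i|) ^ s := by
        gcongr
        · linarith [abs_nonneg (t i)]
        · omega
  calc (n i : ℝ) * (ε ^ j * ‖iteratedDeriv j R (ε * t i)‖)
      ≤ (n i : ℝ) * (ε ^ j * (η i * |ε * t i| ^ (s - j))) := by gcongr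
    _ = ((n i : ℝ) * ε ^ 2) * (η i * ε ^ (s - 2) * |t i| ^ (s - j)) := by
        rw [abs_mul, abs_of_pos hε, mul_pow]
        linear_combination (n i : ℝ) * η i * |t i| ^ (s - j) * (h1 - h2)
    _ = |t i| ^ (s - j) * (η i * ε ^ (s - 2)) := by rw [hnε]; ring
    _ ≤ 1 * (1 + |t i|) ^ s * (η i * ε ^ (s - 2)) := by rw [one_mul]; gcongr

/-- Derivative bounds for the Edgeworth error in the range `|t| ≤ δ √n`. -/
theorem exists_jetBound_edgeworthDiff_inner {k s N : ℕ} (hk : 3 ≤ k) (hks : k ≤ s) (hN : s ≤ N)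
    {a : ℕ → ℝ} {f Λ R : ℝ → ℂ} (hfC : ContDiff ℝ s f) (hΛ : ContDiff ℝ s Λ)
    (hR : ContDiff ℝ s R) {δ₀ : ℝ} (hδ₀ : 0 < δ₀)
    (hf : ∀ u, |u| < δ₀ → f u = Complex.exp (Λ u))
    (hexp : ∀ u, Λ u = -(u : ℂ) ^ 2 / 2 + ∑ j ∈ Finset.Icc k s,
        ((a j : ℝ) : ℂ) * (Complex.I * u) ^ j + R u)
    (hR0 : ∀ j ≤ s, iteratedDeriv j R 0 = 0) :
    ∃ (K : ℝ) (D : ℕ), 0 ≤ K ∧ ∀ η : ℝ, 0 < η → η ≤ 1 → ∃ δ > 0, ∀ n : ℕ, 1 ≤ n → ∀ t : ℝ,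
      |(√(n : ℝ))⁻¹ * t| < δ → JetBound s (edgeworthDiff f k s N a n) t
        (K * (1 + |t|) ^ D * ((η * (√(n : ℝ))⁻¹ ^ (s - 2) + (√(n : ℝ))⁻¹ ^ (s - 1))
          * Real.exp (-t ^ 2 / 4))) := by
  choose! δ' hδ'pos hδ' using fun (η : ℝ) (hη : 0 < η) =>
    exists_norm_iteratedDeriv_le_of_zero hR hR0 hη
  set Sa : ℝ := ∑ j ∈ Finset.Icc k s, |a j| with hSa
  have hSa0 : 0 ≤ Sa := Finset.sum_nonneg fun _ _ => abs_nonneg _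
  -- This radius makes both the exponent A and the remainder r at most t²/8, so the factor
  -- e^{2·t²/8} still leaves e^{-t²/4} of the Gaussian.
  set δ₁ : ℝ := min δ₀ (1 / (8 * (1 + Sa))) with hδ₁
  have hδ₁pos : 0 < δ₁ := lt_min hδ₀ (by positivity)
  -- Indexing by all admissible triples (η, n, t) makes the constants K and D independent of all
  -- three.
  let ι := {p : ℝ × ℕ × ℝ // 0 < p.1 ∧ p.1 ≤ 1 ∧ 1 ≤ p.2.1 ∧
    |(√(p.2.1 : ℝ))⁻¹ * p.2.2| < min (δ' p.1) δ₁}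
  let η : ι → ℝ := fun i => i.1.1
  let n : ι → ℕ := fun i => i.1.2.1
  let t : ι → ℝ := fun i => i.1.2.2
  let ε : ι → ℝ := fun i => (√(n i : ℝ))⁻¹
  let θ : ι → ℝ := fun i => (η i * ε i ^ (s - 2) + ε i ^ (s - 1)) * Real.exp (-t i ^ 2 / 4)
  suffices h : JetO s (fun i => edgeworthDiff f k s N a (n i)) t θ by
    obtain ⟨K, D, hK, h⟩ := h
    exact ⟨K, D, hK, fun η hη hη1 => ⟨min (δ' η) δ₁, lt_min (hδ'pos η hη) hδ₁pos,
      fun n hn t ht => h ⟨(η, n, t), hη, hη1, hn, ht⟩⟩⟩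
  have hη0 : ∀ i, 0 < η i := fun i => i.2.1
  have hη1 : ∀ i, η i ≤ 1 := fun i => i.2.2.1
  have hn1 : ∀ i, 1 ≤ n i := fun i => i.2.2.2.1
  have htδ : ∀ i, |ε i * t i| < min (δ' (η i)) δ₁ := fun i => i.2.2.2.2
  have hε0 : ∀ i, 0 < ε i := fun i => (inv_sqrt_natCast_bounds (hn1 i)).1
  have hε1 : ∀ i, ε i ≤ 1 := fun i => (inv_sqrt_natCast_bounds (hn1 i)).2.1
  have hnε : ∀ i, (n i : ℝ) * ε i ^ 2 = 1 := fun i => (inv_sqrt_natCast_bounds (hn1 i)).2.2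
  have hθ0 : ∀ i, 0 ≤ θ i := fun i => by
    have := hη0 i; have := hε0 i; positivity
  clear_value η n t
  obtain ⟨m, rfl⟩ : ∃ m, s = m + 1 := ⟨s - 1, by omega⟩
  let r : ι → ℝ → ℂ := fun i u => (n i : ℂ) * R (ε i * u)
  let A : ι → ℝ → ℂ := fun i => edgeworthExponent k (m + 1) a (ε i)
  let L : ι → ℝ → ℂ := fun i u => (n i : ℂ) * Λ (ε i * u)
  have hm : ((m : ℕ) : WithTop ℕ∞) ≤ ((m + 1 : ℕ) : WithTop ℕ∞) := by exact_mod_cast Nat.le_succ m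
  have hrC : ∀ i, ContDiff ℝ (m + 1 : ℕ) (r i) := fun i =>
    contDiff_const.mul (hR.comp (contDiff_const.mul contDiff_id))
  have hAC : ∀ i (m : WithTop ℕ∞), ContDiff ℝ m (A i) := fun i m => contDiff_edgeworthExponent _ _ _ _
  have hLC : ∀ i, ContDiff ℝ (m + 1 : ℕ) (L i) := fun i =>
    contDiff_const.mul (hΛ.comp (contDiff_const.mul contDiff_id))
  have hderivC : ∀ {F : ℝ → ℂ}, ContDiff ℝ (m + 1 : ℕ) F → ContDiff ℝ m (deriv F) := fun {F} hF => by
    have : ContDiff ℝ ((m : WithTop ℕ∞) + 1) F := by exact_mod_cast hF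
    exact ((contDiff_succ_iff_deriv).1 this).2.2
  have hdiff : ∀ {F : ℝ → ℂ}, ContDiff ℝ (m + 1 : ℕ) F → ∀ u, HasDerivAt F (deriv F u) u :=
    fun {F} hF u => (hF.differentiable (by exact_mod_cast m.succ_ne_zero) u).hasDerivAt
  have hLeq : ∀ i u, L i u = -(u : ℂ) ^ 2 / 2 + A i u + r i u := by
    intro i u
    have hnε' : (n i : ℂ) * (ε i : ℂ) ^ 2 = 1 := by exact_mod_cast hnε i
    simp only [L, r, A, edgeworthExponent, hexp, mul_add, Finset.mul_sum]
    congr 2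
    · push_cast
      linear_combination (-(u : ℂ) ^ 2 / 2) * hnε'
    · refine Finset.sum_congr rfl fun j hj => ?_
      have hj2 : 2 ≤ j := by have := (Finset.mem_Icc.1 hj).1; omega
      have e : (ε i : ℂ) ^ j = (ε i : ℂ) ^ 2 * (ε i : ℂ) ^ (j - 2) := by
        rw [← pow_add]; congr 1; omega
      push_cast
      rw [mul_pow, mul_pow, e, mul_pow]
      linear_combination (a j * Complex.I ^ j * (ε i : ℂ) ^ (j - 2) * (u : ℂ) ^ j) * hnε'
  have hr : JetO (m + 1) r t (fun i => η i * ε i ^ (m + 1 - 2)) :=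
    jetO_rescaled_remainder (by omega) hR hn1 (fun i => (hη0 i).le) fun i =>
      hδ' (η i) (hη0 i) _ ((htδ i).trans_le (min_le_left _ _))
  have hAJ : JetO (m + 1) A t ε := jetO_edgeworthExponent hk (fun i => (hε0 i).le) hε1
  have hLJ : JetO (m + 1) L t (fun _ => 1) := by
    have h1 : JetO (m + 1) (fun (_ : ι) (u : ℝ) => -(u : ℂ) ^ 2 / 2) t (fun _ => 1) := by
      have h2 := ((JetO.ofReal (m := m + 1) (t := t)).pow
        (fun _ => Complex.ofRealCLM.contDiff) 2).const_mul (fun _ => (-1 / 2 : ℂ))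
      refine JetO.mono (θ := fun i => ‖(-1 / 2 : ℂ)‖ * 1 ^ 2) ?_ fun i => by norm_num
      convert h2 using 3
      simp only [Complex.ofRealCLM_apply]
      ring
    have h3 : (fun i (u : ℝ) => -(u : ℂ) ^ 2 / 2 + A i u + r i u) = L := by
      ext i u; exact (hLeq i u).symm
    rw [← h3]
    have hqC : ContDiff ℝ (m + 1 : ℕ) (fun u : ℝ => -(u : ℂ) ^ 2 / 2) :=
      ((Complex.ofRealCLM.contDiff).pow 2).neg.div_const 2
    refine JetO.add (fun i => hqC.add (hAC i _)) hrC (fun _ => zero_le_one)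
      (JetO.add (fun i => hqC) (fun i => hAC i _) (fun _ => zero_le_one) h1 (hAJ.mono hε1))
      (hr.mono fun i => ?_)
    exact mul_le_one₀ (hη1 i) (pow_nonneg (hε0 i).le _) (pow_le_one₀ (hε0 i).le (hε1 i))
  -- The error y = e^L - e^{-u²/2} S, with S the truncated exponential of A, satisfies y' = L'y + w.
  -- The two parts of w come from the Taylor remainder r and from the truncation defect of S.
  let w : ι → ℝ → ℂ := fun i u => Complex.exp (-(u : ℂ) ^ 2 / 2) *
    (deriv (r i) u * expTrunc N (A i u) + deriv (A i) u * ((N.factorial : ℂ)⁻¹ * A i u ^ N))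
  have hSC : ∀ i, ContDiff ℝ m (fun u => expTrunc N (A i u)) := fun i =>
    contDiff_expTrunc_comp (hAC i _)
  have hPC : ∀ i, ContDiff ℝ m (fun u => (N.factorial : ℂ)⁻¹ * A i u ^ N) := fun i =>
    contDiff_const.mul ((hAC i _).pow N)
  have hwJ : JetO m w t θ := by
    have h1 := (hr.deriv).mul (fun i => hderivC (hrC i)) hSC
      (JetO.expTrunc (fun i => hAC i _) ((hAJ.mono_order (Nat.le_succ m)).mono hε1) N)
    have h2 := (hAJ.deriv).mul (fun i => hderivC (hAC i _)) hPC
      (((hAJ.mono_order (Nat.le_succ m)).pow (fun i => hAC i _) N).const_mul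
        (fun _ => (N.factorial : ℂ)⁻¹))
    have hθ' : ∀ i, 0 ≤ η i * ε i ^ (m + 1 - 2) + ε i ^ (m + 1 - 1) := fun i => by
      have := hη0 i; have := hε0 i; positivity
    have h3 := JetO.add (fun i => (hderivC (hrC i)).mul (hSC i))
      (fun i => (hderivC (hAC i _)).mul (hPC i)) hθ' (h1.mono fun i => ?_) (h2.mono fun i => ?_)
    · refine (jetO_gaussianCF.mul (fun i => contDiff_gaussianCF) (fun i => ?_) h3).mono fun i => ?_
      · exact ((hderivC (hrC i)).mul (hSC i)).add ((hderivC (hAC i _)).mul (hPC i))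
      · rw [mul_comm]
        refine mul_le_mul_of_nonneg_left (Real.exp_le_exp.2 ?_) (hθ' i)
        nlinarith [sq_nonneg (t i)]
    · have := pow_nonneg (hε0 i).le (m + 1 - 1)
      linarith
    · have h4 : ‖(N.factorial : ℂ)⁻¹‖ ≤ 1 := by
        have : (1 : ℝ) ≤ N.factorial := by exact_mod_cast N.factorial_pos
        simpa using inv_le_one_of_one_le₀ this
      have h5 : 0 ≤ η i * ε i ^ (m + 1 - 2) := by have := hη0 i; have := hε0 i; positivity
      have h6 : ε i * ε i ^ N ≤ ε i ^ (m + 1 - 1) := by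
        rw [← pow_succ']
        exact pow_le_pow_of_le_one (hε0 i).le (hε1 i) (by omega)
      have h7 : 0 ≤ ε i * ε i ^ N := by have := hε0 i; positivity
      calc ε i * (‖(N.factorial : ℂ)⁻¹‖ * ε i ^ N) = ‖(N.factorial : ℂ)⁻¹‖ * (ε i * ε i ^ N) := by
            ring
        _ ≤ 1 * (ε i * ε i ^ N) := by gcongr
        _ ≤ _ := by linarith
  have hfn : ∀ i u, |ε i * u| < δ₀ → f (ε i * u) ^ n i = Complex.exp (L i u) := fun i u hu => by
    rw [hf _ hu, ← Complex.exp_nat_mul]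
  refine JetO.of_deriv_eq (c := fun i => deriv (L i)) (w := w)
    (fun i => (contDiff_edgeworthDiff (hfC.of_le hm) _ _ _ _ _)) (fun i => hderivC (hLC i))
    (fun i => contDiff_gaussianCF.mul
      (((hderivC (hrC i)).mul (hSC i)).add ((hderivC (hAC i _)).mul (hPC i))))
    (fun i => ?_) hLJ.deriv hwJ hθ0 ?_
  · have hnear : ∀ᶠ u in 𝓝 (t i), |ε i * u| < δ₀ :=
      (continuous_abs.comp (continuous_const.mul continuous_id)).continuousAt.eventually_lt_const
        ((htδ i).trans_le ((min_le_right _ _).trans (min_le_left _ _)))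
    filter_upwards [hnear.eventually_nhds] with u hu
    have he : edgeworthDiff f k (m + 1) N a (n i) =ᶠ[𝓝 u] fun v => Complex.exp (L i v) -
        Complex.exp (-(v : ℂ) ^ 2 / 2) * expTrunc N (A i v) := by
      filter_upwards [hu] with v hv
      rw [edgeworthDiff, hfn i v hv]
      rfl
    have hq : HasDerivAt (fun u : ℝ => -(u : ℂ) ^ 2 / 2) (-(u : ℂ)) u := by
      have h2 := (((Complex.ofRealCLM.hasDerivAt (x := u)).fun_pow 2).fun_neg.div_const 2)
      simp only [Complex.ofRealCLM_apply] at h2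
      refine h2.congr_deriv ?_
      simp
      ring
    have hL' : deriv (L i) u = -(u : ℂ) + deriv (A i) u + deriv (r i) u := by
      have h3 : L i = fun u : ℝ => -(u : ℂ) ^ 2 / 2 + A i u + r i u := funext (hLeq i)
      rw [h3]
      exact ((hq.add (hdiff (hAC i _) u)).add (hdiff (hrC i) u)).deriv
    have hd := ((hdiff (hLC i) u).cexp).sub
      (hq.cexp.mul (hasDerivAt_expTrunc_comp N (hdiff (hAC i _) u)))
    rw [he.deriv_eq, he.eq_of_nhds]
    refine hd.deriv.trans ?_
    simp only [w, hL']
    ring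
  -- It remains to bound the error itself at t, without derivatives.
  · obtain ⟨K1, D1, hK1, hA1⟩ := hAJ
    obtain ⟨K2, D2, hK2, hr2⟩ := hr
    refine ⟨K2 + K1 ^ (N + 1), max D2 (D1 * (N + 1)), by positivity, fun i => ?_⟩
    have hδ1 := (htδ i).trans_le (min_le_right _ _)
    have hδ8 : |ε i * t i| ≤ 1 / (8 * (1 + Sa)) := (hδ1.le).trans (min_le_right _ _)
    have hle1 : |ε i * t i| * (1 + Sa) ≤ 1 / 8 := by
      calc |ε i * t i| * (1 + Sa) ≤ 1 / (8 * (1 + Sa)) * (1 + Sa) := by gcongr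
        _ = 1 / 8 := by field_simp
    have hab := abs_nonneg (ε i * t i)
    have h18 : |ε i * t i| ≤ 1 / 8 := by nlinarith
    have hnA : ‖A i (t i)‖ ≤ t i ^ 2 / 8 := by
      refine (norm_edgeworthExponent_le hk a (hε0 i).le (by linarith)).trans ?_
      have : |ε i * t i| * Sa ≤ 1 / 8 := by nlinarith
      nlinarith [sq_nonneg (t i)]
    have hnr : ‖r i (t i)‖ ≤ t i ^ 2 / 8 := by
      have h1 := hδ' (η i) (hη0 i) _ ((htδ i).trans_le (min_le_left _ _)) 0 (Nat.zero_le _)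
      simp only [iteratedDeriv_zero, Nat.sub_zero] at h1
      have h2 : |ε i * t i| ^ (m + 1) ≤ |ε i * t i| ^ 3 :=
        pow_le_pow_of_le_one hab (by linarith) (by omega)
      have h3 : |ε i * t i| ^ 2 = ε i ^ 2 * t i ^ 2 := by rw [sq_abs, mul_pow]
      calc ‖r i (t i)‖ = n i * ‖R (ε i * t i)‖ := by simp [r]
        _ ≤ n i * (1 * |ε i * t i| ^ 3) := by
          gcongr
          exact h1.trans (mul_le_mul (hη1 i) h2 (by positivity) zero_le_one)
        _ = (n i * ε i ^ 2) * t i ^ 2 * |ε i * t i| := by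
          rw [pow_succ, h3]; ring
        _ ≤ _ := by rw [hnε i]; nlinarith [sq_nonneg (t i)]
    have hval : edgeworthDiff f k (m + 1) N a (n i) (t i) = Complex.exp (-(t i : ℂ) ^ 2 / 2) *
        (Complex.exp (A i (t i) + r i (t i)) - expTrunc N (A i (t i))) := by
      rw [edgeworthDiff, hfn i _ (hδ1.trans_le (min_le_left _ _)), hLeq, mul_sub, ← Complex.exp_add,
        ← add_assoc]
      rfl
    rw [hval, norm_mul]
    have hg : ‖Complex.exp (-(t i : ℂ) ^ 2 / 2)‖ = Real.exp (-t i ^ 2 / 2) := by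
      rw [Complex.norm_exp]
      simp [← Complex.ofReal_pow]
    rw [hg]
    have h1 : (1 : ℝ) ≤ 1 + |t i| := by linarith [abs_nonneg (t i)]
    have hE : Real.exp (-t i ^ 2 / 2) * Real.exp (2 * (t i ^ 2 / 8)) = Real.exp (-t i ^ 2 / 4) := by
      rw [← Real.exp_add]; congr 1; ring
    set M := max D2 (D1 * (N + 1))
    have hr3 : ‖r i (t i)‖ ≤ K2 * (1 + |t i|) ^ M * (η i * ε i ^ (m + 1 - 2)) := by
      refine (hr2 i).norm_le.trans ?_
      have := hη0 i; have := hε0 i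
      gcongr
      exact le_max_left _ _
    have hA3 : ‖A i (t i)‖ ^ (N + 1) ≤ K1 ^ (N + 1) * (1 + |t i|) ^ M * ε i ^ (m + 1 - 1) := by
      have hε := hε0 i
      calc ‖A i (t i)‖ ^ (N + 1) ≤ (K1 * (1 + |t i|) ^ D1 * ε i) ^ (N + 1) := by
            gcongr; exact (hA1 i).norm_le
        _ = K1 ^ (N + 1) * (1 + |t i|) ^ (D1 * (N + 1)) * ε i ^ (N + 1) := by
            rw [mul_pow, mul_pow, ← pow_mul]
        _ ≤ K1 ^ (N + 1) * (1 + |t i|) ^ M * ε i ^ (m + 1 - 1) := by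
            gcongr ?_ * ?_ * ?_
            · gcongr
              exact le_max_right _ _
            · exact pow_le_pow_of_le_one hε.le (hε1 i) (by omega)
    have hη' := hη0 i
    have hε := hε0 i
    calc Real.exp (-t i ^ 2 / 2) * ‖Complex.exp (A i (t i) + r i (t i)) - expTrunc N (A i (t i))‖
        ≤ Real.exp (-t i ^ 2 / 2) * ((‖r i (t i)‖ + ‖A i (t i)‖ ^ (N + 1))
          * Real.exp (2 * (t i ^ 2 / 8))) := by
          gcongr
          exact norm_exp_add_sub_expTrunc_le N hnA hnr
      _ = (‖r i (t i)‖ + ‖A i (t i)‖ ^ (N + 1)) * Real.exp (-t i ^ 2 / 4) := by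
          rw [← hE]; ring
      _ ≤ (K2 * (1 + |t i|) ^ M * (η i * ε i ^ (m + 1 - 2))
          + K1 ^ (N + 1) * (1 + |t i|) ^ M * ε i ^ (m + 1 - 1)) * Real.exp (-t i ^ 2 / 4) := by
          gcongr
      _ ≤ ((K2 + K1 ^ (N + 1)) * (1 + |t i|) ^ M * (η i * ε i ^ (m + 1 - 2))
          + (K2 + K1 ^ (N + 1)) * (1 + |t i|) ^ M * ε i ^ (m + 1 - 1))
            * Real.exp (-t i ^ 2 / 4) := by
          have : 0 ≤ K1 ^ (N + 1) := by positivity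
          gcongr
          · linarith
          · linarith
      _ = _ := by simp only [θ]; ring

theorem exists_one_add_abs_pow_le_exp (D : ℕ) {c : ℝ} (hc : 0 < c) :
    ∃ C : ℝ, 0 < C ∧ ∀ t : ℝ, (1 + |t|) ^ D ≤ C * Real.exp (c * t ^ 2) := by
  refine ⟨D.factorial * Real.exp (1 + 1 / (4 * c)), by positivity, fun t => ?_⟩
  have h1 := Real.pow_div_factorial_le_exp (1 + |t|) (by positivity) D
  rw [div_le_iff₀ (by positivity)] at h1
  have h2 : 1 + |t| ≤ 1 + 1 / (4 * c) + c * t ^ 2 := by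
    have h3 : 0 ≤ c * (|t| - 1 / (2 * c)) ^ 2 := by positivity
    have h4 : c * (|t| - 1 / (2 * c)) ^ 2 = c * |t| ^ 2 - |t| + 1 / (4 * c) := by field_simp; ring
    rw [← sq_abs t]
    linarith
  calc (1 + |t|) ^ D ≤ Real.exp (1 + |t|) * D.factorial := h1
    _ ≤ Real.exp (1 + 1 / (4 * c) + c * t ^ 2) * D.factorial := by gcongr
    _ = _ := by rw [Real.exp_add]; ring

theorem integrable_one_add_abs_pow_mul_exp (D : ℕ) {c : ℝ} (hc : 0 < c) :
    Integrable (fun t : ℝ => (1 + |t|) ^ D * Real.exp (-c * t ^ 2)) := by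
  obtain ⟨C, hC, h⟩ := exists_one_add_abs_pow_le_exp D (half_pos hc)
  refine ((integrable_exp_neg_mul_sq (half_pos hc)).const_mul C).mono' (by fun_prop)
    (ae_of_all _ fun t => ?_)
  rw [Real.norm_eq_abs, abs_of_nonneg (by positivity)]
  calc (1 + |t|) ^ D * Real.exp (-c * t ^ 2)
      ≤ C * Real.exp (c / 2 * t ^ 2) * Real.exp (-c * t ^ 2) := by gcongr; exact h t
    _ = C * Real.exp (-(c / 2) * t ^ 2) := by
        rw [mul_assoc, ← Real.exp_add]; ring_nf

theorem eventually_natCast_pow_mul_pow_le (p c : ℕ) (K : ℝ) {q η : ℝ} (hq0 : 0 < q) (hq1 : q < 1)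
    (hη : 0 < η) (s : ℕ) :
    ∀ᶠ n : ℕ in atTop, K * (n : ℝ) ^ p * q ^ (n - c) ≤ η * (√(n : ℝ))⁻¹ ^ s := by
  have h1 : Tendsto (fun n : ℕ => |K| / q ^ c * ((n : ℝ) ^ (p + s) * q ^ n)) atTop (𝓝 0) := by
    simpa using (tendsto_pow_const_mul_const_pow_of_lt_one (p + s) hq0.le hq1).const_mul
      (|K| / q ^ c)
  filter_upwards [h1.eventually_le_const hη, eventually_ge_atTop (c + 1)] with n hn hc
  have hn1 : (1 : ℝ) ≤ n := by exact_mod_cast (by omega : 1 ≤ n)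
  have hε : ((n : ℝ) ^ s)⁻¹ ≤ (√(n : ℝ))⁻¹ ^ s := by
    rw [← inv_pow]
    gcongr
    rw [Real.sqrt_le_left (by positivity)]
    nlinarith
  have e : q ^ n = q ^ c * q ^ (n - c) := by rw [← pow_add]; congr 1; omega
  have hns : (0 : ℝ) < (n : ℝ) ^ s := by positivity
  calc K * (n : ℝ) ^ p * q ^ (n - c) ≤ |K| * (n : ℝ) ^ p * q ^ (n - c) := by
        gcongr; exact le_abs_self K
    _ = |K| / q ^ c * ((n : ℝ) ^ (p + s) * q ^ n) * ((n : ℝ) ^ s)⁻¹ := by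
        rw [e, pow_add]; field_simp
    _ ≤ η * ((n : ℝ) ^ s)⁻¹ := by gcongr
    _ ≤ _ := by gcongr

theorem JetBound.comp_const_mul {m : ℕ} {f : ℝ → ℂ} (hf : ContDiff ℝ m f) {ε t M : ℝ}
    (hε0 : 0 ≤ ε) (hε1 : ε ≤ 1) (h : JetBound m f (ε * t) M) :
    JetBound m (fun u => f (ε * u)) t M := fun j hj => by
  have e : iteratedDeriv j (fun u => f (ε * u)) t = ε ^ j • iteratedDeriv j f (ε * t) :=
    congrFun (iteratedDeriv_comp_const_smul (hf.of_le (by exact_mod_cast hj)) ε) t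
  rw [e, norm_smul, norm_pow, Real.norm_eq_abs, abs_of_nonneg hε0]
  have := h j hj
  calc ε ^ j * ‖iteratedDeriv j f (ε * t)‖ ≤ 1 * M :=
        mul_le_mul (pow_le_one₀ hε0 hε1) this (norm_nonneg _) zero_le_one
    _ = M := one_mul M

/-- Derivative bounds for the Edgeworth error in the range `|t| ≥ δ √n`. -/
theorem exists_jetBound_edgeworthDiff_outer {k s N : ℕ} (hk : 3 ≤ k) {a : ℕ → ℝ} {f : ℝ → ℂ}
    (hfC : ContDiff ℝ s f) {M : ℝ} (hM1 : 1 ≤ M) (hM : ∀ t, JetBound s f t M)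
    (hf1 : ∀ t, ‖f t‖ ≤ 1) {m : ℕ} {C : ℝ} (hdecay : ∀ t : ℝ, |t| * ‖f t‖ ^ m ≤ C)
    (hq : ∀ δ > 0, ∃ q : ℝ, 0 < q ∧ q < 1 ∧ ∀ t : ℝ, δ ≤ |t| → ‖f t‖ ≤ q) :
    ∃ D : ℕ, ∀ δ > 0, ∀ η > 0, ∀ᶠ n : ℕ in atTop, ∀ t : ℝ, δ ≤ |(√(n : ℝ))⁻¹ * t| →
      JetBound s (edgeworthDiff f k s N a n) t (η * (√(n : ℝ))⁻¹ ^ (s - 2) *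
        ((1 + |t|) ^ D * Real.exp (-t ^ 2 / 4) + ((1 + |t|) ^ 4)⁻¹)) := by
  obtain ⟨K, D, hK, hE⟩ := jetO_edgeworthCharFun (ι := {p : ℝ × ℝ // 0 ≤ p.1 ∧ p.1 ≤ 1})
    (t := fun p => p.1.2) (ε := fun p => p.1.1) (m := s) (s := s) (a := a) hk N
    (fun p => p.2.1) (fun p => p.2.2)
  refine ⟨D, fun δ hδ η hη => ?_⟩
  have hC0 : 0 ≤ C := by simpa using hdecay 0
  obtain ⟨q, hq0, hq1, hqf⟩ := hq δ hδ
  have hq'1 : Real.exp (-(δ ^ 2 / 4)) < 1 := by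
    rw [← Real.exp_zero]
    exact Real.exp_lt_exp.2 (neg_lt_zero.2 (by positivity))
  have hlarge : ∀ᶠ n : ℕ in atTop, δ⁻¹ ^ 2 ≤ (n : ℝ) :=
    tendsto_natCast_atTop_atTop.eventually_ge_atTop _
  -- Of the n factors of f, up to s are used up by derivatives and 4m produce the decay (1 +
  -- |t|)^{-4}; the rest give q^{n-s-4m}. The power n^{s+2} is n^s from the derivatives and n² =
  -- ε^{-4} from undoing the scaling. The order 4 leaves an integrable function after multiplication
  -- by t².
  filter_upwards [eventually_natCast_pow_mul_pow_le (s + 2) (s + 4 * m)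
      ((2 ^ s * M) ^ s * (C ^ 4 * 16)) hq0 hq1 hη (s - 2),
    eventually_natCast_pow_mul_pow_le 0 0 K (Real.exp_pos _) hq'1 hη (s - 2), hlarge,
    eventually_ge_atTop (s + 4 * m + 1)] with n h1 h2 h3 h4 t ht
  obtain ⟨hε, hε1, hnε⟩ := inv_sqrt_natCast_bounds (by omega : 1 ≤ n)
  have hsq : (√(n : ℝ))⁻¹ ^ 2 = (n : ℝ)⁻¹ := by rw [inv_pow, Real.sq_sqrt (by positivity)]
  set ε : ℝ := (√(n : ℝ))⁻¹ with hεdef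
  have hn0 : (0 : ℝ) < n := by exact_mod_cast (by omega : 0 < n)
  have hsq' : δ ^ 2 * n ≤ t ^ 2 := by
    have h5 : δ ^ 2 ≤ |ε * t| ^ 2 := by gcongr
    rw [sq_abs, mul_pow, hsq] at h5
    calc δ ^ 2 * n ≤ (n : ℝ)⁻¹ * t ^ 2 * n := by gcongr
      _ = t ^ 2 := by field_simp
  have ht1 : 1 ≤ |t| := by
    rw [← one_le_sq_iff₀ (abs_nonneg _), sq_abs]
    refine le_trans ?_ hsq'
    calc 1 = δ ^ 2 * δ⁻¹ ^ 2 := by field_simp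
      _ ≤ _ := by gcongr
  have hfC' : ContDiff ℝ s (fun u => f (ε * u)) := hfC.comp (contDiff_const.mul contDiff_id)
  have hJ1 := JetBound.pow_of_norm_le_one hfC' ((hM (ε * t)).comp_const_mul hfC hε.le hε1) hM1
    (hf1 _) s le_rfl n (by omega)
  have hJ2 := hE ⟨(ε, t), hε.le, hε1⟩
  refine (hJ1.sub (hfC'.pow n) (contDiff_edgeworthCharFun k s N a ε) hJ2).mono ?_
  rw [mul_add, add_comm (η * ε ^ (s - 2) * _)]
  refine add_le_add ?_ ?_
  · have hfq : ‖f (ε * t)‖ ≤ q := hqf _ ht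
    have e1 : ‖f (ε * t)‖ ^ (n - s) = ‖f (ε * t)‖ ^ (n - (s + 4 * m)) * (‖f (ε * t)‖ ^ m) ^ 4 := by
      rw [← pow_mul, ← pow_add]; congr 1; omega
    have hεt : 0 < |ε * t| := hδ.trans_le ht
    have h5 : (‖f (ε * t)‖ ^ m) ^ 4 ≤ C ^ 4 * 16 * (n : ℝ) ^ 2 * ((1 + |t|) ^ 4)⁻¹ := by
      have h6 : ‖f (ε * t)‖ ^ m ≤ C / |ε * t| := by
        rw [le_div_iff₀' hεt]; exact hdecay _
      calc (‖f (ε * t)‖ ^ m) ^ 4 ≤ (C / |ε * t|) ^ 4 := by gcongr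
        _ = C ^ 4 * (n : ℝ) ^ 2 * (|t| ^ 4)⁻¹ := by
          rw [abs_mul, abs_of_pos hε, div_pow, mul_pow, show ε ^ 4 = (ε ^ 2) ^ 2 by ring, hsq]
          field_simp
        _ ≤ C ^ 4 * (n : ℝ) ^ 2 * (((1 + |t|) / 2) ^ 4)⁻¹ := by
          gcongr
          linarith
        _ = _ := by rw [div_pow]; field_simp; norm_num
    calc (2 ^ s * M * n) ^ s * ‖f (ε * t)‖ ^ (n - s)
        ≤ (2 ^ s * M * n) ^ s * (q ^ (n - (s + 4 * m)) *
          (C ^ 4 * 16 * (n : ℝ) ^ 2 * ((1 + |t|) ^ 4)⁻¹)) := by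
          rw [e1]; gcongr
      _ = ((2 ^ s * M) ^ s * (C ^ 4 * 16) * (n : ℝ) ^ (s + 2) * q ^ (n - (s + 4 * m)))
          * ((1 + |t|) ^ 4)⁻¹ := by rw [mul_pow, pow_add]; ring
      _ ≤ _ := by gcongr
  · have h5 : Real.exp (-t ^ 2 / 2) ≤ Real.exp (-(δ ^ 2 / 4)) ^ (n - 0) * Real.exp (-t ^ 2 / 4) := by
      rw [Nat.sub_zero, ← Real.exp_nat_mul, ← Real.exp_add]
      gcongr
      nlinarith
    calc K * (1 + |t|) ^ D * Real.exp (-t ^ 2 / 2)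
        ≤ K * (1 + |t|) ^ D * (Real.exp (-(δ ^ 2 / 4)) ^ (n - 0) * Real.exp (-t ^ 2 / 4)) := by
          gcongr
      _ = (K * (n : ℝ) ^ 0 * Real.exp (-(δ ^ 2 / 4)) ^ (n - 0)) *
          ((1 + |t|) ^ D * Real.exp (-t ^ 2 / 4)) := by ring
      _ ≤ _ := by gcongr

/-- Uniform derivative bounds for the Edgeworth error, with an integrable majorant. -/
theorem exists_jetBound_edgeworthDiff {k s N : ℕ} (hk : 3 ≤ k) (hks : k ≤ s) (hN : s ≤ N)
    {a : ℕ → ℝ} {f Λ R : ℝ → ℂ} (hfC : ContDiff ℝ s f) (hΛ : ContDiff ℝ s Λ)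
    (hR : ContDiff ℝ s R) {δ₀ : ℝ} (hδ₀ : 0 < δ₀)
    (hf : ∀ u, |u| < δ₀ → f u = Complex.exp (Λ u))
    (hexp : ∀ u, Λ u = -(u : ℂ) ^ 2 / 2 + ∑ j ∈ Finset.Icc k s,
        ((a j : ℝ) : ℂ) * (Complex.I * u) ^ j + R u)
    (hR0 : ∀ j ≤ s, iteratedDeriv j R 0 = 0)
    {M : ℝ} (hM1 : 1 ≤ M) (hM : ∀ t, JetBound s f t M)
    (hf1 : ∀ t, ‖f t‖ ≤ 1) {m : ℕ} {C : ℝ} (hdecay : ∀ t : ℝ, |t| * ‖f t‖ ^ m ≤ C)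
    (hq : ∀ δ > 0, ∃ q : ℝ, 0 < q ∧ q < 1 ∧ ∀ t : ℝ, δ ≤ |t| → ‖f t‖ ≤ q) :
    ∃ Ψ : ℝ → ℝ, Integrable Ψ ∧ ∀ η > 0, ∀ᶠ n : ℕ in atTop, ∀ t : ℝ, ∀ i ≤ 2,
      JetBound s (fun u => (u : ℂ) ^ i * edgeworthDiff f k s N a n u) t
        (η * (√(n : ℝ))⁻¹ ^ (s - 2) * Ψ t) := by
  obtain ⟨K, D, hK, hin⟩ := exists_jetBound_edgeworthDiff_inner hk hks hN hfC hΛ hR hδ₀ hf hexp hR0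
  obtain ⟨D', hout⟩ := exists_jetBound_edgeworthDiff_outer (N := N) (a := a) hk hfC hM1 hM hf1
    hdecay hq
  set c : ℝ := 2 ^ s * (2 ^ s) ^ 2 with hc
  have hc0 : 0 < c := by positivity
  let Φ : ℝ → ℝ := fun t => (1 + |t|) ^ (max D D') * Real.exp (-t ^ 2 / 4) + ((1 + |t|) ^ 4)⁻¹
  refine ⟨fun t => (1 + |t|) ^ 2 * Φ t, ?_, fun η hη => ?_⟩
  · have h1 := integrable_one_add_abs_pow_mul_exp (max D D' + 2) (c := 1 / 4) (by norm_num)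
    refine (h1.add integrable_inv_one_add_sq).mono' (by
      refine Continuous.aestronglyMeasurable ?_
      have : ∀ t : ℝ, (1 + |t|) ^ 4 ≠ 0 := fun t => by positivity
      fun_prop (disch := exact this _)) (ae_of_all _ fun t => ?_)
    have hpos : 0 ≤ (1 + |t|) ^ 2 * Φ t := by positivity
    rw [Real.norm_eq_abs, abs_of_nonneg hpos]
    simp only [Φ, mul_add, Pi.add_apply]
    refine add_le_add (le_of_eq ?_) ?_
    · rw [pow_add]; ring_nf
    · rw [show (1 + |t|) ^ 2 * ((1 + |t|) ^ 4)⁻¹ = ((1 + |t|) ^ 2)⁻¹ by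
        rw [show (1 + |t|) ^ 4 = (1 + |t|) ^ 2 * (1 + |t|) ^ 2 by ring]
        have : (1 + |t|) ^ 2 ≠ 0 := by positivity
        field_simp]
      gcongr
      nlinarith [sq_abs t, abs_nonneg t]
  -- The inner bound carries K(η' + ε): η' takes care of one half and large n of the other. Division
  -- by c prepays the cost of multiplying by u^i in the product rule.
  · set η' : ℝ := min 1 (η / c / (2 * (K + 1))) with hη'
    have hη'0 : 0 < η' := lt_min one_pos (by positivity)
    obtain ⟨δ, hδ, hin'⟩ := hin η' hη'0 (min_le_left _ _)
    have hKη : K * η' ≤ η / c / 2 := by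
      calc K * η' ≤ (K + 1) * (η / c / (2 * (K + 1))) := by
            gcongr
            · linarith
            · exact min_le_right _ _
        _ = η / c / 2 := by field_simp
    have hε0 : Tendsto (fun n : ℕ => K * (√(n : ℝ))⁻¹) atTop (𝓝 0) := by
      have h1 : Tendsto (fun n : ℕ => √(n : ℝ)) atTop atTop :=
        Real.tendsto_sqrt_atTop.comp tendsto_natCast_atTop_atTop
      simpa using h1.inv_tendsto_atTop.const_mul K
    filter_upwards [hout δ hδ (η / c) (by positivity), eventually_ge_atTop 1,
      hε0.eventually_le_const (u := η / c / 2) (by positivity)] with n hn hn1 hKε t i hi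
    obtain ⟨hε, hε1, -⟩ := inv_sqrt_natCast_bounds hn1
    have h1 : (1 : ℝ) ≤ 1 + |t| := by linarith [abs_nonneg t]
    have hJ : JetBound s (edgeworthDiff f k s N a n) t
        (η / c * (√(n : ℝ))⁻¹ ^ (s - 2) * Φ t) := by
      rcases lt_or_ge |(√(n : ℝ))⁻¹ * t| δ with hlt | hge
      · refine (hin' n hn1 t hlt).mono ?_
        have e : (√(n : ℝ))⁻¹ ^ (s - 1) = (√(n : ℝ))⁻¹ ^ (s - 2) * (√(n : ℝ))⁻¹ := by
          rw [← pow_succ]; congr 1; omega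
        rw [e]
        calc K * (1 + |t|) ^ D * ((η' * (√(n : ℝ))⁻¹ ^ (s - 2) + (√(n : ℝ))⁻¹ ^ (s - 2) *
              (√(n : ℝ))⁻¹) * Real.exp (-t ^ 2 / 4))
            = (K * η' + K * (√(n : ℝ))⁻¹) * (√(n : ℝ))⁻¹ ^ (s - 2) *
              ((1 + |t|) ^ D * Real.exp (-t ^ 2 / 4)) := by ring
          _ ≤ (η / c / 2 + η / c / 2) * (√(n : ℝ))⁻¹ ^ (s - 2) * Φ t := by
            gcongr
            have h2 : (1 + |t|) ^ D ≤ (1 + |t|) ^ (max D D') :=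
              pow_le_pow_right₀ h1 (le_max_left _ _)
            have h3 : 0 ≤ ((1 + |t|) ^ 4)⁻¹ := by positivity
            have h4 := mul_le_mul_of_nonneg_right h2 (Real.exp_pos (-t ^ 2 / 4)).le
            simp only [Φ]
            linarith
          _ = _ := by ring
      · refine (hn t hge).mono ?_
        simp only [Φ]
        gcongr
        exact le_max_right _ _
    have hpow := (JetBound.ofReal s t).pow Complex.ofRealCLM.contDiff i
    have hmul := hpow.mul (Complex.ofRealCLM.contDiff.pow i)
      (contDiff_edgeworthDiff hfC k s N a n) hJ
    refine hmul.mono ?_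
    have hΦ0 : 0 ≤ Φ t := by positivity
    have h2 : (2 ^ s * (1 + |t|)) ^ i ≤ (2 ^ s * (1 + |t|)) ^ 2 := by
      refine pow_le_pow_right₀ ?_ hi
      have : (1 : ℝ) ≤ 2 ^ s := one_le_pow₀ (by norm_num)
      nlinarith
    calc 2 ^ s * (2 ^ s * (1 + |t|)) ^ i * (η / c * (√(n : ℝ))⁻¹ ^ (s - 2) * Φ t)
        ≤ 2 ^ s * (2 ^ s * (1 + |t|)) ^ 2 * (η / c * (√(n : ℝ))⁻¹ ^ (s - 2) * Φ t) := by gcongr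
      _ = c * (η / c) * (√(n : ℝ))⁻¹ ^ (s - 2) * ((1 + |t|) ^ 2 * Φ t) := by
        rw [hc]; ring
      _ = _ := by rw [mul_div_cancel₀ _ hc0.ne']

/-! ### Fourier inversion with weights; positivity of the density. -/

section Fourier

open scoped FourierTransform

theorem norm_fourier_le_integral_norm (f : ℝ → ℂ) (x : ℝ) : ‖𝓕 f x‖ ≤ ∫ v, ‖f v‖ :=
  VectorFourier.norm_fourierIntegral_le_integral_norm _ _ _ _ _

/-- Weighted bounds for a Fourier transform and its derivatives. -/
theorem fourier_weighted_bound {s : ℕ} {h : ℝ → ℂ} (hh : ContDiff ℝ s h) {Ψ : ℝ → ℝ} {c : ℝ}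
    (hΨ : Integrable Ψ)
    (hb : ∀ t : ℝ, ∀ i ≤ 2, JetBound s (fun u => (u : ℂ) ^ i * h u) t (c * Ψ t)) :
    ContDiff ℝ 2 (𝓕 fun τ : ℝ => h (2 * Real.pi * τ)) ∧ ∀ i ≤ 2, ∀ x : ℝ,
      (1 + |x| ^ s) * ‖iteratedDeriv i (𝓕 fun τ : ℝ => h (2 * Real.pi * τ)) x‖ ≤
        c * ∫ t, Ψ t := by
  have hpi : 0 < 2 * Real.pi := by positivity
  have hpi1 : 1 ≤ Real.pi := by linarith [Real.pi_gt_three]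
  -- The factor (-iu)^i at u = 2πτ is the multiplier for which the transform of `v i` is the i-th
  -- derivative of the transform of h.
  let v : ℕ → ℝ → ℂ := fun i τ => (-Complex.I) ^ i *
    (fun u : ℝ => (u : ℂ) ^ i * h u) (2 * Real.pi * τ)
  have hwC : ∀ i, ContDiff ℝ s (fun u : ℝ => (u : ℂ) ^ i * h u) := fun i =>
    (Complex.ofRealCLM.contDiff.pow i).mul hh
  have hvC : ∀ i, ContDiff ℝ s (v i) := fun i =>
    contDiff_const.mul ((hwC i).comp (contDiff_const.mul contDiff_id))
  have hvd : ∀ i, ∀ j ≤ s, ∀ τ, iteratedDeriv j (v i) τ = (-Complex.I) ^ i *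
      ((2 * Real.pi) ^ j • iteratedDeriv j (fun u : ℝ => (u : ℂ) ^ i * h u) (2 * Real.pi * τ)) := by
    intro i j hj τ
    simp only [v]
    rw [iteratedDeriv_const_mul_field]
    congr 1
    exact congrFun (iteratedDeriv_comp_const_smul
      ((hwC i).of_le (by exact_mod_cast hj)) (2 * Real.pi)) τ
  have hvn : ∀ i ≤ 2, ∀ j ≤ s, ∀ τ, ‖iteratedDeriv j (v i) τ‖ ≤
      (2 * Real.pi) ^ j * (c * Ψ (2 * Real.pi * τ)) := by
    intro i hi j hj τ
    rw [hvd i j hj, norm_mul, norm_pow, norm_neg, Complex.norm_I, one_pow, one_mul, norm_smul,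
      norm_pow, Real.norm_eq_abs, abs_of_pos hpi]
    gcongr
    exact hb _ i hi j hj
  have hΨ2 : Integrable fun τ => Ψ (2 * Real.pi * τ) := hΨ.comp_mul_left' hpi.ne'
  have hvI : ∀ i ≤ 2, ∀ j ≤ s, Integrable (iteratedDeriv j (v i)) := fun i hi j hj =>
    ((hΨ2.const_mul c).const_mul _).mono'
      ((hvC i).continuous_iteratedDeriv j (by exact_mod_cast hj)).aestronglyMeasurable
      (ae_of_all _ (hvn i hi j hj))
  have hInt : ∀ i ≤ 2, ∀ j ≤ s, ∫ τ, ‖iteratedDeriv j (v i) τ‖ ≤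
      (2 * Real.pi) ^ j * (c * ((2 * Real.pi)⁻¹ * ∫ t, Ψ t)) := by
    intro i hi j hj
    refine (integral_mono (hvI i hi j hj).norm ((hΨ2.const_mul c).const_mul _)
      (hvn i hi j hj)).trans (le_of_eq ?_)
    rw [integral_const_mul, integral_const_mul, Measure.integral_comp_mul_left, smul_eq_mul,
      abs_of_pos (by positivity)]
  have hv0 : ∀ i ≤ 2, Integrable (v i) := fun i hi => by simpa using hvI i hi 0 (Nat.zero_le _)
  have hveq : ∀ i, v i = fun τ : ℝ => (-2 * Real.pi * Complex.I * τ) ^ i • h (2 * Real.pi * τ) := by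
    intro i
    ext τ
    simp only [v, smul_eq_mul]
    push_cast
    rw [← mul_assoc, ← mul_pow]
    ring
  have hxI : ∀ i : ℕ, i ≤ 2 → Integrable fun τ : ℝ => τ ^ i • h (2 * Real.pi * τ) := by
    intro i hi
    have h1 := (hv0 i hi).const_mul ((-2 * Real.pi * Complex.I) ^ i)⁻¹
    refine h1.congr (ae_of_all _ fun τ => ?_)
    have h2 : (-2 * Real.pi * Complex.I) ^ i ≠ 0 := by
      refine pow_ne_zero _ (mul_ne_zero (mul_ne_zero (by norm_num) ?_) Complex.I_ne_zero)
      exact_mod_cast Real.pi_ne_zero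
    simp only [hveq, smul_eq_mul, Complex.real_smul]
    rw [mul_pow _ (τ : ℂ)]
    push_cast
    field_simp
  refine ⟨Real.contDiff_fourier (N := 2) fun i hi => ?_, fun i hi x => ?_⟩
  · refine (hxI i (by exact_mod_cast hi)).norm.congr (ae_of_all _ fun τ => ?_)
    simp
  · have hd : iteratedDeriv i (𝓕 fun τ : ℝ => h (2 * Real.pi * τ)) = 𝓕 (v i) := by
      rw [hveq]
      exact Real.iteratedDeriv_fourier (N := 2) (fun n hn => hxI n (by exact_mod_cast hn))
        (by exact_mod_cast hi)
    rw [hd]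
    set J : ℝ := c * ((2 * Real.pi)⁻¹ * ∫ t, Ψ t) with hJ
    have h0 : ‖𝓕 (v i) x‖ ≤ J := by
      refine (norm_fourier_le_integral_norm _ _).trans ?_
      simpa using hInt i hi 0 (Nat.zero_le _)
    -- The transform of the s-th derivative is (2πix)^s times the transform; its factor (2π)^s
    -- cancels the one produced by the dilation.
    have hs : |x| ^ s * ‖𝓕 (v i) x‖ ≤ J := by
      have h1 := congrFun (Real.fourier_iteratedDeriv (N := (s : ℕ∞)) (n := s) (by exact_mod_cast hvC i)
        (fun n hn => hvI i hi n (by exact_mod_cast hn)) le_rfl) x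
      have h2 : ‖𝓕 (iteratedDeriv s (v i)) x‖ ≤ (2 * Real.pi) ^ s * J :=
        (norm_fourier_le_integral_norm _ _).trans (hInt i hi s le_rfl)
      rw [h1, norm_smul, norm_pow, norm_mul, norm_mul, norm_mul, Complex.norm_I, Complex.norm_real,
        Complex.norm_real, Real.norm_eq_abs, Real.norm_eq_abs, abs_of_pos Real.pi_pos, mul_one,
        Complex.norm_ofNat, mul_pow, mul_assoc] at h2
      exact le_of_mul_le_mul_left h2 (by positivity)
    have hJ0 : 0 ≤ J := (norm_nonneg _).trans h0
    have hJle : 2 * J ≤ c * ∫ t, Ψ t := by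
      have : c * ∫ t, Ψ t = 2 * Real.pi * J := by rw [hJ]; field_simp
      rw [this]
      nlinarith
    rw [add_mul, one_mul]
    linarith

/-- The inverse Fourier transform of an integrable characteristic function is nonnegative. -/
theorem fourier_charFun_nonneg (ν : Measure ℝ) [IsProbabilityMeasure ν]
    (hInt : Integrable fun τ : ℝ => charFun ν (2 * Real.pi * τ)) (x : ℝ) :
    0 ≤ (𝓕 (fun τ : ℝ => charFun ν (2 * Real.pi * τ)) x).re ∧
      (𝓕 (fun τ : ℝ => charFun ν (2 * Real.pi * τ)) x).im = 0 := by
  rw [Real.fourier_real_eq_integral_exp_smul]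
  have hInt' : Integrable fun τ : ℝ => Complex.exp (↑(-2 * Real.pi * τ * x) * Complex.I) •
      charFun ν (2 * Real.pi * τ) := by
    refine hInt.bdd_mul (c := 1) (by fun_prop) (ae_of_all _ fun τ => ?_)
    rw [Complex.norm_exp_ofReal_mul_I]
  have hlim := Real.tendsto_integral_cexp_sq_smul hInt'
  -- Gaussian regularization: after Fubini the regularized integral is the ν-integral of a positive
  -- Gaussian. Reality and nonnegativity survive as c tends to infinity.
  have key : ∀ c : ℝ, 0 < c → ∫ τ : ℝ, Complex.exp (-c⁻¹ * ‖τ‖ ^ 2) •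
      (Complex.exp (↑(-2 * Real.pi * τ * x) * Complex.I) • charFun ν (2 * Real.pi * τ)) =
      ((∫ y, (Real.pi / c⁻¹) ^ (1 / 2 : ℝ) * Real.exp (-(2 * Real.pi * (y - x)) ^ 2 / (4 * c⁻¹)) ∂ν
        : ℝ) : ℂ) := by
    intro c hc
    have hF : ∀ τ y : ℝ, Complex.exp (-c⁻¹ * ‖τ‖ ^ 2) *
        (Complex.exp (↑(-2 * Real.pi * τ * x) * Complex.I) *
          Complex.exp (↑(2 * Real.pi * τ) * y * Complex.I)) =
        Complex.exp (Complex.I * (2 * Real.pi * (y - x) : ℝ) * τ) *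
          Complex.exp (-(c⁻¹ : ℝ) * (τ : ℂ) ^ 2) := by
      intro τ y
      simp only [← Complex.exp_add]
      congr 1
      rw [Real.norm_eq_abs, ← Complex.ofReal_pow, sq_abs]
      push_cast
      ring
    calc ∫ τ : ℝ, Complex.exp (-c⁻¹ * ‖τ‖ ^ 2) •
          (Complex.exp (↑(-2 * Real.pi * τ * x) * Complex.I) • charFun ν (2 * Real.pi * τ))
        = ∫ τ : ℝ, ∫ y, Complex.exp (Complex.I * (2 * Real.pi * (y - x) : ℝ) * τ) *
          Complex.exp (-(c⁻¹ : ℝ) * (τ : ℂ) ^ 2) ∂ν := by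
          refine integral_congr_ae (ae_of_all _ fun τ => ?_)
          simp only [smul_eq_mul, charFun_apply_real]
          rw [← integral_const_mul, ← integral_const_mul]
          exact integral_congr_ae (ae_of_all _ fun y => hF τ y)
      _ = ∫ y, (∫ τ : ℝ, Complex.exp (Complex.I * (2 * Real.pi * (y - x) : ℝ) * τ) *
          Complex.exp (-(c⁻¹ : ℝ) * (τ : ℂ) ^ 2)) ∂ν := by
          refine integral_integral_swap ?_
          have hg : Integrable (fun τ : ℝ => Real.exp (-c⁻¹ * τ ^ 2)) :=
            integrable_exp_neg_mul_sq (by positivity)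
          have h2 : Integrable (fun z : ℝ × ℝ => Real.exp (-c⁻¹ * z.1 ^ 2) * (1 : ℝ))
              (volume.prod ν) := hg.mul_prod (integrable_const (μ := ν) (1 : ℝ))
          refine h2.mono' (Continuous.aestronglyMeasurable (by fun_prop)) (ae_of_all _ fun z => ?_)
          simp only [Function.uncurry]
          rw [norm_mul, mul_one]
          have e1 : ‖Complex.exp (Complex.I * (2 * Real.pi * (z.2 - x) : ℝ) * z.1)‖ = 1 := by
            rw [show Complex.I * ((2 * Real.pi * (z.2 - x) : ℝ) : ℂ) * (z.1 : ℂ) =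
              ((2 * Real.pi * (z.2 - x) * z.1 : ℝ) : ℂ) * Complex.I by push_cast; ring]
            exact Complex.norm_exp_ofReal_mul_I _
          have e2 : Complex.exp (-(c⁻¹ : ℝ) * (z.1 : ℂ) ^ 2) =
              ((Real.exp (-c⁻¹ * z.1 ^ 2) : ℝ) : ℂ) := by push_cast; rfl
          rw [e1, e2, one_mul, Complex.norm_real, Real.norm_eq_abs, abs_of_pos (Real.exp_pos _)]
      _ = _ := by
          rw [← integral_complex_ofReal]
          refine integral_congr_ae (ae_of_all _ fun y => ?_)
          beta_reduce
          rw [fourierIntegral_gaussian (by simpa using hc)]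
          push_cast
          congr 1
          rw [show (1 / 2 : ℂ) = ((1 / 2 : ℝ) : ℂ) by push_cast; rfl,
            ← Complex.ofReal_inv, ← Complex.ofReal_div, ← Complex.ofReal_cpow (by positivity)]
  have hev : ∀ᶠ c : ℝ in atTop, 0 < c := eventually_gt_atTop 0
  constructor
  · refine ge_of_tendsto ((Complex.continuous_re.tendsto _).comp hlim) ?_
    filter_upwards [hev] with c hc
    simp only [Function.comp]
    rw [key c hc, Complex.ofReal_re]
    exact integral_nonneg fun y => by positivity
  · refine tendsto_nhds_unique ((Complex.continuous_im.tendsto _).comp hlim)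
      (tendsto_const_nhds.congr' ?_)
    filter_upwards [hev] with c hc
    simp only [Function.comp]
    rw [key c hc, Complex.ofReal_im]

/-- A law with a nice characteristic function has the density given by Fourier inversion. -/
theorem isACDensity_re_fourier (ν : Measure ℝ) [IsProbabilityMeasure ν]
    (hInt : Integrable fun τ : ℝ => charFun ν (2 * Real.pi * τ))
    (hInt' : Integrable (𝓕 fun τ : ℝ => charFun ν (2 * Real.pi * τ)))
    (hC : ContDiff ℝ 1 (𝓕 fun τ : ℝ => charFun ν (2 * Real.pi * τ))) :
    IsACDensity ν fun x => (𝓕 (fun τ : ℝ => charFun ν (2 * Real.pi * τ)) x).re := by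
  set H : ℝ → ℂ := fun τ : ℝ => charFun ν (2 * Real.pi * τ) with hH
  set p : ℝ → ℝ := fun x => (𝓕 H x).re with hp
  have hp0 : ∀ x, 0 ≤ p x := fun x => (fourier_charFun_nonneg ν hInt x).1
  have hpeq : ∀ x, (p x : ℂ) = 𝓕 H x := fun x =>
    Complex.ext rfl (by simpa using ((fourier_charFun_nonneg ν hInt x).2).symm)
  have hpC : ContDiff ℝ 1 p := Complex.reCLM.contDiff.comp hC
  have hpI : Integrable p := hInt'.re
  have hfin : IsFiniteMeasure (volume.withDensity fun x => ENNReal.ofReal (p x)) :=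
    isFiniteMeasure_withDensity_ofReal hpI.2
  refine ⟨hp0, fun a b => hpC.contDiffOn.absolutelyContinuousOnInterval, ?_⟩
  -- Fourier inversion of H shows that the measure with the candidate density has the characteristic
  -- function of ν.
  refine Measure.ext_of_charFun ?_
  ext t
  have hHc : Continuous H := continuous_charFun.comp (by fun_prop)
  have h1 := congrFun (hHc.fourierInv_fourier_eq hInt hInt') (t / (2 * Real.pi))
  have h2 : H (t / (2 * Real.pi)) = charFun ν t := by
    simp only [hH]
    congr 1
    field_simp
  rw [← h2, ← h1, charFun_apply_real, Real.fourierInv_eq',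
    integral_withDensity_eq_integral_toReal_smul hpC.continuous.measurable.ennreal_ofReal
      (ae_of_all _ fun _ => ENNReal.ofReal_lt_top)]
  refine integral_congr_ae (ae_of_all _ fun x => ?_)
  simp only [ENNReal.toReal_ofReal (hp0 x), smul_eq_mul, Complex.real_smul, ← hpeq]
  rw [mul_comm]
  congr 2
  simp
  field_simp

end Fourier

/-! ### The Edgeworth polynomial in ε and x, and its parity. -/

section EdgeworthPolynomial

open Polynomial

noncomputable section

/-- The Edgeworth exponent divided by `ε^{k-2}`, as a polynomial in `ε` and `it`. -/
def edgeworthReducedExponent (k s : ℕ) (a : ℕ → ℝ) : ℝ[X][X] :=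
  ∑ j ∈ Finset.Icc k s, monomial j (monomial (j - k) (a j))

/-- The polynomial `B` in `ε` and `y` such that the truncated exponential of the Edgeworth exponent
is `1 + ε^{k-2} B(ε, it)`. -/
def edgeworthReducedPoly (k s N : ℕ) (a : ℕ → ℝ) : ℝ[X][X] :=
  ∑ l ∈ Finset.range N, C (C ((l + 1).factorial : ℝ)⁻¹ * X ^ ((k - 2) * l)) *
    edgeworthReducedExponent k s a ^ (l + 1)

/-- The polynomial in `ε` and `x` obtained from `edgeworthReducedPoly` by replacing the powers of
`it` by Hermite polynomials. -/
def edgeworthHermite (k s N : ℕ) (a : ℕ → ℝ) : ℝ[X][X] :=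
  ∑ b ∈ Finset.range ((edgeworthReducedPoly k s N a).natDegree + 1),
    C ((edgeworthReducedPoly k s N a).coeff b) * (hermite b).map (Int.castRingHom ℝ[X])

/-- The specialization of a bivariate polynomial at a value of the coefficient variable. -/
def specialize (P : ℝ[X][X]) (ε : ℝ) : ℝ[X] := P.map (evalRingHom ε)

end

variable (k s N : ℕ) (a : ℕ → ℝ)

theorem specialize_edgeworthHermite (ε : ℝ) :
    specialize (edgeworthHermite k s N a) ε =
      ∑ b ∈ Finset.range ((edgeworthReducedPoly k s N a).natDegree + 1),
        C (((edgeworthReducedPoly k s N a).coeff b).eval ε) *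
          (hermite b).map (Int.castRingHom ℝ) := by
  simp only [specialize, edgeworthHermite, Polynomial.map_sum, Polynomial.map_mul, map_C,
    Polynomial.map_map, coe_evalRingHom]
  refine Finset.sum_congr rfl fun b _ => ?_
  congr 2
  exact RingHom.ext_int _ _

theorem eval_specialize_edgeworthReducedPoly (ε z : ℝ) :
    (specialize (edgeworthReducedPoly k s N a) ε).eval z =
      ∑ l ∈ Finset.range N, ((l + 1).factorial : ℝ)⁻¹ * ε ^ ((k - 2) * l) *
        (∑ j ∈ Finset.Icc k s, a j * ε ^ (j - k) * z ^ j) ^ (l + 1) := by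
  simp [specialize, edgeworthReducedPoly, edgeworthReducedExponent, Polynomial.map_sum,
    eval_finsetSum]

theorem coeff_specialize_edgeworthReducedPoly (ε : ℝ) (b : ℕ) :
    (specialize (edgeworthReducedPoly k s N a) ε).coeff b =
      ((edgeworthReducedPoly k s N a).coeff b).eval ε := by
  simp [specialize, coeff_map]

/-- Under (ε, z) → (-ε, -z) each term ε^{j-k}z^j acquires (-1)^k, and the prefactor ε^{(k-2)l} makes
the total sign (-1)^{(k-2)l + k(l+1)} = (-1)^k for every l. Comparing coefficients of z^b gives the
claim. -/
theorem eval_coeff_edgeworthReducedPoly_neg (hk : 2 ≤ k) (ε : ℝ) (b : ℕ) :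
    ((edgeworthReducedPoly k s N a).coeff b).eval (-ε) =
      (-1) ^ (b + k) * ((edgeworthReducedPoly k s N a).coeff b).eval ε := by
  have h : (specialize (edgeworthReducedPoly k s N a) (-ε)).comp (C (-1) * X) =
      C ((-1) ^ k) * specialize (edgeworthReducedPoly k s N a) ε := by
    refine Polynomial.funext fun z => ?_
    rw [eval_comp, eval_mul, eval_C, eval_C_mul, eval_X, eval_specialize_edgeworthReducedPoly,
      eval_specialize_edgeworthReducedPoly, Finset.mul_sum]
    refine Finset.sum_congr rfl fun l _ => ?_
    have h1 : ∑ j ∈ Finset.Icc k s, a j * (-ε) ^ (j - k) * (-1 * z) ^ j =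
        (-1) ^ k * ∑ j ∈ Finset.Icc k s, a j * ε ^ (j - k) * z ^ j := by
      rw [Finset.mul_sum]
      refine Finset.sum_congr rfl fun j hj => ?_
      obtain ⟨i, rfl⟩ := Nat.exists_eq_add_of_le (Finset.mem_Icc.1 hj).1
      have h2 : ((-1 : ℝ) ^ i) * (-1) ^ i = 1 := by
        rw [← mul_pow]; simp
      rw [Nat.add_sub_cancel_left, neg_pow ε, mul_pow, pow_add (-1 : ℝ)]
      linear_combination (a (k + i) * ε ^ i * (-1) ^ k * z ^ (k + i)) * h2
    rw [h1, mul_pow, neg_pow ε]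
    obtain ⟨i, rfl⟩ := Nat.exists_eq_add_of_le' hk
    have h3 : ((-1 : ℝ) ^ ((i + 2 - 2) * l)) * ((-1) ^ (i + 2)) ^ (l + 1) = (-1) ^ (i + 2) := by
      rw [Nat.add_sub_cancel, ← pow_mul, ← pow_add,
        show i * l + (i + 2) * (l + 1) = 2 * (i * l + l) + (i + 2) by ring, pow_add _ (2 * _),
        pow_mul]
      simp
    linear_combination (((l + 1).factorial : ℝ)⁻¹ * ε ^ ((i + 2 - 2) * l) *
      (∑ j ∈ Finset.Icc (i + 2) s, a j * ε ^ (j - (i + 2)) * z ^ j) ^ (l + 1)) * h3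
  have h1 := congrArg (fun p => coeff p b) h
  simp only [comp_C_mul_X_coeff, coeff_C_mul, coeff_specialize_edgeworthReducedPoly] at h1
  have h2 : ((-1 : ℝ) ^ b) * (-1) ^ b = 1 := by rw [← mul_pow]; simp
  rw [pow_add]
  linear_combination (-1) ^ b * h1 -
    (((edgeworthReducedPoly k s N a).coeff b).eval (-ε)) * h2

theorem hermite_comp_neg_X (m : ℕ) : (hermite m).comp (-X) = (-1) ^ m * hermite m := by
  induction m with
  | zero => simp
  | succ m ih =>
    have h1 : (derivative (hermite m)).comp (-X) = -derivative ((hermite m).comp (-X)) := by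
      rw [derivative_comp]; simp
    have h2 : derivative ((-1 : ℤ[X]) ^ m * hermite m) = (-1) ^ m * derivative (hermite m) := by
      have : ((-1 : ℤ[X]) ^ m) = C ((-1) ^ m) := by simp
      rw [this, derivative_C_mul]
    rw [hermite_succ, sub_comp, mul_comp, X_comp, ih, h1, ih, h2]
    ring

theorem eval_hermite_neg (m : ℕ) (x : ℝ) :
    ((hermite m).map (Int.castRingHom ℝ)).eval (-x) =
      (-1) ^ m * ((hermite m).map (Int.castRingHom ℝ)).eval x := by
  have h := congrArg (fun p => (p.map (Int.castRingHom ℝ)).eval x) (hermite_comp_neg_X m)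
  simpa [Polynomial.map_comp, eval_comp] using h

theorem eval_specialize_edgeworthHermite_neg (hk : 2 ≤ k) (ε x : ℝ) :
    (specialize (edgeworthHermite k s N a) (-ε)).eval (-x) =
      (-1) ^ k * (specialize (edgeworthHermite k s N a) ε).eval x := by
  simp only [specialize_edgeworthHermite, eval_finsetSum, eval_mul, eval_C, Finset.mul_sum]
  refine Finset.sum_congr rfl fun b _ => ?_
  rw [eval_coeff_edgeworthReducedPoly_neg k s N a hk, eval_hermite_neg]
  have h2 : ((-1 : ℝ) ^ b) * (-1) ^ b = 1 := by rw [← mul_pow]; simp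
  rw [pow_add]
  linear_combination ((-1) ^ k * ((edgeworthReducedPoly k s N a).coeff b).eval ε *
    ((hermite b).map (Int.castRingHom ℝ)).eval x) * h2

/-- At ε = 0 only the linear term of the exponential and the lowest cumulant survive. -/
theorem specialize_edgeworthHermite_zero (hk : 3 ≤ k) (hks : k ≤ s) (hN : 1 ≤ N) :
    specialize (edgeworthHermite k s N a) 0 =
      C (a k) * (hermite k).map (Int.castRingHom ℝ) := by
  have h : specialize (edgeworthReducedPoly k s N a) 0 = monomial k (a k) := by
    refine Polynomial.funext fun z => ?_
    rw [eval_specialize_edgeworthReducedPoly, Finset.sum_eq_single 0, Finset.sum_eq_single k]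
    · simp
    · intro j hj hjk
      have : j - k ≠ 0 := by have := (Finset.mem_Icc.1 hj).1; omega
      simp [this]
    · intro h
      exact absurd (Finset.mem_Icc.2 ⟨le_rfl, hks⟩) h
    · intro l _ hl
      have : (k - 2) * l ≠ 0 := Nat.mul_ne_zero (by omega) hl
      simp [this]
    · intro h
      simp at h
      omega
  have hc : ∀ b, ((edgeworthReducedPoly k s N a).coeff b).eval 0 = if k = b then a k else 0 := by
    intro b
    rw [← coeff_specialize_edgeworthReducedPoly, h, coeff_monomial]
  rw [specialize_edgeworthHermite]
  simp only [hc]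
  rw [Finset.sum_eq_single k]
  · simp
  · intro b _ hb
    simp [hb.symm]
  -- If the degree in y is below k, the coefficient of order k vanishes, hence a_k = 0 and both
  -- sides are 0.
  · intro hkn
    have h1 : (edgeworthReducedPoly k s N a).coeff k = 0 :=
      coeff_eq_zero_of_natDegree_lt (by simpa using hkn)
    have h2 := hc k
    rw [h1] at h2
    simp at h2
    simp [← h2]

/-- Each term of the exponent has the factor ε^{k-2}; the power l + 1 contributes it l + 1 times,
one of which is taken out in front. -/
theorem expTrunc_edgeworthExponent (hk : 2 ≤ k) (ε t : ℝ) :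
    expTrunc N (edgeworthExponent k s a ε t) = 1 + (ε : ℂ) ^ (k - 2) *
      ∑ b ∈ Finset.range ((edgeworthReducedPoly k s N a).natDegree + 1),
        ((((edgeworthReducedPoly k s N a).coeff b).eval ε : ℝ) : ℂ) * (Complex.I * t) ^ b := by
  have h1 : ∑ b ∈ Finset.range ((edgeworthReducedPoly k s N a).natDegree + 1),
        ((((edgeworthReducedPoly k s N a).coeff b).eval ε : ℝ) : ℂ) * (Complex.I * t) ^ b =
      (edgeworthReducedPoly k s N a).eval₂ (Complex.ofRealHom.comp (evalRingHom ε))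
        (Complex.I * t) := by
    rw [eval₂_eq_sum_range]
    rfl
  rw [h1]
  have h2 : (edgeworthReducedPoly k s N a).eval₂ (Complex.ofRealHom.comp (evalRingHom ε))
        (Complex.I * t) = ∑ l ∈ Finset.range N, (((l + 1).factorial : ℂ)⁻¹ *
        (ε : ℂ) ^ ((k - 2) * l)) *
        (∑ j ∈ Finset.Icc k s, ((a j * ε ^ (j - k) : ℝ) : ℂ) * (Complex.I * t) ^ j) ^ (l + 1) := by
    simp [edgeworthReducedPoly, edgeworthReducedExponent, eval₂_finsetSum, eval₂_mul, eval₂_pow,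
      eval₂_monomial]
  have h3 : edgeworthExponent k s a ε t = (ε : ℂ) ^ (k - 2) *
      ∑ j ∈ Finset.Icc k s, ((a j * ε ^ (j - k) : ℝ) : ℂ) * (Complex.I * t) ^ j := by
    rw [edgeworthExponent, Finset.mul_sum]
    refine Finset.sum_congr rfl fun j hj => ?_
    have : (ε : ℂ) ^ (j - 2) = (ε : ℂ) ^ (k - 2) * (ε : ℂ) ^ (j - k) := by
      have := (Finset.mem_Icc.1 hj).1
      rw [← pow_add]; congr 1; omega
    push_cast
    rw [this]
    ring
  rw [h2, expTrunc, Finset.sum_range_succ', h3]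
  generalize ∑ j ∈ Finset.Icc k s, ((a j * ε ^ (j - k) : ℝ) : ℂ) * (Complex.I * t) ^ j = S
  rw [Finset.mul_sum, pow_zero, Nat.factorial_zero,
    Nat.cast_one, div_one, add_comm (1 : ℂ)]
  refine congrArg (· + (1 : ℂ)) (Finset.sum_congr rfl fun l _ => ?_)
  rw [mul_pow, pow_mul, pow_succ ((ε : ℂ) ^ (k - 2))]
  ring

end EdgeworthPolynomial

/-! ### Gaussian integrals of polynomials and the leading coefficient. -/

theorem gaussianPDFReal_zero_one (x : ℝ) :
    gaussianPDFReal 0 1 x = (√(2 * Real.pi))⁻¹ * Real.exp (-x ^ 2 / 2) := by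
  simp [gaussianPDFReal]

theorem gaussianPDFReal_zero_one_pos (x : ℝ) : 0 < gaussianPDFReal 0 1 x :=
  gaussianPDFReal_pos 0 1 x one_ne_zero

theorem hasDerivAt_gaussianPDFReal_zero_one (x : ℝ) :
    HasDerivAt (gaussianPDFReal 0 1) (-x * gaussianPDFReal 0 1 x) x := by
  have h := ((((hasDerivAt_id x).pow 2).neg.div_const 2).exp).const_mul (√(2 * Real.pi))⁻¹
  have e : gaussianPDFReal 0 1 = fun x => (√(2 * Real.pi))⁻¹ * Real.exp (-x ^ 2 / 2) :=
    funext gaussianPDFReal_zero_one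
  rw [e]
  refine h.congr_deriv ?_
  simp
  ring

section GaussianPolynomial

open Polynomial

theorem exists_abs_eval_le_of_abs_le_one (q : ℝ[X]) :
    ∃ K : ℝ, 0 ≤ K ∧ ∀ ε : ℝ, |ε| ≤ 1 → |q.eval ε| ≤ K := by
  obtain ⟨K, hK⟩ := (isCompact_Icc (a := (-1 : ℝ)) (b := 1)).exists_bound_of_continuousOn
    q.continuous.continuousOn
  exact ⟨K, (norm_nonneg _).trans (hK 0 (by simp)), fun ε hε => hK ε (abs_le.1 hε)⟩

theorem exists_abs_eval_specialize_le (P : ℝ[X][X]) :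
    ∃ (K : ℝ) (D : ℕ), 0 ≤ K ∧ ∀ ε : ℝ, |ε| ≤ 1 → ∀ x : ℝ,
      |(specialize P ε).eval x| ≤ K * (1 + |x|) ^ D := by
  choose K hK0 hK using fun i => exists_abs_eval_le_of_abs_le_one (P.coeff i)
  refine ⟨∑ i ∈ Finset.range (P.natDegree + 1), K i, P.natDegree,
    Finset.sum_nonneg fun i _ => hK0 i, fun ε hε x => ?_⟩
  have e : (specialize P ε).eval x =
      ∑ i ∈ Finset.range (P.natDegree + 1), (P.coeff i).eval ε * x ^ i := by
    rw [specialize, eval_map, eval₂_eq_sum_range]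
    rfl
  rw [e, Finset.sum_mul]
  refine (Finset.abs_sum_le_sum_abs _ _).trans (Finset.sum_le_sum fun i hi => ?_)
  rw [abs_mul, abs_pow]
  have h1 : (1 : ℝ) ≤ 1 + |x| := by linarith [abs_nonneg x]
  refine mul_le_mul (hK i ε hε) ?_ (by positivity) (hK0 i)
  calc |x| ^ i ≤ (1 + |x|) ^ i := by gcongr; linarith
    _ ≤ _ := pow_le_pow_right₀ h1 (by simpa [Nat.lt_succ_iff] using hi)

theorem exists_abs_eval_le (P : ℝ[X]) :
    ∃ (K : ℝ) (D : ℕ), 0 ≤ K ∧ ∀ x : ℝ, |P.eval x| ≤ K * (1 + |x|) ^ D := by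
  obtain ⟨K, D, hK, h⟩ := exists_abs_eval_specialize_le (P.map C)
  refine ⟨K, D, hK, fun x => ?_⟩
  have := h 0 (by simp) x
  rwa [specialize, Polynomial.map_map, show (evalRingHom (0 : ℝ)).comp C = RingHom.id ℝ by
    ext; simp, Polynomial.map_id] at this

theorem integrable_gaussianPDFReal_mul_pow (D : ℕ) :
    Integrable fun x : ℝ => gaussianPDFReal 0 1 x * (1 + |x|) ^ D := by
  refine ((integrable_one_add_abs_pow_mul_exp D (c := 1 / 2) (by norm_num)).const_mul
    (√(2 * Real.pi))⁻¹).congr (ae_of_all _ fun x => ?_)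
  simp only [gaussianPDFReal_zero_one]
  ring_nf

theorem integrable_gaussianPDFReal_mul_eval (P : ℝ[X]) :
    Integrable fun x : ℝ => gaussianPDFReal 0 1 x * P.eval x := by
  obtain ⟨K, D, hK, h⟩ := exists_abs_eval_le P
  refine ((integrable_gaussianPDFReal_mul_pow D).const_mul K).mono'
    ((measurable_gaussianPDFReal 0 1).mul P.continuous.measurable).aestronglyMeasurable
    (ae_of_all _ fun x => ?_)
  have h0 := (gaussianPDFReal_zero_one_pos x).le
  rw [Real.norm_eq_abs, abs_mul, abs_of_nonneg h0]
  calc _ ≤ gaussianPDFReal 0 1 x * (K * (1 + |x|) ^ D) := by gcongr; exact h x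
    _ = _ := by ring

/-- The derivative of φP is φ(P' - XP), and it integrates to 0. -/
theorem integral_gaussianPDFReal_mul_X_mul (P : ℝ[X]) :
    ∫ x, gaussianPDFReal 0 1 x * (X * P).eval x =
      ∫ x, gaussianPDFReal 0 1 x * (derivative P).eval x := by
  have h1 := integral_eq_zero_of_hasDerivAt_of_integrable
    (f := fun x => gaussianPDFReal 0 1 x * P.eval x)
    (f' := fun x => gaussianPDFReal 0 1 x * (derivative P - X * P).eval x) (fun x => by
      refine ((hasDerivAt_gaussianPDFReal_zero_one x).mul (P.hasDerivAt x)).congr_deriv ?_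
      simp
      ring) (integrable_gaussianPDFReal_mul_eval _) (integrable_gaussianPDFReal_mul_eval _)
  simp only [eval_sub, mul_sub] at h1
  rw [integral_sub (integrable_gaussianPDFReal_mul_eval _)
    (integrable_gaussianPDFReal_mul_eval _)] at h1
  linarith

/-- The recurrence H_{m+1} = XH_m - H_m' and one Gaussian integration by parts move one derivative
onto P. -/
theorem integral_gaussianPDFReal_mul_hermite_mul (m : ℕ) (P : ℝ[X]) :
    ∫ x, gaussianPDFReal 0 1 x * ((hermite m).map (Int.castRingHom ℝ) * P).eval x =
      ∫ x, gaussianPDFReal 0 1 x * (derivative^[m] P).eval x := by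
  induction m generalizing P with
  | zero => simp
  | succ m ih =>
    rw [Function.iterate_succ_apply, ← ih]
    set H := (hermite m).map (Int.castRingHom ℝ)
    have e : (hermite (m + 1)).map (Int.castRingHom ℝ) * P = X * (H * P) - derivative H * P := by
      rw [hermite_succ, Polynomial.map_sub, Polynomial.map_mul, map_X, ← derivative_map]
      ring
    rw [e]
    simp only [eval_sub, mul_sub]
    rw [integral_sub (integrable_gaussianPDFReal_mul_eval _)
      (integrable_gaussianPDFReal_mul_eval _), integral_gaussianPDFReal_mul_X_mul, derivative_mul]
    simp only [eval_add, mul_add]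
    rw [integral_add (integrable_gaussianPDFReal_mul_eval _)
      (integrable_gaussianPDFReal_mul_eval _)]
    ring

theorem integral_gaussianPDFReal_mul_hermite_mul_of_natDegree_le {m : ℕ} {P : ℝ[X]}
    (hP : P.natDegree ≤ m) :
    ∫ x, gaussianPDFReal 0 1 x * ((hermite m).map (Int.castRingHom ℝ) * P).eval x =
      m.factorial * P.coeff m := by
  have e : derivative^[m] P = C (m.factorial * P.coeff m) := by
    ext i
    rw [coeff_iterate_derivative, coeff_C]
    rcases i with _ | i
    · simp [Nat.descFactorial_self]
    · rw [coeff_eq_zero_of_natDegree_lt (by omega)]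
      simp
  rw [integral_gaussianPDFReal_mul_hermite_mul, e]
  simp only [eval_C]
  rw [integral_mul_const, integral_gaussianPDFReal_eq_one 0 one_ne_zero, one_mul]

/-- From H_{k+1} = XH_k - H_k' one gets H_k'² = H_k(XH_k') - H_{k+1}H_k'. The second term integrates
to 0 by degree, and the first picks out the leading coefficient k of XH_k'. -/
theorem integral_gaussianPDFReal_mul_derivative_hermite_sq (k : ℕ) :
    ∫ x, gaussianPDFReal 0 1 x *
      (derivative ((hermite k).map (Int.castRingHom ℝ))).eval x ^ 2 = k * k.factorial := by
  set H := (hermite k).map (Int.castRingHom ℝ) with hH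
  have hdeg : H.natDegree = k := by
    rw [hH, (hermite_monic k).natDegree_map, natDegree_hermite]
  have hcoeff : H.coeff k = 1 := by
    rw [hH, coeff_map, coeff_hermite_self]
    simp
  have hXH : (derivative H) ^ 2 = H * (X * derivative H) -
      (hermite (k + 1)).map (Int.castRingHom ℝ) * derivative H := by
    rw [hermite_succ, Polynomial.map_sub, Polynomial.map_mul, map_X, ← derivative_map]
    ring
  have hd' : (derivative H).natDegree ≤ k - 1 := by
    rw [← hdeg]; exact natDegree_derivative_le H
  simp only [← eval_pow, hXH, eval_sub, mul_sub]
  rw [integral_sub (integrable_gaussianPDFReal_mul_eval _)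
    (integrable_gaussianPDFReal_mul_eval _),
    integral_gaussianPDFReal_mul_hermite_mul_of_natDegree_le (m := k + 1) (by omega),
    coeff_eq_zero_of_natDegree_lt (p := derivative H) (by omega : _ < k + 1)]
  rcases k with _ | k
  · have : derivative H = 0 := by simp [hH]
    simp [this]
  rw [integral_gaussianPDFReal_mul_hermite_mul_of_natDegree_le
    (natDegree_mul_le.trans (by rw [natDegree_X]; omega))]
  rw [coeff_X_mul, coeff_derivative, hcoeff]
  push_cast
  ring

/-- The coefficients are polynomials in ε and the Gaussian moments are constants. Knowing that the
integral is a polynomial lets parity alone control its expansion. -/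
theorem exists_integral_gaussianPDFReal_mul_specialize_eq (P : ℝ[X][X]) :
    ∃ m : ℝ[X], ∀ ε : ℝ,
      ∫ x, gaussianPDFReal 0 1 x * (specialize P ε).eval x = m.eval ε := by
  refine ⟨∑ i ∈ Finset.range (P.natDegree + 1),
    P.coeff i * C (∫ x, gaussianPDFReal 0 1 x * (X ^ i : ℝ[X]).eval x), fun ε => ?_⟩
  have e : ∀ x, gaussianPDFReal 0 1 x * (specialize P ε).eval x =
      ∑ i ∈ Finset.range (P.natDegree + 1), (P.coeff i).eval ε *
        (gaussianPDFReal 0 1 x * (X ^ i : ℝ[X]).eval x) := fun x => by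
    rw [specialize, eval_map, eval₂_eq_sum_range, Finset.mul_sum]
    refine Finset.sum_congr rfl fun i _ => ?_
    simp
    ring
  simp only [e]
  rw [integral_finsetSum _ fun i _ => (integrable_gaussianPDFReal_mul_eval _).const_mul _]
  simp only [integral_const_mul, eval_finsetSum, eval_mul, eval_C]

/-- An even polynomial has no linear coefficient, so it is a constant plus ε² times a polynomial,
bounded on [-1, 1]. -/
theorem exists_abs_eval_sub_eval_zero_le_of_even {m : ℝ[X]} (hm : ∀ ε, m.eval (-ε) = m.eval ε) :
    ∃ K : ℝ, 0 ≤ K ∧ ∀ ε : ℝ, |ε| ≤ 1 → |m.eval ε - m.eval 0| ≤ K * ε ^ 2 := by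
  have hc : m.comp (C (-1) * X) = m := Polynomial.funext fun ε => by
    rw [eval_comp]
    simpa using hm ε
  have h1 : m.coeff 1 = 0 := by
    have := congrArg (fun p => coeff p 1) hc
    simp only [comp_C_mul_X_coeff] at this
    linarith
  have e : m = X * (X * m.divX.divX) + C (m.coeff 0) := by
    conv_lhs => rw [← m.X_mul_divX_add, ← m.divX.X_mul_divX_add]
    rw [coeff_divX, h1]
    simp
  obtain ⟨K, hK0, hK⟩ := exists_abs_eval_le_of_abs_le_one m.divX.divX
  refine ⟨K, hK0, fun ε hε => ?_⟩
  rw [e]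
  simp only [eval_add, eval_mul, eval_X, eval_C]
  rw [show ε * (ε * m.divX.divX.eval ε) + m.coeff 0 - (0 * (0 * m.divX.divX.eval 0) + m.coeff 0) =
    m.divX.divX.eval ε * ε ^ 2 by ring, abs_mul, abs_of_nonneg (sq_nonneg ε)]
  gcongr
  exact hK ε hε

/-- The leading term of the relative Fisher information of the Edgeworth approximation. -/
theorem exists_abs_edgeworth_fisher_sub_le {k s N : ℕ} (hk : 3 ≤ k) (hks : k ≤ s) (hN : 1 ≤ N)
    (a : ℕ → ℝ) : ∃ K : ℝ, 0 ≤ K ∧ ∀ ε : ℝ, |ε| ≤ 1 →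
      |(∫ x, gaussianPDFReal 0 1 x *
          ((derivative (specialize (edgeworthHermite k s N a) ε)).eval x ^ 2 *
            (1 - ε ^ (k - 2) * (specialize (edgeworthHermite k s N a) ε).eval x)))
        - a k ^ 2 * (k * k.factorial)| ≤ K * ε ^ 2 := by
  set B := edgeworthHermite k s N a with hB
  obtain ⟨m, hm⟩ := exists_integral_gaussianPDFReal_mul_specialize_eq
    (derivative B ^ 2 * (1 - C (X ^ (k - 2)) * B))
  have hspec : ∀ ε x, (specialize (derivative B ^ 2 * (1 - C (X ^ (k - 2)) * B)) ε).eval x =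
      (derivative (specialize B ε)).eval x ^ 2 * (1 - ε ^ (k - 2) * (specialize B ε).eval x) := by
    intro ε x
    simp [specialize, ← derivative_map]
  have hpar : ∀ ε x, (specialize B (-ε)).eval (-x) = (-1) ^ k * (specialize B ε).eval x :=
    eval_specialize_edgeworthHermite_neg k s N a (by omega)
  have hpar' : ∀ ε x, (derivative (specialize B (-ε))).eval (-x) =
      (-1) ^ (k + 1) * (derivative (specialize B ε)).eval x := by
    intro ε x
    have h1 : (specialize B (-ε)).comp (-X) = C ((-1) ^ k) * specialize B ε :=
      Polynomial.funext fun x => by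
        rw [eval_comp, eval_C_mul, ← hpar]
        simp
    have h2 := congrArg (fun p => (derivative p).eval x) h1
    simp only [derivative_comp, derivative_C_mul, eval_mul, eval_comp, eval_C] at h2
    simp only [derivative_neg, derivative_X, eval_neg, eval_one, eval_X] at h2
    rw [pow_succ]
    linarith
  have hsq : ((-1 : ℝ) ^ k) * (-1) ^ k = 1 := by rw [← mul_pow]; simp
  -- Substitute x → -x. The squared derivative of B is unchanged, and in ε^{k-2}B the signs
  -- (-1)^{k-2} and (-1)^k cancel.
  have heven : ∀ ε, m.eval (-ε) = m.eval ε := by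
    intro ε
    rw [← hm, ← hm, ← integral_neg_eq_self]
    refine integral_congr_ae (ae_of_all _ fun x => ?_)
    have hg : gaussianPDFReal 0 1 (-x) = gaussianPDFReal 0 1 x := by
      simp [gaussianPDFReal_zero_one]
    simp only [hspec, hg, hpar, hpar']
    obtain ⟨i, rfl⟩ := Nat.exists_eq_add_of_le' (by omega : 2 ≤ k)
    rw [Nat.add_sub_cancel, neg_pow ε] at *
    have e1 : ((-1 : ℝ) ^ (i + 2 + 1)) ^ 2 = 1 := by
      rw [← pow_mul, mul_comm, pow_mul]; simp
    have e2 : (-1 : ℝ) ^ i * (-1) ^ (i + 2) = 1 := by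
      rw [← pow_add, show i + (i + 2) = 2 * (i + 1) by ring, pow_mul]; simp
    rw [mul_pow, e1]
    linear_combination (-gaussianPDFReal 0 1 x * (derivative (specialize B ε)).eval x ^ 2 *
      ε ^ i * (specialize B ε).eval x) * e2
  obtain ⟨K, hK0, hK⟩ := exists_abs_eval_sub_eval_zero_le_of_even heven
  refine ⟨K, hK0, fun ε hε => ?_⟩
  have h0 : m.eval 0 = a k ^ 2 * (k * k.factorial) := by
    rw [← hm, ← integral_gaussianPDFReal_mul_derivative_hermite_sq, ← integral_const_mul]
    refine integral_congr_ae (ae_of_all _ fun x => ?_)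
    have hk2 : k - 2 ≠ 0 := by omega
    have hB0 : specialize B 0 = C (a k) * (hermite k).map (Int.castRingHom ℝ) :=
      specialize_edgeworthHermite_zero k s N a hk hks hN
    simp only [hspec, hB0, derivative_C_mul, eval_mul, eval_C]
    rw [zero_pow hk2]
    ring
  have := hK ε hε
  rw [h0, ← hm] at this
  simpa only [hspec] using this

end GaussianPolynomial

/-! ### Fourier transforms of Gaussians times monomials. -/

section HermiteFourier

open Polynomial
open scoped FourierTransform

theorem iteratedDeriv_ofReal_comp {f : ℝ → ℝ} {x : ℝ} {j : ℕ} (hf : ContDiffAt ℝ j f x) :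
    iteratedDeriv j (fun u => (f u : ℂ)) x = (iteratedDeriv j f x : ℝ) := by
  have h := Complex.ofRealCLM.iteratedFDeriv_comp_left hf le_rfl
  have h2 : (Complex.ofRealCLM ∘ f) = fun u => (f u : ℂ) := by
    ext u; simp
  rw [h2] at h
  rw [iteratedDeriv, h, iteratedDeriv]
  simp

theorem fourier_gaussianCF :
    (𝓕 fun τ : ℝ => Complex.exp (-((2 * Real.pi * τ : ℝ) : ℂ) ^ 2 / 2)) =
      fun x : ℝ => ((gaussianPDFReal 0 1 x : ℝ) : ℂ) := by
  have hpi : (Real.pi : ℂ) ≠ 0 := by exact_mod_cast Real.pi_ne_zero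
  have h := fourier_gaussian_pi (b := ((2 * Real.pi : ℝ) : ℂ))
    (by rw [Complex.ofReal_re]; positivity)
  have e : (fun τ : ℝ => Complex.exp (-((2 * Real.pi * τ : ℝ) : ℂ) ^ 2 / 2)) =
      fun τ : ℝ => Complex.exp (-Real.pi * ((2 * Real.pi : ℝ) : ℂ) * τ ^ 2) := by
    ext τ
    congr 1
    push_cast
    ring
  rw [e, h]
  ext x
  rw [gaussianPDFReal_zero_one, Real.sqrt_eq_rpow]
  push_cast
  rw [show (1 / 2 : ℂ) = ((1 / 2 : ℝ) : ℂ) by push_cast; rfl, one_div]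
  congr 2
  · rw [Complex.ofReal_cpow (by positivity)]
    push_cast
    rfl
  · field_simp

theorem integrable_pow_mul_gaussianCF (b : ℕ) :
    Integrable fun τ : ℝ => τ ^ b • Complex.exp (-((2 * Real.pi * τ : ℝ) : ℂ) ^ 2 / 2) := by
  refine (integrable_one_add_abs_pow_mul_exp b (c := 2 * Real.pi ^ 2) (by positivity)).mono'
    (Continuous.aestronglyMeasurable (by fun_prop)) (ae_of_all _ fun τ => ?_)
  rw [norm_smul, norm_pow, Real.norm_eq_abs]
  have e : ‖Complex.exp (-((2 * Real.pi * τ : ℝ) : ℂ) ^ 2 / 2)‖ =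
      Real.exp (-(2 * Real.pi ^ 2) * τ ^ 2) := by
    rw [show -((2 * Real.pi * τ : ℝ) : ℂ) ^ 2 / 2 = ((-(2 * Real.pi ^ 2) * τ ^ 2 : ℝ) : ℂ) by
      push_cast; ring, ← Complex.ofReal_exp, Complex.norm_real, Real.norm_eq_abs,
      abs_of_pos (Real.exp_pos _)]
  rw [e]
  gcongr
  linarith

theorem contDiff_gaussianPDFReal_zero_one {m : WithTop ℕ∞} :
    ContDiff ℝ m (gaussianPDFReal 0 1) := by
  have e : gaussianPDFReal 0 1 = fun x => (√(2 * Real.pi))⁻¹ * Real.exp (-x ^ 2 / 2) :=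
    funext gaussianPDFReal_zero_one
  rw [e]
  fun_prop

theorem iteratedDeriv_gaussianPDFReal (b : ℕ) (x : ℝ) :
    iteratedDeriv b (gaussianPDFReal 0 1) x =
      (-1) ^ b * (gaussianPDFReal 0 1 x * ((hermite b).map (Int.castRingHom ℝ)).eval x) := by
  have e : gaussianPDFReal 0 1 = fun x => (√(2 * Real.pi))⁻¹ * Real.exp (-(x ^ 2 / 2)) := by
    ext x
    rw [gaussianPDFReal_zero_one, neg_div]
  have h := deriv_gaussian_eq_hermite_mul_gaussian b x
  rw [← iteratedDeriv_eq_iterate] at h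
  rw [e, iteratedDeriv_const_mul_field, h, eval_map, aeval_def,
    RingHom.ext_int (algebraMap ℤ ℝ) (Int.castRingHom ℝ)]
  ring

/-- Differentiating the transform of the Gaussian b times gives φ^{(b)} = (-1)^b φH_b, and passing
from -2πiτ to 2πiτ gives another (-1)^b. -/
theorem fourier_pow_mul_gaussianCF (b : ℕ) (x : ℝ) :
    𝓕 (fun τ : ℝ => Complex.exp (-((2 * Real.pi * τ : ℝ) : ℂ) ^ 2 / 2) *
      (Complex.I * (2 * Real.pi * τ : ℝ)) ^ b) x =
      ((gaussianPDFReal 0 1 x * ((hermite b).map (Int.castRingHom ℝ)).eval x : ℝ) : ℂ) := by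
  have h := congrFun (Real.iteratedDeriv_fourier (N := (b : ℕ∞)) (n := b)
    (fun n _ => integrable_pow_mul_gaussianCF n) le_rfl) x
  rw [fourier_gaussianCF, iteratedDeriv_ofReal_comp contDiff_gaussianPDFReal_zero_one.contDiffAt,
    iteratedDeriv_gaussianPDFReal] at h
  have e : (fun τ : ℝ => Complex.exp (-((2 * Real.pi * τ : ℝ) : ℂ) ^ 2 / 2) *
      (Complex.I * (2 * Real.pi * τ : ℝ)) ^ b) = (fun τ : ℝ => (-1 : ℂ) ^ b •
      ((-2 * Real.pi * Complex.I * τ) ^ b •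
        Complex.exp (-((2 * Real.pi * τ : ℝ) : ℂ) ^ 2 / 2))) := by
    ext τ
    simp only [smul_eq_mul]
    rw [← mul_assoc, ← mul_pow, mul_comm]
    congr 2
    push_cast
    ring
  have h2 : ((-1 : ℂ) ^ b) * (-1) ^ b = 1 := by rw [← mul_pow]; simp
  rw [e, Real.fourier_eq]
  simp only [smul_comm _ ((-1 : ℂ) ^ b)]
  rw [integral_smul, ← Real.fourier_eq, ← h, smul_eq_mul]
  push_cast
  linear_combination ((gaussianPDFReal 0 1 x : ℂ) *
    (((hermite b).map (Int.castRingHom ℝ)).eval x : ℝ)) * h2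

theorem integrable_gaussianCF_mul_pow (b : ℕ) :
    Integrable fun τ : ℝ => Complex.exp (-((2 * Real.pi * τ : ℝ) : ℂ) ^ 2 / 2) *
      (Complex.I * (2 * Real.pi * τ : ℝ)) ^ b := by
  refine ((integrable_pow_mul_gaussianCF b).const_mul
    ((Complex.I * (2 * Real.pi : ℝ)) ^ b)).congr (ae_of_all _ fun τ => ?_)
  simp only [Complex.real_smul]
  push_cast
  ring

/-- `edgeworthCharFun` as a combination of Gaussian characteristic functions times monomials. -/
theorem edgeworthCharFun_two_pi_mul {k : ℕ} (hk : 2 ≤ k) (s N : ℕ) (a : ℕ → ℝ) (ε : ℝ) :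
    (fun τ : ℝ => edgeworthCharFun k s N a ε (2 * Real.pi * τ)) = fun τ : ℝ =>
      (Complex.exp (-((2 * Real.pi * τ : ℝ) : ℂ) ^ 2 / 2) *
        (Complex.I * (2 * Real.pi * τ : ℝ)) ^ 0) +
      ∑ b ∈ Finset.range ((edgeworthReducedPoly k s N a).natDegree + 1),
        ((ε ^ (k - 2) * ((edgeworthReducedPoly k s N a).coeff b).eval ε : ℝ) : ℂ) •
        (Complex.exp (-((2 * Real.pi * τ : ℝ) : ℂ) ^ 2 / 2) *
          (Complex.I * (2 * Real.pi * τ : ℝ)) ^ b) := by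
  ext τ
  rw [edgeworthCharFun, expTrunc_edgeworthExponent k s N a hk, mul_add, Finset.mul_sum,
    Finset.mul_sum, pow_zero]
  refine congrArg₂ (· + ·) rfl (Finset.sum_congr rfl fun b _ => ?_)
  simp only [smul_eq_mul]
  push_cast
  ring

theorem integrable_edgeworthCharFun {k : ℕ} (hk : 2 ≤ k) (s N : ℕ) (a : ℕ → ℝ) (ε : ℝ) :
    Integrable fun τ : ℝ => edgeworthCharFun k s N a ε (2 * Real.pi * τ) := by
  rw [edgeworthCharFun_two_pi_mul hk]
  exact (integrable_gaussianCF_mul_pow 0).add (integrable_finsetSum _ fun b _ =>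
    (integrable_gaussianCF_mul_pow b).smul
      ((ε ^ (k - 2) * ((edgeworthReducedPoly k s N a).coeff b).eval ε : ℝ) : ℂ))

/-- The density with characteristic function `edgeworthCharFun`. -/
theorem fourier_edgeworthCharFun {k : ℕ} (hk : 2 ≤ k) (s N : ℕ) (a : ℕ → ℝ) (ε x : ℝ) :
    𝓕 (fun τ : ℝ => edgeworthCharFun k s N a ε (2 * Real.pi * τ)) x =
      ((gaussianPDFReal 0 1 x *
        (1 + ε ^ (k - 2) * (specialize (edgeworthHermite k s N a) ε).eval x) : ℝ) : ℂ) := by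
  set c : ℕ → ℝ := fun b => ((edgeworthReducedPoly k s N a).coeff b).eval ε
  have hc : ∀ b, ((edgeworthReducedPoly k s N a).coeff b).eval ε = c b := fun b => rfl
  rw [edgeworthCharFun_two_pi_mul hk, Real.fourier_eq]
  simp only [hc]
  simp only [smul_add, Finset.smul_sum]
  have hI : ∀ b, Integrable fun τ : ℝ => Real.fourierChar (-inner ℝ τ x) •
      (Complex.exp (-((2 * Real.pi * τ : ℝ) : ℂ) ^ 2 / 2) *
        (Complex.I * (2 * Real.pi * τ : ℝ)) ^ b) := fun b =>
    (Real.fourierIntegral_convergent_iff x).2 (integrable_gaussianCF_mul_pow b)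
  have hI' : ∀ b, Integrable fun τ : ℝ => Real.fourierChar (-inner ℝ τ x) •
      ((ε ^ (k - 2) * c b : ℝ) : ℂ) •
      (Complex.exp (-((2 * Real.pi * τ : ℝ) : ℂ) ^ 2 / 2) *
        (Complex.I * (2 * Real.pi * τ : ℝ)) ^ b) := fun b => by
    simp only [smul_comm _ ((ε ^ (k - 2) * c b : ℝ) : ℂ)]
    exact (hI b).smul ((ε ^ (k - 2) * c b : ℝ) : ℂ)
  rw [integral_add (hI 0) (integrable_finsetSum _ fun b _ => hI' b),
    integral_finsetSum _ fun b _ => hI' b]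
  simp only [smul_comm _ ((ε ^ (k - 2) * c _ : ℝ) : ℂ), integral_smul, ← Real.fourier_eq,
    fourier_pow_mul_gaussianCF, specialize_edgeworthHermite, eval_finsetSum, eval_mul, eval_C]
  simp only [smul_eq_mul, Finset.mul_sum, mul_add]
  push_cast
  refine congrArg₂ (· + ·) (by simp) (Finset.sum_congr rfl fun b _ => ?_)
  simp only [c]
  ring

end HermiteFourier

/-! ### Edgeworth expansion of the density. -/

section DensityExpansion

open scoped FourierTransform

theorem exists_jetBound_charFun {μ : Measure ℝ} [IsProbabilityMeasure μ] {s : ℕ}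
    (hmom : MemLp id s μ) : ∃ M : ℝ, 1 ≤ M ∧ ∀ t, JetBound s (charFun μ) t M := by
  have hI : ∀ j, 0 ≤ ∫ x, |x| ^ j ∂μ := fun j => integral_nonneg fun x => by positivity
  refine ⟨1 + ∑ j ∈ Finset.range (s + 1), ∫ x, |x| ^ j ∂μ,
    le_add_of_nonneg_right (Finset.sum_nonneg fun j _ => hI j), fun t j hj => ?_⟩
  rw [iteratedDeriv_charFun (hmom.mono_exponent (by exact_mod_cast hj)), norm_mul, norm_pow,
    Complex.norm_I, one_pow, one_mul]
  have h1 : ‖∫ x : ℝ, (x : ℂ) ^ j * Complex.exp (t * x * Complex.I) ∂μ‖ ≤ ∫ x, |x| ^ j ∂μ := by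
    refine (norm_integral_le_integral_norm _).trans (le_of_eq ?_)
    refine integral_congr_ae (ae_of_all _ fun x => ?_)
    simp only [norm_mul, norm_pow, Complex.norm_real, Real.norm_eq_abs]
    rw [← Complex.ofReal_mul, Complex.norm_exp_ofReal_mul_I, mul_one]
  have h2 := Finset.single_le_sum (f := fun j => ∫ x, |x| ^ j ∂μ) (fun j _ => hI j)
    (Finset.mem_range.2 (Nat.lt_succ_of_le hj))
  linarith

theorem abs_iteratedDeriv_re_le {g : ℝ → ℂ} {i : ℕ} (hg : ContDiff ℝ i g) (x : ℝ) :
    |iteratedDeriv i (fun y => (g y).re) x| ≤ ‖iteratedDeriv i g x‖ := by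
  rw [← Real.norm_eq_abs, ← norm_iteratedFDeriv_eq_norm_iteratedDeriv,
    ← norm_iteratedFDeriv_eq_norm_iteratedDeriv]
  have := Complex.reCLM.norm_iteratedFDeriv_comp_left (hg.contDiffAt (x := x)) (n := i) le_rfl
  rwa [Complex.reCLM_norm, one_mul] at this

theorem integrable_inv_one_add_abs_pow {s : ℕ} (hs : 2 ≤ s) :
    Integrable fun x : ℝ => (1 + |x| ^ s)⁻¹ := by
  refine (integrable_inv_one_add_sq.const_mul 2).mono'
    (Measurable.aestronglyMeasurable (by fun_prop)) (ae_of_all _ fun x => ?_)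
  rw [Real.norm_of_nonneg (by positivity), ← sq_abs x, ← div_eq_mul_inv,
    inv_le_comm₀ (by positivity) (by positivity), inv_div]
  have h0 := abs_nonneg x
  rcases le_total 1 |x| with h | h
  · have := pow_le_pow_right₀ h hs
    have := pow_nonneg h0 s
    linarith
  · have h1 : |x| ^ 2 ≤ 1 := pow_le_one₀ h0 h
    have := pow_nonneg h0 s
    linarith

/-- The density of a normalized sum is the Edgeworth density up to a small error with two
derivatives decaying polynomially. -/
theorem eventually_exists_isACDensity {μ : Measure ℝ} [IsProbabilityMeasure μ] {s k : ℕ}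
    (hk3 : 3 ≤ k) (hks : k ≤ s) (hmom : MemLp id s μ) (hmean : ∫ x, x ∂μ = 0)
    (hvar : ∫ x, x ^ 2 ∂μ = 1) (hcum : ∀ j, 3 ≤ j → j < k → cumulant μ j = 0)
    {m : ℕ} {C : ℝ} (hC : ∀ t : ℝ, |t| * ‖charFun μ t‖ ^ m ≤ C)
    {ν : ℕ → Measure ℝ} (hνp : ∀ n, IsProbabilityMeasure (ν n))
    (hν : ∀ n t, charFun (ν n) t = charFun μ ((√(n : ℝ))⁻¹ * t) ^ n) {η : ℝ} (hη : 0 < η) :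
    ∀ᶠ n : ℕ in atTop, ∃ E : ℝ → ℝ, ContDiff ℝ 2 E ∧
      (∀ i ≤ 2, ∀ x, (1 + |x| ^ s) * |iteratedDeriv i E x| ≤ η * (√(n : ℝ))⁻¹ ^ (s - 2)) ∧
      IsACDensity (ν n) fun x => gaussianPDFReal 0 1 x * (1 + (√(n : ℝ))⁻¹ ^ (k - 2) *
        (specialize (edgeworthHermite k s s fun j => cumulant μ j / j.factorial)
          (√(n : ℝ))⁻¹).eval x) + E x := by
  obtain ⟨Λ, R, δ, hδ, hΛ, hR, hexp, hform, hR0⟩ :=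
    exists_log_charFun_expansion hk3 hks hmom hmean hvar hcum
  obtain ⟨M, hM1, hM⟩ := exists_jetBound_charFun hmom
  set a : ℕ → ℝ := fun j => cumulant μ j / j.factorial with ha
  obtain ⟨Ψ, hΨ, hJ⟩ := exists_jetBound_edgeworthDiff hk3 hks le_rfl (contDiff_charFun hmom) hΛ hR
    hδ hexp hform hR0 hM1 hM (norm_charFun_le_one) hC
    (fun δ hδ => exists_norm_charFun_le_lt_one μ hC hδ) (a := a)
  set J := |∫ t, Ψ t| + 1 with hJdef
  have hJ0 : 0 < J := by positivity
  filter_upwards [hJ (η / J) (by positivity), eventually_ge_atTop 1] with n hn hn1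
  obtain ⟨hε, hε1, -⟩ := inv_sqrt_natCast_bounds hn1
  set ε := (√(n : ℝ))⁻¹
  have := hνp n
  obtain ⟨hG2, hGb⟩ := fourier_weighted_bound
    (contDiff_edgeworthDiff (contDiff_charFun hmom) k s s a n) hΨ hn
  set h := edgeworthDiff (charFun μ) k s s a n with hh
  set G : ℝ → ℂ := 𝓕 fun τ : ℝ => h (2 * Real.pi * τ) with hGdef
  have hGb' : ∀ i ≤ 2, ∀ x : ℝ, (1 + |x| ^ s) * ‖iteratedDeriv i G x‖ ≤ η * ε ^ (s - 2) := by
    intro i hi x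
    refine (hGb i hi x).trans ?_
    calc η / J * ε ^ (s - 2) * ∫ t, Ψ t ≤ η / J * ε ^ (s - 2) * J := by
          gcongr
          exact (le_abs_self _).trans (by rw [hJdef]; linarith)
      _ = η * ε ^ (s - 2) := by field_simp
  have hhI : Integrable fun τ : ℝ => h (2 * Real.pi * τ) := by
    have hcont : Continuous h :=
      (contDiff_edgeworthDiff (m := s) (contDiff_charFun hmom) k s s a n).continuous
    have : Integrable h := by
      refine (hΨ.const_mul (η / J * ε ^ (s - 2))).mono' hcont.aestronglyMeasurable
        (ae_of_all _ fun t => ?_)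
      simpa using hn t 0 (by norm_num) 0 (Nat.zero_le _)
    exact this.comp_mul_left' (by positivity)
  have hgI := integrable_edgeworthCharFun (by omega : 2 ≤ k) s s a ε
  have hsum : (fun τ : ℝ => charFun (ν n) (2 * Real.pi * τ)) = fun τ : ℝ =>
      edgeworthCharFun k s s a ε (2 * Real.pi * τ) + h (2 * Real.pi * τ) := by
    ext τ
    rw [hν, hh, edgeworthDiff]
    ring
  -- Linearity splits the density into the explicit Edgeworth part and the transform G of the small
  -- difference; the real part of G becomes E.
  have hF : 𝓕 (fun τ : ℝ => charFun (ν n) (2 * Real.pi * τ)) = fun x =>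
      ((gaussianPDFReal 0 1 x * (1 + ε ^ (k - 2) *
        (specialize (edgeworthHermite k s s a) ε).eval x) : ℝ) : ℂ) + G x := by
    ext x
    rw [hsum, ← fourier_edgeworthCharFun (by omega : 2 ≤ k), hGdef]
    simp only [Real.fourier_eq, smul_add]
    exact integral_add ((Real.fourierIntegral_convergent_iff x).2 hgI)
      ((Real.fourierIntegral_convergent_iff x).2 hhI)
  have hpoly : ∀ m : WithTop ℕ∞, ContDiff ℝ m fun x : ℝ => ((gaussianPDFReal 0 1 x *
      (1 + ε ^ (k - 2) * (specialize (edgeworthHermite k s s a) ε).eval x) : ℝ) : ℂ) := fun m =>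
    Complex.ofRealCLM.contDiff.comp (contDiff_gaussianPDFReal_zero_one.mul
      (contDiff_const.add (contDiff_const.mul ((specialize (edgeworthHermite k s s a) ε).contDiff_aeval m))))
  have hpolyI : Integrable fun x : ℝ => ((gaussianPDFReal 0 1 x *
      (1 + ε ^ (k - 2) * (specialize (edgeworthHermite k s s a) ε).eval x) : ℝ) : ℂ) := by
    have := integrable_gaussianPDFReal_mul_eval
      (1 + Polynomial.C (ε ^ (k - 2)) * specialize (edgeworthHermite k s s a) ε)
    simpa using this.ofReal (𝕜 := ℂ)
  have hGI : Integrable G := by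
    refine ((integrable_inv_one_add_abs_pow (by omega : 2 ≤ s)).const_mul
      (η * ε ^ (s - 2))).mono' hG2.continuous.aestronglyMeasurable (ae_of_all _ fun x => ?_)
    have := hGb' 0 (by norm_num) x
    rw [iteratedDeriv_zero] at this
    rwa [← div_eq_mul_inv, le_div_iff₀' (by positivity)]
  refine ⟨fun x => (G x).re, Complex.reCLM.contDiff.comp hG2, fun i hi x => ?_, ?_⟩
  · refine le_trans ?_ (hGb' i hi x)
    gcongr
    exact abs_iteratedDeriv_re_le (hG2.of_le (by exact_mod_cast hi)) x
  · have hac := isACDensity_re_fourier (ν n) (by rw [hsum]; exact hgI.add hhI)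
      (by rw [hF]; exact hpolyI.add hGI)
      (by rw [hF]; exact (hpoly 1).add (hG2.of_le (by norm_num)))
    rw [hF] at hac
    simpa only [Complex.add_re, Complex.ofReal_re] using hac

end DensityExpansion

/-! ### Elementary inequalities for the Fisher integrand. -/

section FisherCalculus

open Polynomial

/-- Landau's inequality for nonnegative functions. -/
theorem sq_deriv_le_of_nonneg {p p₁ p₂ : ℝ → ℝ} (hp : ∀ y, HasDerivAt p (p₁ y) y)
    (hp₁ : ∀ y, HasDerivAt p₁ (p₂ y) y) (h0 : ∀ y, 0 ≤ p y) {x δ S : ℝ} (hδ : 0 < δ)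
    (hS : ∀ y, |y - x| ≤ δ → |p₂ y| ≤ S) :
    p₁ x ^ 2 ≤ 4 * S * p x + 4 * p x ^ 2 / δ ^ 2 := by
  have hS0 : 0 ≤ S := (abs_nonneg _).trans (hS x (by simpa using hδ.le))
  have taylor : ∀ h, |h| ≤ δ → p (x + h) ≤ p x + p₁ x * h + S * h ^ 2 := by
    intro h hh
    have hball : ∀ y ∈ Metric.closedBall x |h|, |y - x| ≤ |h| := fun y hy => by
      simpa [Real.dist_eq] using hy
    have hx : x ∈ Metric.closedBall x |h| := by simp
    have hxh : x + h ∈ Metric.closedBall x |h| := by simp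
    have h1 : ∀ y ∈ Metric.closedBall x |h|, ‖p₁ y - p₁ x‖ ≤ S * |h| := by
      intro y hy
      refine ((convex_closedBall x |h|).norm_image_sub_le_of_norm_hasDerivWithin_le
        (fun z hz => (hp₁ z).hasDerivWithinAt)
        (fun z hz => hS z ((hball z hz).trans hh)) hx hy).trans ?_
      rw [Real.norm_eq_abs]
      exact mul_le_mul_of_nonneg_left (hball y hy) hS0
    have h2 := (convex_closedBall x |h|).norm_image_sub_le_of_norm_hasDerivWithin_le
      (f := fun y => p y - p₁ x * y) (f' := fun y => p₁ y - p₁ x)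
      (fun z hz => ((hp z).sub (by simpa using (hasDerivAt_id z).const_mul (p₁ x))).hasDerivWithinAt)
      h1 hx hxh
    have h3 := (le_abs_self _).trans h2
    rw [add_sub_cancel_left, Real.norm_eq_abs, mul_assoc, abs_mul_abs_self] at h3
    nlinarith
  have hpx := h0 x
  -- The optimal step -p'/(2S) in the quadratic bound is allowed if |p'| ≤ 2Sδ. Otherwise a step of
  -- length δ against the sign of p' gives |p'|δ ≤ 2p.
  rcases le_or_gt |p₁ x| (2 * S * δ) with hle | hgt
  · rcases hS0.eq_or_lt with h | hpos
    · rw [← h] at hle ⊢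
      have : p₁ x = 0 := abs_eq_zero.1 (le_antisymm (by simpa using hle) (abs_nonneg _))
      rw [this, zero_pow two_ne_zero]
      positivity
    · have h1 := taylor (-(p₁ x) / (2 * S)) (by
        rw [abs_div, abs_neg, abs_of_pos (by positivity : 0 < 2 * S), div_le_iff₀ (by positivity)]
        linarith)
      have h2 := (h0 _).trans h1
      have h3 : p x + p₁ x * (-(p₁ x) / (2 * S)) + S * (-(p₁ x) / (2 * S)) ^ 2 =
          p x - p₁ x ^ 2 / (4 * S) := by field_simp; ring
      rw [h3, sub_nonneg, div_le_iff₀ (by positivity)] at h2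
      have : 0 ≤ 4 * p x ^ 2 / δ ^ 2 := by positivity
      linarith
  · have key : |p₁ x| * δ ≤ 2 * p x := by
      rcases le_total 0 (p₁ x) with hs | hs
      · have h1 := (h0 _).trans (taylor (-δ) (by rw [abs_neg, abs_of_pos hδ]))
        rw [abs_of_nonneg hs] at hgt ⊢
        nlinarith
      · have h1 := (h0 _).trans (taylor δ (by rw [abs_of_pos hδ]))
        rw [abs_of_nonpos hs] at hgt ⊢
        nlinarith
    have h2 : p₁ x ^ 2 ≤ 4 * p x ^ 2 / δ ^ 2 := by
      rw [le_div_iff₀ (by positivity), ← mul_pow, ← sq_abs, abs_mul, abs_of_pos hδ]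
      calc (|p₁ x| * δ) ^ 2 ≤ (2 * p x) ^ 2 := by gcongr
        _ = 4 * p x ^ 2 := by ring
    have : 0 ≤ 4 * S * p x := by positivity
    linarith

/-- With p = φ(1 + Q) + E ≥ φ/2, the difference is an exact sum of four terms: the cross term in
Q'ρ, ρ²/p, the effect of E on the denominator, and 1/(1 + Q) - (1 - Q) = Q²/(1 + Q). -/
theorem abs_sq_div_sub_le {φ Q Q' E ρ : ℝ} (hφ : 0 < φ) (hQ : |Q| ≤ 1 / 4) (hE : |E| ≤ φ / 4) :
    |(φ * Q' + ρ) ^ 2 / (φ * (1 + Q) + E) - φ * Q' ^ 2 * (1 - Q)| ≤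
      4 * (|Q'| * |ρ|) + 2 * (ρ ^ 2 / φ) + 3 * (Q' ^ 2 * |E|) + 2 * (φ * Q' ^ 2 * Q ^ 2) := by
  have hQ1 := abs_le.1 hQ
  have hE1 := abs_le.1 hE
  have hq : 3 / 4 ≤ 1 + Q := by linarith
  have hp : φ / 2 ≤ φ * (1 + Q) + E := by nlinarith
  set p := φ * (1 + Q) + E with hpdef
  have hp0 : 0 < p := by linarith
  have hq0 : 0 < 1 + Q := by linarith
  have e : (φ * Q' + ρ) ^ 2 / p - φ * Q' ^ 2 * (1 - Q) = 2 * (φ / p) * (Q' * ρ) + ρ ^ 2 / p -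
      (φ / p) * (1 / (1 + Q)) * (Q' ^ 2 * E) + (1 / (1 + Q)) * (φ * Q' ^ 2 * Q ^ 2) := by
    field_simp
    rw [hpdef]
    ring
  have h1 : φ / p ≤ 2 := by rw [div_le_iff₀ hp0]; linarith
  have h2 : 1 / (1 + Q) ≤ 4 / 3 := by rw [div_le_iff₀ hq0]; linarith
  have h10 : 0 ≤ φ / p := by positivity
  have h20 : 0 ≤ 1 / (1 + Q) := by positivity
  have h3 : ρ ^ 2 / p ≤ 2 * (ρ ^ 2 / φ) := by
    rw [← mul_div_assoc, div_le_div_iff₀ hp0 hφ]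
    nlinarith [sq_nonneg ρ]
  rw [e]
  have t1 : |2 * (φ / p) * (Q' * ρ)| ≤ 4 * (|Q'| * |ρ|) := by
    rw [abs_mul, abs_mul Q', abs_of_nonneg (by positivity : 0 ≤ 2 * (φ / p))]
    have : 0 ≤ |Q'| * |ρ| := by positivity
    nlinarith
  have t2 : |ρ ^ 2 / p| ≤ 2 * (ρ ^ 2 / φ) := by rwa [abs_of_nonneg (by positivity)]
  have t3 : |(φ / p) * (1 / (1 + Q)) * (Q' ^ 2 * E)| ≤ 3 * (Q' ^ 2 * |E|) := by
    rw [abs_mul, abs_mul (Q' ^ 2), abs_of_nonneg (by positivity : 0 ≤ φ / p * (1 / (1 + Q))),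
      abs_of_nonneg (sq_nonneg Q')]
    have h4 : φ / p * (1 / (1 + Q)) ≤ 2 * (4 / 3) := mul_le_mul h1 h2 h20 (by norm_num)
    have : 0 ≤ Q' ^ 2 * |E| := by positivity
    nlinarith
  have t4 : |(1 / (1 + Q)) * (φ * Q' ^ 2 * Q ^ 2)| ≤ 2 * (φ * Q' ^ 2 * Q ^ 2) := by
    have : 0 ≤ φ * Q' ^ 2 * Q ^ 2 := by positivity
    rw [abs_of_nonneg (by positivity)]
    nlinarith
  refine (abs_add_le _ _).trans (add_le_add ((abs_sub _ _).trans (add_le_add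
    ((abs_add_le _ _).trans (add_le_add t1 t2)) t3)) t4)

/-- For |x| = T + |u| one has x² ≥ T² + u² and 1 + |x| ≤ (1 + T)(1 + |u|). The factor e^{-T²/2}
comes out and an integrable function of u = x ∓ T remains; the sum covers both signs of x. -/
theorem one_add_abs_pow_mul_exp_le (D : ℕ) {T x : ℝ} (hT : 0 ≤ T) (hx : T ≤ |x|) :
    (1 + |x|) ^ D * Real.exp (-x ^ 2 / 2) ≤ (1 + T) ^ D * Real.exp (-T ^ 2 / 2) *
      ((1 + |x - T|) ^ D * Real.exp (-(1 / 2) * (x - T) ^ 2) +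
        (1 + |x + T|) ^ D * Real.exp (-(1 / 2) * (x + T) ^ 2)) := by
  have key : ∀ u : ℝ, |u| = |x| - T → (1 + |x|) ^ D * Real.exp (-x ^ 2 / 2) ≤
      (1 + T) ^ D * Real.exp (-T ^ 2 / 2) * ((1 + |u|) ^ D * Real.exp (-(1 / 2) * u ^ 2)) := by
    intro u hu
    rw [mul_mul_mul_comm, ← mul_pow, ← Real.exp_add]
    have hu0 : 0 ≤ |u| := abs_nonneg u
    gcongr
    · nlinarith
    · rw [← sq_abs u, hu, ← sq_abs x]
      nlinarith
  have n1 : 0 ≤ (1 + T) ^ D * Real.exp (-T ^ 2 / 2) := by positivity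
  rcases le_total 0 x with h | h
  · refine (key (x - T) ?_).trans (mul_le_mul_of_nonneg_left ?_ n1)
    · rw [abs_of_nonneg h] at hx ⊢
      exact abs_of_nonneg (by linarith)
    · exact le_add_of_nonneg_right (by positivity)
  · refine (key (x + T) ?_).trans (mul_le_mul_of_nonneg_left ?_ n1)
    · rw [abs_of_nonpos h] at hx ⊢
      rw [abs_of_nonpos (by linarith)]
      ring
    · exact le_add_of_nonneg_left (by positivity)

/-- Up to a constant, e^{r²/2}/(1 + r)^m is largest at the end point r = T. This rests on T ≤ (1 +
r)(1 + (T - r)) and r² + (T - r)² ≤ T². -/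
theorem exists_pow_mul_exp_le (m : ℕ) : ∃ C : ℝ, 0 < C ∧ ∀ T r : ℝ, 0 ≤ r → r ≤ T →
    T ^ m * Real.exp (r ^ 2 / 2) ≤ C * (1 + r) ^ m * Real.exp (T ^ 2 / 2) := by
  obtain ⟨C, hC, h⟩ := exists_one_add_abs_pow_le_exp m (by norm_num : (0 : ℝ) < 1 / 2)
  refine ⟨C, hC, fun T r hr hT => ?_⟩
  have hT0 : 0 ≤ T := hr.trans hT
  have h1 : T ≤ (1 + r) * (1 + |T - r|) := by
    rw [abs_of_nonneg (by linarith)]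
    nlinarith
  calc T ^ m * Real.exp (r ^ 2 / 2)
      ≤ ((1 + r) * (1 + |T - r|)) ^ m * Real.exp (r ^ 2 / 2) := by gcongr
    _ = (1 + r) ^ m * Real.exp (r ^ 2 / 2) * (1 + |T - r|) ^ m := by rw [mul_pow]; ring
    _ ≤ (1 + r) ^ m * Real.exp (r ^ 2 / 2) * (C * Real.exp (1 / 2 * (T - r) ^ 2)) := by
        gcongr
        exact h _
    _ = C * (1 + r) ^ m * Real.exp (r ^ 2 / 2 + 1 / 2 * (T - r) ^ 2) := by rw [Real.exp_add]; ring
    _ ≤ C * (1 + r) ^ m * Real.exp (T ^ 2 / 2) := by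
        gcongr
        nlinarith

theorem one_add_pow_le_two_pow_mul (s : ℕ) {r : ℝ} (hr : 0 ≤ r) :
    (1 + r) ^ s ≤ 2 ^ s * (1 + r ^ s) := by
  have h2 : (0 : ℝ) ≤ 2 ^ s := by positivity
  have hrs : 0 ≤ r ^ s := by positivity
  rcases le_total r 1 with h | h
  · calc (1 + r) ^ s ≤ 2 ^ s := by gcongr; linarith
      _ ≤ _ := by nlinarith
  · calc (1 + r) ^ s ≤ (2 * r) ^ s := by gcongr; linarith
      _ = 2 ^ s * r ^ s := mul_pow _ _ _
      _ ≤ _ := by nlinarith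

theorem inv_gaussianPDFReal_zero_one_le (x : ℝ) :
    (gaussianPDFReal 0 1 x)⁻¹ ≤ 3 * Real.exp (x ^ 2 / 2) := by
  rw [gaussianPDFReal_zero_one, mul_inv, inv_inv, ← Real.exp_neg, neg_div, neg_neg]
  gcongr
  rw [Real.sqrt_le_left (by norm_num)]
  nlinarith [Real.pi_lt_d2]

theorem gaussianPDFReal_zero_one_le_exp (x : ℝ) :
    gaussianPDFReal 0 1 x ≤ Real.exp (-x ^ 2 / 2) := by
  rw [gaussianPDFReal_zero_one]
  refine mul_le_of_le_one_left (Real.exp_pos _).le (inv_le_one_of_one_le₀ ?_)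
  rw [Real.one_le_sqrt]
  nlinarith [Real.pi_gt_three]

/-- A shift by 1/|x| lowers x²/2 by at most 1, so the density grows by at most e ≤ 3. This fixes the
length scale for Landau's inequality in the tails. -/
theorem gaussianPDFReal_zero_one_le_of_abs_sub_le {x y : ℝ} (hx : 0 < |x|) (hy : |y - x| ≤ 1 / |x|) :
    gaussianPDFReal 0 1 y ≤ 3 * gaussianPDFReal 0 1 x := by
  rw [gaussianPDFReal_zero_one, gaussianPDFReal_zero_one, mul_left_comm]
  gcongr
  have h1 : x ^ 2 - 2 ≤ y ^ 2 := by
    have h2 : |x| * |y - x| ≤ 1 := by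
      calc |x| * |y - x| ≤ |x| * (1 / |x|) := by gcongr
        _ = 1 := by field_simp
    rw [← abs_mul] at h2
    have := (abs_le.1 h2).1
    nlinarith [sq_nonneg (y - x)]
  calc Real.exp (-y ^ 2 / 2) ≤ Real.exp (1 + -x ^ 2 / 2) := by
        gcongr
        linarith
    _ = Real.exp 1 * Real.exp (-x ^ 2 / 2) := Real.exp_add _ _
    _ ≤ _ := by
        gcongr
        linarith [Real.exp_one_lt_d9]

end FisherCalculus

/-! ### Relative Fisher information of a perturbed Gaussian density. -/

section FisherPerturbation

open Polynomial

variable {s D : ℕ} {Q : ℝ[X]} {E E₁ E₂ : ℝ → ℝ} {κ d T : ℝ}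

theorem hasDerivAt_gaussian_mul_add (hE : ∀ x, HasDerivAt E (E₁ x) x) (x : ℝ) :
    HasDerivAt (fun y => gaussianPDFReal 0 1 y * (1 + Q.eval y) + E y)
      (gaussianPDFReal 0 1 x * (Q.derivative.eval x - x * (1 + Q.eval x)) + E₁ x) x := by
  refine (((hasDerivAt_gaussianPDFReal_zero_one x).mul
    ((Q.hasDerivAt x).const_add 1)).add (hE x)).congr_deriv ?_
  ring

theorem hasDerivAt_deriv_gaussian_mul_add (hE₁ : ∀ x, HasDerivAt E₁ (E₂ x) x) (x : ℝ) :
    HasDerivAt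
      (fun y => gaussianPDFReal 0 1 y * (Q.derivative.eval y - y * (1 + Q.eval y)) + E₁ y)
      (gaussianPDFReal 0 1 x * ((x ^ 2 - 1) * (1 + Q.eval x) - 2 * (x * Q.derivative.eval x) +
        Q.derivative.derivative.eval x) + E₂ x) x := by
  refine (((hasDerivAt_gaussianPDFReal_zero_one x).mul ((Q.derivative.hasDerivAt x).sub
    ((hasDerivAt_id x).mul ((Q.hasDerivAt x).const_add 1)))).add (hE₁ x)).congr_deriv ?_
  simp only [id, Pi.sub_apply, Pi.mul_apply]
  ring

set_option maxHeartbeats 800000 in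
/-- The pointwise comparison in the region where the Gaussian density dominates the error. -/
theorem exists_abs_fisher_sub_le_core (s D : ℕ) (hs : 1 ≤ s) : ∃ C : ℝ, 0 < C ∧
    ∀ (Q : ℝ[X]) (κ d T x E E₁ : ℝ), 0 ≤ κ → κ ≤ 1 → 0 < T → 0 ≤ d → |x| ≤ T →
      |Q.eval x| ≤ κ * (1 + |x|) ^ D → |Q.derivative.eval x| ≤ κ * (1 + |x|) ^ D →
      κ * (1 + T) ^ D ≤ 1 / 4 → C * (d * Real.exp (T ^ 2 / 2)) ≤ T ^ s →
      |E| ≤ d / (1 + |x| ^ s) → |E₁| ≤ d / (1 + |x| ^ s) →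
      |((gaussianPDFReal 0 1 x * (Q.derivative.eval x - x * (1 + Q.eval x)) + E₁) /
          (gaussianPDFReal 0 1 x * (1 + Q.eval x) + E) + x) ^ 2 *
          (gaussianPDFReal 0 1 x * (1 + Q.eval x) + E) -
        gaussianPDFReal 0 1 x * Q.derivative.eval x ^ 2 * (1 - Q.eval x)| ≤
      2 * κ ^ 4 * (gaussianPDFReal 0 1 x * (1 + |x|) ^ (4 * D)) +
        C * (κ * d * (1 + T) ^ (2 * D + 1) + d ^ 2 * Real.exp (T ^ 2 / 2) / T ^ (2 * s - 2)) := by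
  obtain ⟨C₁, hC₁, h₁⟩ := exists_pow_mul_exp_le s
  obtain ⟨C₂, hC₂, h₂⟩ := exists_pow_mul_exp_le (2 * s - 2)
  -- The summand with C₁ guarantees |E| ≤ φ/4, the one with C₂ pays for ρ²/φ, and 7 = 4 + 3 pays for
  -- the cross term and the denominator term.
  refine ⟨7 + 12 * 2 ^ s * C₁ + 6 * 4 ^ s * C₂, by positivity, ?_⟩
  intro Q κ d T x E E₁ hκ hκ1 hT hd hx hQ hQ' hκT hsmall hE hE₁
  have hφ := gaussianPDFReal_zero_one_pos x
  have hφi := inv_gaussianPDFReal_zero_one_le x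
  set φ := gaussianPDFReal 0 1 x
  set q := Q.eval x
  set q' := Q.derivative.eval x
  set r := |x| with hr
  have hr0 : 0 ≤ r := abs_nonneg x
  have hτ : (1 + r) ^ s ≤ 2 ^ s * (1 + r ^ s) := one_add_pow_le_two_pow_mul s hr0
  have hd' : d / (1 + r ^ s) ≤ 2 ^ s * d / (1 + r) ^ s := by
    rw [div_le_div_iff₀ (by positivity) (by positivity)]
    nlinarith
  have hdd : d / (1 + r ^ s) ≤ d := div_le_self hd (by linarith [pow_nonneg hr0 s])
  have hxr : x ^ 2 = r ^ 2 := (sq_abs x).symm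
  have hpow : κ * (1 + r) ^ D ≤ κ * (1 + T) ^ D := by gcongr
  have hq : |q| ≤ 1 / 4 := hQ.trans (hpow.trans hκT)
  have hEφ : |E| ≤ φ / 4 := by
    have h3 := h₁ T r hr0 hx
    have h4 : |E| * φ⁻¹ ≤ 1 / 4 := by
      calc |E| * φ⁻¹ ≤ 2 ^ s * d / (1 + r) ^ s * (3 * Real.exp (r ^ 2 / 2)) := by
            rw [← hxr]
            exact mul_le_mul (hE.trans hd') hφi (by positivity) (by positivity)
        _ = 3 * 2 ^ s * d * (T ^ s * Real.exp (r ^ 2 / 2)) / ((1 + r) ^ s * T ^ s) := by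
            field_simp
        _ ≤ 3 * 2 ^ s * d * (C₁ * (1 + r) ^ s * Real.exp (T ^ 2 / 2)) / ((1 + r) ^ s * T ^ s) := by
            gcongr
        _ = (12 * 2 ^ s * C₁) * (d * Real.exp (T ^ 2 / 2)) / (4 * T ^ s) := by
            field_simp
            ring
        _ ≤ T ^ s / (4 * T ^ s) := by
            gcongr
            refine le_trans ?_ hsmall
            gcongr
            have : 0 < 6 * 4 ^ s * C₂ := by positivity
            linarith
        _ = 1 / 4 := by field_simp
    rw [← div_eq_mul_inv, div_le_iff₀ hφ] at h4
    linarith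
  -- In p' + xp the derivative of φ cancels and φQ' + ρ remains.
  set ρ := E₁ + x * E with hρ
  have hp : 0 < φ * (1 + q) + E := by
    have := (abs_le.1 hq).1
    have := (abs_le.1 hEφ).1
    nlinarith
  have hρ1 : |ρ| ≤ d / (1 + r ^ s) * (1 + r) := by
    calc |ρ| ≤ |E₁| + |x * E| := abs_add_le _ _
      _ = |E₁| + r * |E| := by rw [abs_mul]
      _ ≤ d / (1 + r ^ s) + r * (d / (1 + r ^ s)) := by gcongr
      _ = _ := by ring
  have e : ((φ * (q' - x * (1 + q)) + E₁) / (φ * (1 + q) + E) + x) ^ 2 * (φ * (1 + q) + E) =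
      (φ * q' + ρ) ^ 2 / (φ * (1 + q) + E) := by
    rw [hρ, div_add' _ _ _ hp.ne', div_pow, pow_two (φ * (1 + q) + E), ← div_div,
      div_mul_cancel₀ _ hp.ne']
    congr 2
    ring
  rw [e]
  refine (abs_sq_div_sub_le hφ hq hEφ).trans ?_
  have hTr : (1 : ℝ) ≤ 1 + T := by linarith
  have t1 : |q'| * |ρ| ≤ κ * d * (1 + T) ^ (2 * D + 1) := by
    calc |q'| * |ρ| ≤ κ * (1 + T) ^ D * (d * (1 + T)) := by
          gcongr
          · exact hQ'.trans hpow
          · exact hρ1.trans (by gcongr)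
      _ = κ * d * (1 + T) ^ (D + 1) := by ring
      _ ≤ κ * d * (1 + T) ^ (2 * D + 1) := by
          gcongr
          omega
  have t3 : q' ^ 2 * |E| ≤ κ * d * (1 + T) ^ (2 * D + 1) := by
    calc q' ^ 2 * |E| = |q'| ^ 2 * |E| := by rw [sq_abs]
      _ ≤ (κ * (1 + T) ^ D) ^ 2 * d := by
          gcongr
          · exact hQ'.trans hpow
          · exact hE.trans hdd
      _ = κ * (κ * d * (1 + T) ^ (2 * D)) := by ring
      _ ≤ 1 * (κ * d * (1 + T) ^ (2 * D)) := by gcongr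
      _ ≤ κ * d * (1 + T) ^ (2 * D + 1) := by
          rw [one_mul]
          gcongr
          omega
  have t4 : φ * q' ^ 2 * q ^ 2 ≤ κ ^ 4 * (φ * (1 + r) ^ (4 * D)) := by
    calc φ * q' ^ 2 * q ^ 2 = φ * |q'| ^ 2 * |q| ^ 2 := by rw [sq_abs, sq_abs]
      _ ≤ φ * (κ * (1 + r) ^ D) ^ 2 * (κ * (1 + r) ^ D) ^ 2 := by gcongr
      _ = _ := by ring
  have t2 : ρ ^ 2 / φ ≤ 3 * 4 ^ s * C₂ * (d ^ 2 * Real.exp (T ^ 2 / 2) / T ^ (2 * s - 2)) := by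
    have h3 := h₂ T r hr0 hx
    have es : (1 + r) ^ (2 * s) = (1 + r) ^ (2 * s - 2) * (1 + r) ^ 2 := by
      rw [← pow_add]
      congr 1
      omega
    have e4 : (4 : ℝ) ^ s = (2 ^ s) ^ 2 := by
      rw [← pow_mul, mul_comm, pow_mul]
      norm_num
    calc ρ ^ 2 / φ = |ρ| ^ 2 * φ⁻¹ := by rw [sq_abs, div_eq_mul_inv]
      _ ≤ (2 ^ s * d / (1 + r) ^ s * (1 + r)) ^ 2 * (3 * Real.exp (r ^ 2 / 2)) := by
          rw [← hxr]
          gcongr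
          exact hρ1.trans (by gcongr)
      _ = 3 * 4 ^ s * d ^ 2 * Real.exp (r ^ 2 / 2) / (1 + r) ^ (2 * s - 2) := by
          have : ((1 + r) ^ s) ^ 2 = (1 + r) ^ (2 * s - 2) * (1 + r) ^ 2 := by
            rw [← es, ← pow_mul, mul_comm]
          rw [mul_pow, div_pow, this, mul_pow, ← e4]
          field_simp
      _ = 3 * 4 ^ s * d ^ 2 * (T ^ (2 * s - 2) * Real.exp (r ^ 2 / 2)) /
            ((1 + r) ^ (2 * s - 2) * T ^ (2 * s - 2)) := by field_simp
      _ ≤ 3 * 4 ^ s * d ^ 2 * (C₂ * (1 + r) ^ (2 * s - 2) * Real.exp (T ^ 2 / 2)) /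
            ((1 + r) ^ (2 * s - 2) * T ^ (2 * s - 2)) := by gcongr
      _ = _ := by field_simp
  set a := κ * d * (1 + T) ^ (2 * D + 1) with ha
  set b := d ^ 2 * Real.exp (T ^ 2 / 2) / T ^ (2 * s - 2) with hb
  have ha0 : 0 ≤ a := by positivity
  have hb0 : 0 ≤ b := by positivity
  have p1 : 0 ≤ (12 * 2 ^ s * C₁ + 6 * 4 ^ s * C₂) * a := by positivity
  have p2 : 0 ≤ (7 + 12 * 2 ^ s * C₁) * b := by positivity
  have e5 : (7 + 12 * 2 ^ s * C₁ + 6 * 4 ^ s * C₂) * (a + b) = 7 * a +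
      (12 * 2 ^ s * C₁ + 6 * 4 ^ s * C₂) * a + (7 + 12 * 2 ^ s * C₁) * b +
      2 * (3 * 4 ^ s * C₂ * b) := by ring
  rw [e5]
  linarith

set_option maxHeartbeats 800000 in
/-- The pointwise comparison in the tails. -/
theorem abs_fisher_sub_le_tail (hs : 4 ≤ s)
    (hE : ∀ x, HasDerivAt E (E₁ x) x) (hE₁ : ∀ x, HasDerivAt E₁ (E₂ x) x)
    (hEb : ∀ x, |E x| ≤ d / (1 + |x| ^ s)) (hE₂b : ∀ x, |E₂ x| ≤ d / (1 + |x| ^ s))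
    (hp : ∀ x, 0 ≤ gaussianPDFReal 0 1 x * (1 + Q.eval x) + E x)
    (hκ : 0 ≤ κ) (hκ1 : κ ≤ 1) (hd : 0 ≤ d) (hT : 2 ≤ T)
    (hQ : ∀ x, |Q.eval x| ≤ κ * (1 + |x|) ^ D)
    (hQ' : ∀ x, |Q.derivative.eval x| ≤ κ * (1 + |x|) ^ D)
    (hQ'' : ∀ x, |Q.derivative.derivative.eval x| ≤ κ * (1 + |x|) ^ D) {x : ℝ} (hx : T ≤ |x|) :
    |((gaussianPDFReal 0 1 x * (Q.derivative.eval x - x * (1 + Q.eval x)) + E₁ x) /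
          (gaussianPDFReal 0 1 x * (1 + Q.eval x) + E x) + x) ^ 2 *
          (gaussianPDFReal 0 1 x * (1 + Q.eval x) + E x) -
        gaussianPDFReal 0 1 x * Q.derivative.eval x ^ 2 * (1 - Q.eval x)| ≤
      (96 * 2 ^ (D + 2) + 12) * (gaussianPDFReal 0 1 x * (1 + |x|) ^ 2 +
        κ * (gaussianPDFReal 0 1 x * (1 + |x|) ^ (3 * D + 2))) +
      (8 * 2 ^ s + 10) * (d / |x| ^ (s - 2)) := by
  have hφ := gaussianPDFReal_zero_one_pos x
  have hx2 : 2 ≤ |x| := hT.trans hx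
  have hx0 : 0 < |x| := by linarith
  set τ := 1 + |x| with hτ
  have hτ1 : 1 ≤ τ := by linarith
  have hD2 : τ ^ (D + 2) ≤ τ ^ (3 * D + 2) := pow_le_pow_right₀ hτ1 (by omega)
  have h3D : τ ^ (3 * D) ≤ τ ^ (3 * D + 2) := pow_le_pow_right₀ hτ1 (by omega)
  set S : ℝ := 3 * gaussianPDFReal 0 1 x * (4 * τ ^ 2 + 4 * κ * (2 ^ (D + 2) * τ ^ (D + 2))) +
    2 ^ s * (d / |x| ^ s) with hS
  have hS0 : 0 ≤ S := by positivity
  -- With δ = 1/|x| the second term in Landau's inequality becomes 4x²p², and S bounds p'' on an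
  -- interval where φ is still comparable to φ(x).
  have hland := sq_deriv_le_of_nonneg (fun y => hasDerivAt_gaussian_mul_add (Q := Q) hE y)
    (fun y => hasDerivAt_deriv_gaussian_mul_add (Q := Q) hE₁ y) hp (x := x) (δ := 1 / |x|) (S := S)
    (by positivity) (by
      intro y hy
      have hinv : 1 / |x| ≤ 1 / 2 := by gcongr
      have hyx : |y| ≤ |x| + |y - x| := by
        calc |y| = |x + (y - x)| := by ring_nf
          _ ≤ _ := abs_add_le _ _
      have hxy : |x| ≤ |y| + |y - x| := by
        calc |x| = |y - (y - x)| := by ring_nf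
          _ ≤ _ := abs_sub _ _
      have hσ : 1 + |y| ≤ 2 * τ := by linarith
      have hyl : |x| / 2 ≤ |y| := by linarith
      have hσ1 : 1 ≤ 1 + |y| := by linarith [abs_nonneg y]
      set σ := 1 + |y| with hσdef
      have b1 : |(y ^ 2 - 1) * (1 + Q.eval y) - 2 * (y * Q.derivative.eval y) +
          Q.derivative.derivative.eval y| ≤ σ ^ 2 + 4 * κ * σ ^ (D + 2) := by
        have a1 : |y ^ 2 - 1| ≤ σ ^ 2 := by
          rw [abs_le, hσdef, ← sq_abs y]
          constructor <;> nlinarith [abs_nonneg y]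
        have a2 : |1 + Q.eval y| ≤ 1 + κ * σ ^ D :=
          (abs_add_le _ _).trans (by rw [abs_one]; linarith [hQ y])
        have a3 : |y * Q.derivative.eval y| ≤ σ ^ 2 * (κ * σ ^ D) := by
          rw [abs_mul]
          refine mul_le_mul ?_ (hQ' y) (abs_nonneg _) (by positivity)
          nlinarith
        have a4 : |Q.derivative.derivative.eval y| ≤ σ ^ 2 * (κ * σ ^ D) := by
          refine (hQ'' y).trans ?_
          refine le_mul_of_one_le_left (by positivity) (one_le_pow₀ hσ1)
        calc _ ≤ |y ^ 2 - 1| * |1 + Q.eval y| + 2 * |y * Q.derivative.eval y| +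
              |Q.derivative.derivative.eval y| := by
              refine (abs_add_le _ _).trans (add_le_add_left ((abs_sub _ _).trans ?_) _)
              rw [abs_mul, abs_mul 2, abs_two]
          _ ≤ σ ^ 2 * (1 + κ * σ ^ D) + 2 * (σ ^ 2 * (κ * σ ^ D)) + σ ^ 2 * (κ * σ ^ D) := by
              gcongr
          _ = _ := by ring
      have b2 : |E₂ y| ≤ 2 ^ s * (d / |x| ^ s) := by
        refine (hE₂b y).trans ?_
        calc d / (1 + |y| ^ s) ≤ d / (|x| / 2) ^ s := by
              gcongr
              have : (|x| / 2) ^ s ≤ |y| ^ s := by gcongr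
              linarith
          _ = _ := by rw [div_pow]; field_simp
      have hφy := gaussianPDFReal_zero_one_le_of_abs_sub_le hx0 hy
      have hφy0 := gaussianPDFReal_zero_one_pos y
      calc _ ≤ gaussianPDFReal 0 1 y * (σ ^ 2 + 4 * κ * σ ^ (D + 2)) + 2 ^ s * (d / |x| ^ s) := by
            refine (abs_add_le _ _).trans (add_le_add ?_ b2)
            rw [abs_mul, abs_of_pos hφy0]
            gcongr
        _ ≤ 3 * gaussianPDFReal 0 1 x * ((2 * τ) ^ 2 + 4 * κ * (2 * τ) ^ (D + 2)) +
              2 ^ s * (d / |x| ^ s) := by gcongr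
        _ = S := by rw [hS, mul_pow, mul_pow]; ring)
  have hpx := hp x
  set p := gaussianPDFReal 0 1 x * (1 + Q.eval x) + E x with hpdef
  set p₁ := gaussianPDFReal 0 1 x * (Q.derivative.eval x - x * (1 + Q.eval x)) + E₁ x
  set φ := gaussianPDFReal 0 1 x
  -- Where p = 0 the expression is 0. Elsewhere Landau's inequality is divided by p, so no lower
  -- bound on p is needed.
  have hF : (p₁ / p + x) ^ 2 * p ≤ 8 * S + 10 * (|x| ^ 2 * p) := by
    rcases hpx.eq_or_lt with h | h
    · rw [← h]
      simpa using hS0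
    · have e1 : (p₁ / p) ^ 2 * p = p₁ ^ 2 / p := by field_simp
      have e2 : p₁ ^ 2 / p ≤ 4 * S + 4 * (|x| ^ 2 * p) := by
        rw [div_le_iff₀ h]
        refine hland.trans (le_of_eq ?_)
        field_simp
      calc (p₁ / p + x) ^ 2 * p ≤ 2 * ((p₁ / p) ^ 2 + x ^ 2) * p := by
            gcongr
            exact add_sq_le
        _ = 2 * (p₁ ^ 2 / p) + 2 * (|x| ^ 2 * p) := by rw [← e1, sq_abs]; ring
        _ ≤ _ := by linarith
  have hxp : |x| ^ 2 * p ≤ φ * τ ^ 2 + κ * (φ * τ ^ (D + 2)) + d / |x| ^ (s - 2) := by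
    have hxτ : |x| ^ 2 ≤ τ ^ 2 := by gcongr; linarith
    have a1 : p ≤ φ * (1 + κ * τ ^ D) + d / (1 + |x| ^ s) := by
      rw [hpdef]
      gcongr
      · exact (le_abs_self _).trans (hQ x)
      · exact (le_abs_self _).trans (hEb x)
    calc |x| ^ 2 * p ≤ |x| ^ 2 * (φ * (1 + κ * τ ^ D) + d / (1 + |x| ^ s)) := by gcongr
      _ = |x| ^ 2 * (φ * (1 + κ * τ ^ D)) + |x| ^ 2 * (d / (1 + |x| ^ s)) := mul_add _ _ _
      _ ≤ τ ^ 2 * (φ * (1 + κ * τ ^ D)) + |x| ^ 2 * (d / |x| ^ s) := by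
          gcongr
          linarith
      _ = φ * τ ^ 2 + κ * (φ * τ ^ (D + 2)) + d / |x| ^ (s - 2) := by
          have : |x| ^ s = |x| ^ (s - 2) * |x| ^ 2 := by
            rw [← pow_add]; congr 1; omega
          rw [this]
          field_simp
          ring
  have hW : |φ * Q.derivative.eval x ^ 2 * (1 - Q.eval x)| ≤ 2 * (κ * (φ * τ ^ (3 * D + 2))) := by
    have a1 : |1 - Q.eval x| ≤ 1 + κ * τ ^ D :=
      (abs_sub _ _).trans (by rw [abs_one]; linarith [hQ x])
    have a2 : 1 + κ * τ ^ D ≤ 2 * τ ^ D := by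
      have : 1 ≤ τ ^ D := one_le_pow₀ hτ1
      nlinarith
    rw [abs_mul, abs_mul, abs_of_pos hφ, abs_pow]
    calc φ * |Q.derivative.eval x| ^ 2 * |1 - Q.eval x|
        ≤ φ * (κ * τ ^ D) ^ 2 * (2 * τ ^ D) := by
          gcongr
          · exact hQ' x
          · exact a1.trans a2
      _ = κ * (2 * (κ * (φ * τ ^ (3 * D)))) := by ring
      _ ≤ 1 * (2 * (κ * (φ * τ ^ (3 * D)))) := by gcongr
      _ ≤ 2 * (κ * (φ * τ ^ (3 * D + 2))) := by rw [one_mul]; gcongr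
  have hF0 : 0 ≤ (p₁ / p + x) ^ 2 * p := by positivity
  have hds : d / |x| ^ s ≤ d / |x| ^ (s - 2) := by
    gcongr
    · linarith
    · omega
  have g1 : κ * (φ * τ ^ (D + 2)) ≤ κ * (φ * τ ^ (3 * D + 2)) := by gcongr
  have hu : 0 ≤ κ * (φ * τ ^ (3 * D + 2)) := by positivity
  have h22 : (4 : ℝ) ≤ 2 ^ (D + 2) := by
    have : (1 : ℝ) ≤ 2 ^ D := one_le_pow₀ (by norm_num)
    rw [pow_add]
    linarith
  refine (abs_sub _ _).trans ?_
  rw [abs_of_nonneg hF0]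
  have hSle : S ≤ 12 * (φ * τ ^ 2) + 12 * 2 ^ (D + 2) * (κ * (φ * τ ^ (3 * D + 2))) +
      2 ^ s * (d / |x| ^ (s - 2)) := by
    have g2 : 12 * 2 ^ (D + 2) * (κ * (φ * τ ^ (D + 2))) ≤
      12 * 2 ^ (D + 2) * (κ * (φ * τ ^ (3 * D + 2))) := by gcongr
    have g3 : 2 ^ s * (d / |x| ^ s) ≤ 2 ^ s * (d / |x| ^ (s - 2)) := by gcongr
    calc S = 12 * (φ * τ ^ 2) + 12 * 2 ^ (D + 2) * (κ * (φ * τ ^ (D + 2))) +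
        2 ^ s * (d / |x| ^ s) := by rw [hS]; ring
      _ ≤ _ := by linarith
  have hv : 0 ≤ φ * τ ^ 2 := by positivity
  have hv' : 4 * (φ * τ ^ 2) ≤ 2 ^ (D + 2) * (φ * τ ^ 2) := mul_le_mul_of_nonneg_right h22 hv
  set u := κ * (φ * τ ^ (3 * D + 2))
  set v := φ * τ ^ 2
  set w := d / |x| ^ (s - 2)
  have e6 : (96 * 2 ^ (D + 2) + 12) * (v + u) + (8 * 2 ^ s + 10) * w =
      96 * (2 ^ (D + 2) * v) + 12 * v + 8 * (12 * 2 ^ (D + 2) * u) + 12 * u +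
        8 * (2 ^ s * w) + 10 * w := by ring
  rw [e6]
  linarith

end FisherPerturbation

section FisherIntegral

open Polynomial

set_option maxHeartbeats 800000 in
/-- The relative Fisher information of a perturbed Gaussian density. -/
theorem exists_abs_integral_fisher_sub_le {s : ℕ} (hs : 4 ≤ s) (D : ℕ) : ∃ C : ℝ, 0 < C ∧
    ∀ (Q : ℝ[X]) (E E₁ E₂ : ℝ → ℝ) (κ d T : ℝ),
      (∀ x, HasDerivAt E (E₁ x) x) → (∀ x, HasDerivAt E₁ (E₂ x) x) →
      (∀ x, |E x| ≤ d / (1 + |x| ^ s)) → (∀ x, |E₁ x| ≤ d / (1 + |x| ^ s)) →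
      (∀ x, |E₂ x| ≤ d / (1 + |x| ^ s)) →
      (∀ x, 0 ≤ gaussianPDFReal 0 1 x * (1 + Q.eval x) + E x) →
      0 ≤ κ → κ ≤ 1 → 0 ≤ d → 2 ≤ T →
      (∀ x, |Q.eval x| ≤ κ * (1 + |x|) ^ D) →
      (∀ x, |Q.derivative.eval x| ≤ κ * (1 + |x|) ^ D) →
      (∀ x, |Q.derivative.derivative.eval x| ≤ κ * (1 + |x|) ^ D) →
      κ * (1 + T) ^ D ≤ 1 / 4 → C * (d * Real.exp (T ^ 2 / 2)) ≤ T ^ s →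
      Integrable (fun x =>
        ((gaussianPDFReal 0 1 x * (Q.derivative.eval x - x * (1 + Q.eval x)) + E₁ x) /
          (gaussianPDFReal 0 1 x * (1 + Q.eval x) + E x) + x) ^ 2 *
          (gaussianPDFReal 0 1 x * (1 + Q.eval x) + E x)) ∧
      |(∫ x, ((gaussianPDFReal 0 1 x * (Q.derivative.eval x - x * (1 + Q.eval x)) + E₁ x) /
          (gaussianPDFReal 0 1 x * (1 + Q.eval x) + E x) + x) ^ 2 *
          (gaussianPDFReal 0 1 x * (1 + Q.eval x) + E x)) -
        ∫ x, gaussianPDFReal 0 1 x * (Q.derivative.eval x ^ 2 * (1 - Q.eval x))| ≤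
      C * (κ ^ 4 + κ * d * (1 + T) ^ (2 * D + 2) +
        d ^ 2 * Real.exp (T ^ 2 / 2) / T ^ (2 * s - 3) + (1 + T) ^ 2 * Real.exp (-T ^ 2 / 2) +
        κ * (1 + T) ^ (3 * D + 2) * Real.exp (-T ^ 2 / 2) + d / T ^ (s - 3)) := by
  obtain ⟨C₀, hC₀, hcore⟩ := exists_abs_fisher_sub_le_core s D (by omega)
  set c₄ : ℝ := 96 * 2 ^ (D + 2) + 12 with hc₄
  set c₅ : ℝ := 8 * 2 ^ s + 10 with hc₅
  set h : ℝ → ℝ := fun y => (1 + |y|) ^ (3 * D + 2) * Real.exp (-(1 / 2) * y ^ 2) with hh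
  have hhI : Integrable h := integrable_one_add_abs_pow_mul_exp _ (by norm_num)
  have hh0 : ∀ y, 0 ≤ h y := fun y => by positivity
  set I₀ := ∫ x, gaussianPDFReal 0 1 x * (1 + |x|) ^ (4 * D) with hI₀
  set I₁ := ∫ y, h y with hI₁
  have hI₀0 : 0 ≤ I₀ := integral_nonneg fun x => by
    have := gaussianPDFReal_zero_one_pos x
    positivity
  have hI₁0 : 0 ≤ I₁ := integral_nonneg hh0
  have hc₄0 : 0 ≤ c₄ := by positivity
  have hc₅0 : 0 ≤ c₅ := by positivity
  have hpi := Real.pi_pos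
  refine ⟨C₀ + 2 * I₀ + 2 * Real.pi * C₀ + 2 * Real.pi * c₅ + 2 * c₄ * I₁, by positivity, ?_⟩
  intro Q E E₁ E₂ κ d T hE hE₁ hEb hE₁b hE₂b hp hκ hκ1 hd hT hQ hQ' hQ'' hκT hsmall
  have hT0 : 0 < T := by linarith
  have hsmall' : C₀ * (d * Real.exp (T ^ 2 / 2)) ≤ T ^ s := by
    refine le_trans ?_ hsmall
    gcongr
    have h1 : 0 ≤ 2 * I₀ := by positivity
    have h2 : 0 ≤ 2 * Real.pi * C₀ := by positivity
    have h3 : 0 ≤ 2 * Real.pi * c₅ := by positivity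
    have h4 : 0 ≤ 2 * c₄ * I₁ := by positivity
    linarith
  set F : ℝ → ℝ := fun x =>
    ((gaussianPDFReal 0 1 x * (Q.derivative.eval x - x * (1 + Q.eval x)) + E₁ x) /
      (gaussianPDFReal 0 1 x * (1 + Q.eval x) + E x) + x) ^ 2 *
      (gaussianPDFReal 0 1 x * (1 + Q.eval x) + E x) with hF
  set W : ℝ → ℝ := fun x =>
    gaussianPDFReal 0 1 x * (Q.derivative.eval x ^ 2 * (1 - Q.eval x)) with hW
  have hWI : Integrable W := by
    have := integrable_gaussianPDFReal_mul_eval (Q.derivative ^ 2 * (1 - Q))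
    simpa only [eval_mul, eval_pow, eval_sub, eval_one] using this
  set a₁ := κ * d * (1 + T) ^ (2 * D + 1) + d ^ 2 * Real.exp (T ^ 2 / 2) / T ^ (2 * s - 2) with ha₁
  set a₂ := d / T ^ (s - 2) with ha₂
  set b := (1 + T) ^ 2 * Real.exp (-T ^ 2 / 2) +
    κ * (1 + T) ^ (3 * D + 2) * Real.exp (-T ^ 2 / 2) with hb
  have ha₁0 : 0 ≤ a₁ := by positivity
  have ha₂0 : 0 ≤ a₂ := by positivity
  have hb0 : 0 ≤ b := by positivity
  -- The kernel 1/(1 + (x/T)²) is at least 1/2 for |x| ≤ T, where it dominates the constant core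
  -- errors, and it also dominates the polynomial tail. Its integral is πT, which is the factor T
  -- gained in the final estimate.
  set G : ℝ → ℝ := fun x => 2 * κ ^ 4 * (gaussianPDFReal 0 1 x * (1 + |x|) ^ (4 * D)) +
    (2 * C₀ * a₁ + 2 * c₅ * a₂) * (1 + (x / T) ^ 2)⁻¹ + c₄ * b * (h (x - T) + h (x + T)) with hG
  have hptw : ∀ x, ‖F x - W x‖ ≤ G x := by
    intro x
    have hφ := gaussianPDFReal_zero_one_pos x
    have n1 : 0 ≤ 2 * κ ^ 4 * (gaussianPDFReal 0 1 x * (1 + |x|) ^ (4 * D)) := by positivity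
    have n2 : 0 ≤ (1 + (x / T) ^ 2)⁻¹ := by positivity
    have n3 : 0 ≤ c₄ * b * (h (x - T) + h (x + T)) :=
      mul_nonneg (by positivity) (add_nonneg (hh0 _) (hh0 _))
    have eW : W x = gaussianPDFReal 0 1 x * Q.derivative.eval x ^ 2 * (1 - Q.eval x) := by
      simp only [hW]
      ring
    rw [Real.norm_eq_abs, eW]
    rcases le_total |x| T with hx | hx
    · refine (hcore Q κ d T x (E x) (E₁ x) hκ hκ1 hT0 hd hx (hQ x) (hQ' x) hκT hsmall' (hEb x)
        (hE₁b x)).trans ?_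
      have h1 : 1 ≤ 2 * (1 + (x / T) ^ 2)⁻¹ := by
        have : (x / T) ^ 2 ≤ 1 := by
          rw [sq_le_one_iff_abs_le_one, abs_div, abs_of_pos hT0, div_le_one hT0]
          exact hx
        rw [← div_eq_mul_inv, le_div_iff₀ (by positivity)]
        linarith
      have h2 : C₀ * a₁ ≤ (2 * C₀ * a₁ + 2 * c₅ * a₂) * (1 + (x / T) ^ 2)⁻¹ := by
        calc C₀ * a₁ ≤ C₀ * a₁ * (2 * (1 + (x / T) ^ 2)⁻¹) :=
              le_mul_of_one_le_right (by positivity) h1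
          _ = 2 * C₀ * a₁ * (1 + (x / T) ^ 2)⁻¹ := by ring
          _ ≤ _ := by
              gcongr
              exact le_add_of_nonneg_right (by positivity)
      simp only [hG]
      linarith
    · refine (abs_fisher_sub_le_tail hs hE hE₁ hEb hE₂b hp hκ hκ1 hd hT hQ hQ' hQ'' hx).trans ?_
      have hx0 : 0 < |x| := by linarith
      have g1 : gaussianPDFReal 0 1 x * (1 + |x|) ^ 2 ≤ (1 + T) ^ 2 * Real.exp (-T ^ 2 / 2) *
          (h (x - T) + h (x + T)) := by
        calc gaussianPDFReal 0 1 x * (1 + |x|) ^ 2 ≤ Real.exp (-x ^ 2 / 2) * (1 + |x|) ^ 2 := by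
              gcongr
              exact gaussianPDFReal_zero_one_le_exp x
          _ ≤ _ := by
              rw [mul_comm]
              refine (one_add_abs_pow_mul_exp_le 2 hT0.le hx).trans ?_
              simp only [hh]
              gcongr <;> first | omega | linarith [abs_nonneg (x - T), abs_nonneg (x + T)]
      have g2 : gaussianPDFReal 0 1 x * (1 + |x|) ^ (3 * D + 2) ≤
          (1 + T) ^ (3 * D + 2) * Real.exp (-T ^ 2 / 2) * (h (x - T) + h (x + T)) := by
        calc _ ≤ Real.exp (-x ^ 2 / 2) * (1 + |x|) ^ (3 * D + 2) := by
              gcongr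
              exact gaussianPDFReal_zero_one_le_exp x
          _ ≤ _ := by
              rw [mul_comm]
              exact one_add_abs_pow_mul_exp_le (3 * D + 2) hT0.le hx
      have g3 : c₄ * (gaussianPDFReal 0 1 x * (1 + |x|) ^ 2 +
          κ * (gaussianPDFReal 0 1 x * (1 + |x|) ^ (3 * D + 2))) ≤
          c₄ * b * (h (x - T) + h (x + T)) := by
        calc _ ≤ c₄ * ((1 + T) ^ 2 * Real.exp (-T ^ 2 / 2) * (h (x - T) + h (x + T)) +
              κ * ((1 + T) ^ (3 * D + 2) * Real.exp (-T ^ 2 / 2) *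
                (h (x - T) + h (x + T)))) := by gcongr
          _ = _ := by rw [hb]; ring
      -- For |x| ≥ T the exponent s - 4 ≥ 0 can be evaluated at T, and the remaining |x|² is at
      -- least (T² + |x|²)/2.
      have g4 : d / |x| ^ (s - 2) ≤ 2 * a₂ * (1 + (x / T) ^ 2)⁻¹ := by
        have e1 : |x| ^ (s - 2) = |x| ^ (s - 4) * |x| ^ 2 := by
          rw [← pow_add]; congr 1; omega
        have e2 : T ^ (s - 2) = T ^ (s - 4) * T ^ 2 := by
          rw [← pow_add]; congr 1; omega
        have e3 : T ^ (s - 4) * ((T ^ 2 + |x| ^ 2) / 2) ≤ |x| ^ (s - 4) * |x| ^ 2 := by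
          have : T ^ 2 ≤ |x| ^ 2 := by gcongr
          gcongr
          linarith
        calc d / |x| ^ (s - 2) ≤ d / (T ^ (s - 4) * ((T ^ 2 + |x| ^ 2) / 2)) := by
              rw [e1]
              gcongr
          _ = _ := by
              rw [ha₂, e2, sq_abs]
              field_simp
      have g5 : c₅ * (d / |x| ^ (s - 2)) ≤
          (2 * C₀ * a₁ + 2 * c₅ * a₂) * (1 + (x / T) ^ 2)⁻¹ := by
        calc c₅ * (d / |x| ^ (s - 2)) ≤ c₅ * (2 * a₂ * (1 + (x / T) ^ 2)⁻¹) := by gcongr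
          _ = 2 * c₅ * a₂ * (1 + (x / T) ^ 2)⁻¹ := by ring
          _ ≤ _ := by
              gcongr
              exact le_add_of_nonneg_left (by positivity)
      simp only [hG]
      linarith
  have hφcont : Continuous (gaussianPDFReal 0 1) :=
    (contDiff_gaussianPDFReal_zero_one (m := 1)).continuous
  have hEc : Continuous E := continuous_iff_continuousAt.2 fun x => (hE x).continuousAt
  have hE₁c : Continuous E₁ := continuous_iff_continuousAt.2 fun x => (hE₁ x).continuousAt
  have hFm : AEStronglyMeasurable F volume := by
    have m0 : Measurable fun x => gaussianPDFReal 0 1 x * (1 + Q.eval x) + E x :=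
      ((hφcont.mul (continuous_const.add Q.continuous)).add hEc).measurable
    have m1 : Measurable fun x => gaussianPDFReal 0 1 x *
        (Q.derivative.eval x - x * (1 + Q.eval x)) + E₁ x :=
      ((hφcont.mul (Q.derivative.continuous.sub (continuous_id.mul
        (continuous_const.add Q.continuous)))).add hE₁c).measurable
    exact ((((m1.div m0).add measurable_id).pow_const 2).mul m0).aestronglyMeasurable
  have i1 : Integrable fun x => 2 * κ ^ 4 * (gaussianPDFReal 0 1 x * (1 + |x|) ^ (4 * D)) :=
    (integrable_gaussianPDFReal_mul_pow (4 * D)).const_mul _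
  have i2 : Integrable fun x => (2 * C₀ * a₁ + 2 * c₅ * a₂) * (1 + (x / T) ^ 2)⁻¹ :=
    (integrable_inv_one_add_sq.comp_div hT0.ne').const_mul _
  have i3 : Integrable fun x => c₄ * b * (h (x - T) + h (x + T)) :=
    ((hhI.comp_sub_right T).add (hhI.comp_add_right T)).const_mul _
  have hGI : Integrable G := (i1.add i2).add i3
  have hFWI : Integrable fun x => F x - W x :=
    hGI.mono' (hFm.sub hWI.aestronglyMeasurable) (ae_of_all _ hptw)
  have hFI : Integrable F := by
    refine (hFWI.add hWI).congr (ae_of_all _ fun x => ?_)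
    simp
  refine ⟨hFI, ?_⟩
  rw [← integral_sub hFI hWI, ← Real.norm_eq_abs]
  refine (norm_integral_le_of_norm_le hGI (ae_of_all _ hptw)).trans ?_
  have hGint : ∫ x, G x = 2 * κ ^ 4 * I₀ + (2 * C₀ * a₁ + 2 * c₅ * a₂) * (T * Real.pi) +
      c₄ * b * (I₁ + I₁) := by
    have e1 : ∫ x, G x = (∫ x, (2 * κ ^ 4 * (gaussianPDFReal 0 1 x * (1 + |x|) ^ (4 * D)) +
        (2 * C₀ * a₁ + 2 * c₅ * a₂) * (1 + (x / T) ^ 2)⁻¹)) +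
        ∫ x, c₄ * b * (h (x - T) + h (x + T)) := integral_add (i1.add i2) i3
    rw [e1, integral_add i1 i2, integral_const_mul, integral_const_mul, integral_const_mul,
      integral_add (hhI.comp_sub_right T) (hhI.comp_add_right T),
      integral_sub_right_eq_self h T, integral_add_right_eq_self h T,
      Measure.integral_comp_div (fun x => (1 + x ^ 2)⁻¹) T, integral_univ_inv_one_add_sq,
      abs_of_pos hT0, smul_eq_mul]
  rw [hGint]
  set z₁ := κ * d * (1 + T) ^ (2 * D + 2) with hz₁
  set z₂ := d ^ 2 * Real.exp (T ^ 2 / 2) / T ^ (2 * s - 3) with hz₂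
  set z₃ := d / T ^ (s - 3) with hz₃
  have hz₁0 : 0 ≤ z₁ := by positivity
  have hz₂0 : 0 ≤ z₂ := by positivity
  have hz₃0 : 0 ≤ z₃ := by positivity
  have f1 : a₁ * T ≤ z₁ + z₂ := by
    have e1 : T ^ (2 * s - 2) = T ^ (2 * s - 3) * T := by
      rw [← pow_succ]; congr 1; omega
    rw [ha₁, add_mul]
    refine add_le_add ?_ (le_of_eq ?_)
    · calc κ * d * (1 + T) ^ (2 * D + 1) * T ≤ κ * d * (1 + T) ^ (2 * D + 1) * (1 + T) := by
            gcongr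
            linarith
        _ = z₁ := by rw [hz₁]; ring
    · rw [hz₂, e1]
      field_simp
  have f2 : a₂ * T = z₃ := by
    have e1 : T ^ (s - 2) = T ^ (s - 3) * T := by
      rw [← pow_succ]; congr 1; omega
    rw [ha₂, hz₃, e1]
    field_simp
  have e7 : κ ^ 4 + z₁ + z₂ + (1 + T) ^ 2 * Real.exp (-T ^ 2 / 2) +
      κ * (1 + T) ^ (3 * D + 2) * Real.exp (-T ^ 2 / 2) + z₃ = κ ^ 4 + (z₁ + z₂) + z₃ + b := by
    rw [hb]
    ring
  rw [e7]
  have hk0 : 0 ≤ κ ^ 4 := by positivity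
  set z := z₁ + z₂ with hz
  have hz0 : 0 ≤ z := by positivity
  calc 2 * κ ^ 4 * I₀ + (2 * C₀ * a₁ + 2 * c₅ * a₂) * (T * Real.pi) + c₄ * b * (I₁ + I₁)
      = 2 * I₀ * κ ^ 4 + 2 * Real.pi * C₀ * (a₁ * T) + 2 * Real.pi * c₅ * (a₂ * T) +
        2 * c₄ * I₁ * b := by ring
    _ ≤ 2 * I₀ * κ ^ 4 + 2 * Real.pi * C₀ * z + 2 * Real.pi * c₅ * z₃ + 2 * c₄ * I₁ * b := by
        rw [f2]
        gcongr
    _ ≤ 2 * I₀ * (κ ^ 4 + z + z₃ + b) + 2 * Real.pi * C₀ * (κ ^ 4 + z + z₃ + b) +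
        2 * Real.pi * c₅ * (κ ^ 4 + z + z₃ + b) + 2 * c₄ * I₁ * (κ ^ 4 + z + z₃ + b) := by
        gcongr <;> linarith
    _ ≤ C₀ * (κ ^ 4 + z + z₃ + b) + (2 * I₀ * (κ ^ 4 + z + z₃ + b) +
        2 * Real.pi * C₀ * (κ ^ 4 + z + z₃ + b) +
        2 * Real.pi * c₅ * (κ ^ 4 + z + z₃ + b) + 2 * c₄ * I₁ * (κ ^ 4 + z + z₃ + b)) :=
        le_add_of_nonneg_left (by positivity)
    _ = _ := by ring

end FisherIntegral

/-! ### Choice of the cutoff and asymptotics of the Fisher information. -/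

section FisherAsymptotics

open Polynomial

/-- Uniqueness of the density reduces the infimum to one value, φ'/φ = -x, and the set {p > 0} may
be dropped because the integrand has the factor p. -/
theorem relFisherInfo_eq_ofReal_integral {ν : Measure ℝ} {p p₁ : ℝ → ℝ} (hp : IsACDensity ν p)
    (hd : ∀ x, HasDerivAt p (p₁ x) x)
    (hI : Integrable fun x => (p₁ x / p x + x) ^ 2 * p x) :
    relFisherInfo ν 0 1 = ENNReal.ofReal (∫ x, (p₁ x / p x + x) ^ 2 * p x) := by
  have h1 : relFisherInfo ν 0 1 = ∫⁻ x in {x | 0 < p x}, ENNReal.ofReal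
      ((deriv p x / p x - deriv (gaussianPDFReal 0 1) x / gaussianPDFReal 0 1 x) ^ 2 * p x) := by
    refine le_antisymm (iInf₂_le p hp) (le_iInf₂ fun q hq => ?_)
    rw [hq.unique hp]
  have hS : MeasurableSet {x | 0 < p x} := measurableSet_lt measurable_const
    hp.continuous.measurable
  rw [h1, ofReal_integral_eq_lintegral_ofReal hI
    (ae_of_all _ fun x => mul_nonneg (sq_nonneg _) (hp.nonneg x)), ← lintegral_indicator hS]
  refine lintegral_congr fun x => ?_
  rcases (hp.nonneg x).eq_or_lt with h | h
  · simp [← h]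
  · rw [Set.indicator_of_mem (by exact h), (hd x).deriv,
      (hasDerivAt_gaussianPDFReal_zero_one x).deriv,
      mul_div_cancel_right₀ _ (gaussianPDFReal_zero_one_pos x).ne', sub_neg_eq_add]

/-- The point where the Gaussian density becomes comparable with the error term. -/
theorem eventually_exists_cutoff {s : ℕ} (hs : 3 ≤ s) (H : ℕ) (M : ℝ) {θ : ℝ} (hθ : 0 < θ) :
    ∀ᶠ n : ℕ in atTop, ∃ T : ℝ,
      Real.exp (T ^ 2 / 2) * (√(n : ℝ))⁻¹ ^ (s - 2) = √(Real.log n) ^ s ∧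
      1 ≤ √(Real.log n) ∧ M ≤ √(Real.log n) ∧ √(Real.log n) ≤ T ∧
      1 + T ≤ 3 * s * √(Real.log n) ∧ (√(n : ℝ))⁻¹ * (1 + T) ^ H ≤ θ := by
  have hlog : Tendsto (fun n : ℕ => √(Real.log n)) atTop atTop :=
    Real.tendsto_sqrt_atTop.comp (Real.tendsto_log_atTop.comp tendsto_natCast_atTop_atTop)
  have hs0 : (0 : ℝ) < s := by exact_mod_cast (by omega : 0 < s)
  set c := θ / (3 * s) ^ H with hc
  have hc0 : 0 < c := by positivity
  have hpow : ∀ᶠ n : ℕ in atTop, Real.log n ^ H ≤ c ^ 2 * n := by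
    have h1 := (Real.isLittleO_pow_log_id_atTop (n := H)).comp_tendsto tendsto_natCast_atTop_atTop
    filter_upwards [h1.def (by positivity : 0 < c ^ 2)] with n hn
    simp only [Function.comp, id, Real.norm_natCast] at hn
    exact (le_abs_self _).trans hn
  filter_upwards [hlog.eventually_ge_atTop 1, hlog.eventually_ge_atTop M, hpow,
    eventually_ge_atTop 1] with n h1 hM hn hn1
  have hn0 : (0 : ℝ) < n := by exact_mod_cast hn1
  set L := Real.log n with hL
  have hL1 : 1 ≤ L := by
    rwa [Real.one_le_sqrt] at h1
  have hL0 : 0 < L := by linarith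
  have hLL : 0 ≤ Real.log L := Real.log_nonneg hL1
  have hLL' : Real.log L ≤ L := (Real.log_le_sub_one_of_pos hL0).trans (by linarith)
  have hs2 : ((s - 2 : ℕ) : ℝ) = s - 2 := by rw [Nat.cast_sub (by omega)]; norm_num
  have hs3 : (3 : ℝ) ≤ s := by exact_mod_cast hs
  -- T² = (s - 2) log n + s log log n solves the required equation. Then dε-scale errors times
  -- e^{T²/2} stay below a multiple of T^s, while T²e^{-T²/2} is smaller than the target rate by a
  -- factor of order 1/√(log n).
  set T := √((s - 2 : ℕ) * L + s * Real.log L) with hT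
  have hT2 : T ^ 2 = (s - 2 : ℕ) * L + s * Real.log L := Real.sq_sqrt (by positivity)
  have hTle : T ≤ 2 * s * √L := by
    rw [hT, Real.sqrt_le_left (by positivity), mul_pow, Real.sq_sqrt hL0.le, hs2]
    have h2 : (s : ℝ) * Real.log L ≤ s * L := by gcongr
    have h3 : ((s : ℝ) - 2 + s) * L ≤ (2 * s) ^ 2 * L := by
      gcongr
      nlinarith
    linarith
  have hTle' : 1 + T ≤ 3 * s * √L := by nlinarith
  have hT0 : 0 ≤ T := Real.sqrt_nonneg _
  refine ⟨T, ?_, h1, hM, ?_, hTle', ?_⟩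
  · have e1 : Real.exp (T ^ 2 / 2) = √(n : ℝ) ^ (s - 2) * √L ^ s := by
      rw [hT2, show (((s - 2 : ℕ) : ℝ) * L + s * Real.log L) / 2 = ((s - 2 : ℕ) : ℝ) * (L / 2) +
        s * (Real.log L / 2) by ring, Real.exp_add, Real.exp_nat_mul, Real.exp_nat_mul,
        Real.exp_half, Real.exp_half, Real.exp_log hL0, hL, Real.exp_log hn0]
    rw [e1, mul_right_comm, ← mul_pow, mul_inv_cancel₀ (by positivity), one_pow, one_mul]
  · refine Real.sqrt_le_sqrt ?_
    rw [hs2]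
    have : 0 ≤ (s : ℝ) * Real.log L := by positivity
    nlinarith
  · have h5 : √L ^ H ≤ c * √(n : ℝ) := by
      refine (sq_le_sq₀ (by positivity) (by positivity)).1 ?_
      rw [← pow_mul, mul_comm H, pow_mul, Real.sq_sqrt hL0.le, mul_pow, Real.sq_sqrt hn0.le]
      exact hn
    calc (√(n : ℝ))⁻¹ * (1 + T) ^ H ≤ (√(n : ℝ))⁻¹ * (3 * s * √L) ^ H := by gcongr
      _ = (√(n : ℝ))⁻¹ * ((3 * s) ^ H * √L ^ H) := by rw [mul_pow]
      _ ≤ (√(n : ℝ))⁻¹ * ((3 * s) ^ H * (c * √(n : ℝ))) := by gcongr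
      _ = θ := by
        have : 0 < √(n : ℝ) := by positivity
        rw [hc]
        field_simp

theorem exists_abs_eval_specialize_derivatives_le (P : ℝ[X][X]) :
    ∃ (K : ℝ) (D : ℕ), 1 ≤ K ∧ ∀ ε : ℝ, |ε| ≤ 1 → ∀ x : ℝ,
      |(specialize P ε).eval x| ≤ K * (1 + |x|) ^ D ∧
      |(specialize P ε).derivative.eval x| ≤ K * (1 + |x|) ^ D ∧
      |(specialize P ε).derivative.derivative.eval x| ≤ K * (1 + |x|) ^ D := by
  obtain ⟨K₀, D₀, hK₀, h₀⟩ := exists_abs_eval_specialize_le P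
  obtain ⟨K₁, D₁, hK₁, h₁⟩ := exists_abs_eval_specialize_le P.derivative
  obtain ⟨K₂, D₂, hK₂, h₂⟩ := exists_abs_eval_specialize_le P.derivative.derivative
  refine ⟨1 + K₀ + K₁ + K₂, D₀ + D₁ + D₂, by linarith, fun ε hε x => ?_⟩
  have hx : 1 ≤ 1 + |x| := by linarith [abs_nonneg x]
  have mono : ∀ {K : ℝ} {D : ℕ} {y : ℝ}, 0 ≤ K → K ≤ 1 + K₀ + K₁ + K₂ → D ≤ D₀ + D₁ + D₂ →
      |y| ≤ K * (1 + |x|) ^ D → |y| ≤ (1 + K₀ + K₁ + K₂) * (1 + |x|) ^ (D₀ + D₁ + D₂) := by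
    intro K D y hK hK' hD h
    refine h.trans (mul_le_mul hK' (pow_le_pow_right₀ hx hD) (by positivity) (by linarith))
  have e₁ : (specialize P ε).derivative = specialize P.derivative ε := by
    rw [specialize, specialize, derivative_map]
  have e₂ : (specialize P.derivative ε).derivative = specialize P.derivative.derivative ε := by
    rw [specialize, specialize, derivative_map]
  refine ⟨mono hK₀ (by linarith) (by omega) (h₀ ε hε x), ?_, ?_⟩
  · rw [e₁]
    exact mono hK₁ (by linarith) (by omega) (h₁ ε hε x)
  · rw [e₁, e₂]
    exact mono hK₂ (by linarith) (by omega) (h₂ ε hε x)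

/-- The error terms of the Fisher information are of the required order at the cutoff point. -/
theorem fisher_error_le {s k D : ℕ} (hs : 4 ≤ s) (hk : 3 ≤ k) {ε ℓ T K η : ℝ} (hε : 0 < ε)
    (hε1 : ε ≤ 1) (hℓ1 : 1 ≤ ℓ) (hK : 1 ≤ K) (hη : 0 < η) (hη1 : η ≤ 1)
    (hT : Real.exp (T ^ 2 / 2) * ε ^ (s - 2) = ℓ ^ s) (hℓT : ℓ ≤ T) (hTℓ : 1 + T ≤ 3 * s * ℓ)
    (hℓη : 9 * s ^ 2 / η ≤ ℓ) (hsmall : ε * (1 + T) ^ (5 * D + s + 2) ≤ η / K) :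
    (K * ε ^ (k - 2)) ^ 4 + K * ε ^ (k - 2) * (η * ε ^ (s - 2)) * (1 + T) ^ (2 * D + 2) +
        (η * ε ^ (s - 2)) ^ 2 * Real.exp (T ^ 2 / 2) / T ^ (2 * s - 3) +
        (1 + T) ^ 2 * Real.exp (-T ^ 2 / 2) +
        K * ε ^ (k - 2) * (1 + T) ^ (3 * D + 2) * Real.exp (-T ^ 2 / 2) +
        η * ε ^ (s - 2) / T ^ (s - 3) ≤
      K ^ 4 * (ε ^ 2) ^ (k - 1) + 5 * η * (ε ^ (s - 2) / ℓ ^ (s - 3)) := by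
  have hℓ0 : 0 < ℓ := by linarith
  have hT1 : 1 ≤ T := hℓ1.trans hℓT
  have hT0 : 0 < T := by linarith
  have h1T : 1 ≤ 1 + T := by linarith
  have hK0 : 0 < K := by linarith
  have hs0 : (0 : ℝ) < s := by exact_mod_cast (by omega : 0 < s)
  have hεk : ε ^ (k - 2) ≤ ε := pow_le_of_le_one hε.le hε1 (by omega)
  have hsm : ∀ m ≤ 5 * D + s + 2, K * ε * (1 + T) ^ m ≤ η := by
    intro m hm
    calc K * ε * (1 + T) ^ m ≤ K * (ε * (1 + T) ^ (5 * D + s + 2)) := by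
          rw [mul_assoc]
          gcongr
      _ ≤ K * (η / K) := by gcongr
      _ = η := by field_simp
  have hexp : Real.exp (-T ^ 2 / 2) = ε ^ (s - 2) / ℓ ^ s := by
    rw [← hT, neg_div, Real.exp_neg]
    have := Real.exp_pos (T ^ 2 / 2)
    field_simp
  set A := ε ^ (s - 2) with hA
  have hA0 : 0 < A := by positivity
  -- Here 4(k - 2) ≥ 2(k - 1), which is exactly k ≥ 3.
  have t1 : (K * ε ^ (k - 2)) ^ 4 ≤ K ^ 4 * (ε ^ 2) ^ (k - 1) := by
    rw [mul_pow, ← pow_mul, ← pow_mul]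
    exact mul_le_mul_of_nonneg_left (pow_le_pow_of_le_one hε.le hε1 (by omega)) (by positivity)
  -- The spare factor ε^{k-2} ≤ ε absorbs every power of T.
  have t2 : K * ε ^ (k - 2) * (η * A) * (1 + T) ^ (2 * D + 2) ≤ η * (A / ℓ ^ (s - 3)) := by
    rw [← mul_div_assoc, le_div_iff₀ (by positivity)]
    calc K * ε ^ (k - 2) * (η * A) * (1 + T) ^ (2 * D + 2) * ℓ ^ (s - 3)
        ≤ K * ε * (η * A) * (1 + T) ^ (2 * D + 2) * (1 + T) ^ (s - 3) := by
          gcongr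
          linarith
      _ = K * ε * (1 + T) ^ (2 * D + 2 + (s - 3)) * (η * A) := by rw [pow_add]; ring
      _ ≤ 1 * (η * A) := by
          gcongr
          exact (hsm _ (by omega)).trans hη1
      _ = η * A := one_mul _
  have t3 : (η * A) ^ 2 * Real.exp (T ^ 2 / 2) / T ^ (2 * s - 3) ≤ η * (A / ℓ ^ (s - 3)) := by
    have e1 : ℓ ^ (2 * s - 3) = ℓ ^ s * ℓ ^ (s - 3) := by
      rw [← pow_add]; congr 1; omega
    calc (η * A) ^ 2 * Real.exp (T ^ 2 / 2) / T ^ (2 * s - 3)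
        = η * (η * A) * (Real.exp (T ^ 2 / 2) * A) / T ^ (2 * s - 3) := by ring
      _ ≤ 1 * (η * A) * ℓ ^ s / ℓ ^ (2 * s - 3) := by
          rw [hT]
          gcongr
      _ = η * (A / ℓ ^ (s - 3)) := by
          rw [e1]
          field_simp
  -- The cutoff equation gives ℓ^{-s}; two powers of ℓ are lost to (1 + T)², and the one left over
  -- beyond ℓ^{-(s-3)} beats 9s²/η.
  have t4 : (1 + T) ^ 2 * Real.exp (-T ^ 2 / 2) ≤ η * (A / ℓ ^ (s - 3)) := by
    have e1 : ℓ ^ s = ℓ ^ (s - 3) * ℓ ^ 3 := by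
      rw [← pow_add]; congr 1; omega
    rw [div_le_iff₀ hη] at hℓη
    calc (1 + T) ^ 2 * Real.exp (-T ^ 2 / 2) ≤ (3 * s * ℓ) ^ 2 * (A / ℓ ^ s) := by
          rw [hexp]
          gcongr
      _ = 9 * s ^ 2 * (A / (ℓ ^ (s - 3) * ℓ)) := by
          rw [e1]
          field_simp
          norm_num
      _ ≤ ℓ * η * (A / (ℓ ^ (s - 3) * ℓ)) := by gcongr
      _ = η * (A / ℓ ^ (s - 3)) := by field_simp
  have hℓs : A / ℓ ^ s ≤ A / ℓ ^ (s - 3) := by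
    gcongr
    omega
  have t5 : K * ε ^ (k - 2) * (1 + T) ^ (3 * D + 2) * Real.exp (-T ^ 2 / 2) ≤
      η * (A / ℓ ^ (s - 3)) := by
    rw [hexp]
    refine mul_le_mul (le_trans ?_ (hsm (3 * D + 2) (by omega))) hℓs (by positivity) hη.le
    gcongr
  have t6 : η * A / T ^ (s - 3) ≤ η * (A / ℓ ^ (s - 3)) := by
    rw [← mul_div_assoc]
    gcongr
  linarith

/-- The expansion of the relative Fisher information along laws whose densities have Edgeworth
expansions. -/
theorem exists_eventually_abs_relFisherInfo_sub_le {s k : ℕ} (hs : 4 ≤ s) (hk3 : 3 ≤ k)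
    (hks : k ≤ s) (a : ℕ → ℝ) {ν : ℕ → Measure ℝ}
    (hν : ∀ η > 0, ∀ᶠ n : ℕ in atTop, ∃ E : ℝ → ℝ, ContDiff ℝ 2 E ∧
      (∀ i ≤ 2, ∀ x, (1 + |x| ^ s) * |iteratedDeriv i E x| ≤ η * (√(n : ℝ))⁻¹ ^ (s - 2)) ∧
      IsACDensity (ν n) fun x => gaussianPDFReal 0 1 x * (1 + (√(n : ℝ))⁻¹ ^ (k - 2) *
        (specialize (edgeworthHermite k s s a) (√(n : ℝ))⁻¹).eval x) + E x) :
    ∃ C : ℝ, 0 ≤ C ∧ ∀ η > 0, ∀ᶠ n : ℕ in atTop, relFisherInfo (ν n) 0 1 < ∞ ∧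
      |(relFisherInfo (ν n) 0 1).toReal -
          a k ^ 2 * (k * k.factorial) * ((√(n : ℝ))⁻¹ ^ 2) ^ (k - 2)| ≤
        C * ((√(n : ℝ))⁻¹ ^ 2) ^ (k - 1) +
          η * ((√(n : ℝ))⁻¹ ^ (s - 2) / √(Real.log n) ^ (s - 3)) := by
  set B := edgeworthHermite k s s a with hB
  obtain ⟨K, D, hK1, hBb⟩ := exists_abs_eval_specialize_derivatives_le B
  obtain ⟨K', hK', hmain⟩ := exists_abs_edgeworth_fisher_sub_le hk3 hks (by omega : 1 ≤ s) a
  obtain ⟨C, hC, hfish⟩ := exists_abs_integral_fisher_sub_le hs D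
  -- The two summands come from the term κ⁴ and from the even expansion of the main term. Neither
  -- depends on η', as the later split into O and o requires.
  refine ⟨C * K ^ 4 + K', by positivity, fun η' hη' => ?_⟩
  have hK0 : 0 < K := by linarith
  -- The three bounds serve |Q| ≤ 1/4 on the core, the smallness condition at T, and the final
  -- coefficient η'.
  set η := min (1 / 4) (min (1 / C) (η' / (5 * C))) with hη
  have hη0 : 0 < η := by positivity
  have hη4 : η ≤ 1 / 4 := min_le_left _ _
  have hηC : C * η ≤ 1 := by
    calc C * η ≤ C * (1 / C) := by
          gcongr
          exact (min_le_right _ _).trans (min_le_left _ _)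
      _ = 1 := by field_simp
  have hηη : C * (5 * η) ≤ η' := by
    calc C * (5 * η) ≤ C * (5 * (η' / (5 * C))) := by
          gcongr
          exact (min_le_right _ _).trans (min_le_right _ _)
      _ = η' := by field_simp
  filter_upwards [hν η hη0, eventually_ge_atTop 1, eventually_exists_cutoff (by omega : 3 ≤ s)
    (5 * D + s + 2) (max 2 (9 * s ^ 2 / η)) (by positivity : 0 < η / K)] with n hn hn1 hcut
  obtain ⟨E, hE2, hEb, hac⟩ := hn
  obtain ⟨T, hT, hℓ1, hM, hℓT, hTℓ, hsmall⟩ := hcut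
  obtain ⟨hε, hε1, -⟩ := inv_sqrt_natCast_bounds hn1
  set ε := (√(n : ℝ))⁻¹ with hεdef
  set ℓ := √(Real.log n) with hℓ
  have hεabs : |ε| ≤ 1 := by rwa [abs_of_pos hε]
  set Q : ℝ[X] := Polynomial.C (ε ^ (k - 2)) * specialize B ε with hQ
  have eQ : ∀ x, Q.eval x = ε ^ (k - 2) * (specialize B ε).eval x := fun x => by
    rw [hQ, eval_C_mul]
  have eQ' : ∀ x, Q.derivative.eval x = ε ^ (k - 2) * (specialize B ε).derivative.eval x :=
    fun x => by rw [hQ, derivative_C_mul, eval_C_mul]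
  have eQ'' : ∀ x, Q.derivative.derivative.eval x =
      ε ^ (k - 2) * (specialize B ε).derivative.derivative.eval x := fun x => by
    rw [hQ, derivative_C_mul, derivative_C_mul, eval_C_mul]
  have bd : ∀ {x y z : ℝ}, y = ε ^ (k - 2) * z → |z| ≤ K * (1 + |x|) ^ D →
      |y| ≤ K * ε ^ (k - 2) * (1 + |x|) ^ D := by
    intro x y z hy hz
    rw [hy, abs_mul, abs_of_pos (by positivity)]
    calc ε ^ (k - 2) * |z| ≤ ε ^ (k - 2) * (K * (1 + |x|) ^ D) := by gcongr
      _ = _ := by ring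
  have hEd : ∀ x, HasDerivAt E (deriv E x) x := fun x =>
    (hE2.differentiable (by norm_num) x).hasDerivAt
  have hE1 : ContDiff ℝ 1 (deriv E) := by
    have h2 : ContDiff ℝ (1 + 1) E := by
      rw [one_add_one_eq_two]
      exact hE2
    exact (contDiff_succ_iff_deriv.1 h2).2.2
  have hEd' : ∀ x, HasDerivAt (deriv E) (deriv (deriv E) x) x := fun x =>
    (hE1.differentiable (by norm_num) x).hasDerivAt
  have hEb' : ∀ i ≤ 2, ∀ x, |iteratedDeriv i E x| ≤ η * ε ^ (s - 2) / (1 + |x| ^ s) := by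
    intro i hi x
    rw [le_div_iff₀' (by positivity)]
    exact hEb i hi x
  have hℓ0 : 0 < ℓ := by linarith
  have hT2 : 2 ≤ T := (le_max_left _ _).trans (hM.trans hℓT)
  have hεk : ε ^ (k - 2) ≤ ε := pow_le_of_le_one hε.le hε1 (by omega)
  have hκT : K * ε ^ (k - 2) * (1 + T) ^ D ≤ 1 / 4 := by
    calc K * ε ^ (k - 2) * (1 + T) ^ D ≤ K * (ε * (1 + T) ^ (5 * D + s + 2)) := by
          rw [mul_assoc]
          gcongr
          · linarith
          · omega
      _ ≤ K * (η / K) := by gcongr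
      _ = η := by field_simp
      _ ≤ 1 / 4 := hη4
  have hκ1 : K * ε ^ (k - 2) ≤ 1 := by
    have : 1 ≤ (1 + T) ^ D := one_le_pow₀ (by linarith)
    have h0 : 0 ≤ K * ε ^ (k - 2) := by positivity
    nlinarith
  have hdT : C * (η * ε ^ (s - 2) * Real.exp (T ^ 2 / 2)) ≤ T ^ s := by
    calc C * (η * ε ^ (s - 2) * Real.exp (T ^ 2 / 2))
        = C * η * (Real.exp (T ^ 2 / 2) * ε ^ (s - 2)) := by ring
      _ ≤ 1 * T ^ s := by
          rw [hT]
          gcongr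
      _ = T ^ s := one_mul _
  have hac' : IsACDensity (ν n) fun x => gaussianPDFReal 0 1 x * (1 + Q.eval x) + E x := by
    simpa only [eQ] using hac
  obtain ⟨hFI, hFb⟩ := hfish Q E (deriv E) (deriv (deriv E)) (K * ε ^ (k - 2)) (η * ε ^ (s - 2)) T
    hEd hEd' (fun x => by simpa using hEb' 0 (by norm_num) x)
    (fun x => by simpa using hEb' 1 (by norm_num) x)
    (fun x => by simpa [iteratedDeriv_succ] using hEb' 2 le_rfl x) hac'.nonneg (by positivity) hκ1
    (by positivity) hT2 (fun x => bd (eQ x) (hBb ε hεabs x).1)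
    (fun x => bd (eQ' x) (hBb ε hεabs x).2.1) (fun x => bd (eQ'' x) (hBb ε hεabs x).2.2) hκT hdT
  have hrel := relFisherInfo_eq_ofReal_integral hac'
    (fun x => hasDerivAt_gaussian_mul_add (Q := Q) hEd x) hFI
  refine ⟨by rw [hrel]; exact ENNReal.ofReal_lt_top, ?_⟩
  rw [hrel, ENNReal.toReal_ofReal
    (integral_nonneg fun x => mul_nonneg (sq_nonneg _) (hac'.nonneg x))]
  set I := ∫ x, ((gaussianPDFReal 0 1 x * (Q.derivative.eval x - x * (1 + Q.eval x)) + deriv E x) /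
    (gaussianPDFReal 0 1 x * (1 + Q.eval x) + E x) + x) ^ 2 *
    (gaussianPDFReal 0 1 x * (1 + Q.eval x) + E x)
  have hWint : ∫ x, gaussianPDFReal 0 1 x * (Q.derivative.eval x ^ 2 * (1 - Q.eval x)) =
      (ε ^ 2) ^ (k - 2) * ∫ x, gaussianPDFReal 0 1 x * ((specialize B ε).derivative.eval x ^ 2 *
        (1 - ε ^ (k - 2) * (specialize B ε).eval x)) := by
    rw [← integral_const_mul]
    refine integral_congr_ae (ae_of_all _ fun x => ?_)
    simp only [eQ, eQ']
    rw [← pow_mul, mul_comm 2, pow_mul]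
    ring
  have hm := hmain ε hεabs
  set M := ∫ x, gaussianPDFReal 0 1 x * ((specialize B ε).derivative.eval x ^ 2 *
        (1 - ε ^ (k - 2) * (specialize B ε).eval x))
  rw [hWint] at hFb
  have herr := fisher_error_le (D := D) hs hk3 hε hε1 hℓ1 hK1 hη0 (by linarith) hT hℓT hTℓ
    ((le_max_right _ _).trans hM) hsmall
  have hek : (ε ^ 2) ^ (k - 1) = (ε ^ 2) ^ (k - 2) * ε ^ 2 := by
    rw [← pow_succ]; congr 1; omega
  have h2 : |(ε ^ 2) ^ (k - 2) * M - a k ^ 2 * (k * k.factorial) * (ε ^ 2) ^ (k - 2)| ≤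
      K' * (ε ^ 2) ^ (k - 1) := by
    rw [mul_comm (a k ^ 2 * _), ← mul_sub, abs_mul, abs_of_pos (by positivity), hek]
    calc (ε ^ 2) ^ (k - 2) * |M - a k ^ 2 * (k * k.factorial)|
        ≤ (ε ^ 2) ^ (k - 2) * (K' * ε ^ 2) := by gcongr
      _ = _ := by ring
  set r := ε ^ (s - 2) / ℓ ^ (s - 3) with hr
  have hr0 : 0 ≤ r := by positivity
  calc |I - a k ^ 2 * (k * k.factorial) * (ε ^ 2) ^ (k - 2)|
      ≤ |I - (ε ^ 2) ^ (k - 2) * M| +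
        |(ε ^ 2) ^ (k - 2) * M - a k ^ 2 * (k * k.factorial) * (ε ^ 2) ^ (k - 2)| :=
        abs_sub_le _ _ _
    _ ≤ C * (K ^ 4 * (ε ^ 2) ^ (k - 1) + 5 * η * r) + K' * (ε ^ 2) ^ (k - 1) := by
        refine add_le_add (hFb.trans ?_) h2
        gcongr
    _ = (C * K ^ 4 + K') * (ε ^ 2) ^ (k - 1) + C * (5 * η) * r := by ring
    _ ≤ _ := by gcongr

end FisherAsymptotics

/-! ### Passage from random variables to laws, and conclusion. -/

theorem normalizedSum_eq {Ω : Type*} (X : ℕ → Ω → ℝ) (n : ℕ) :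
    normalizedSum X n = fun ω => (√(n : ℝ))⁻¹ * ∑ i ∈ Finset.range n, X i ω := by
  ext ω
  rw [normalizedSum, div_eq_inv_mul]

theorem memLp_id_map_of_integrable_abs_pow {Ω : Type*} [MeasurableSpace Ω] {P : Measure Ω}
    {Y : Ω → ℝ} (hY : AEMeasurable Y P) {s : ℕ} (hs : s ≠ 0)
    (h : Integrable (fun ω => |Y ω| ^ s) P) : MemLp id s (P.map Y) := by
  rw [memLp_map_measure_iff aestronglyMeasurable_id hY, Function.id_comp,
    ← integrable_norm_rpow_iff hY.aestronglyMeasurable (by exact_mod_cast hs) (by simp)]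
  simpa using h

/-- A sequence that is bounded by `C b + η r` for every `η > 0` splits into `O(b)` and `o(r)`. -/
theorem exists_isBigO_isLittleO_of_forall_le {u b r : ℕ → ℝ} {C : ℝ} (hC : 0 ≤ C)
    (hb : ∀ n, 0 ≤ b n) (h : ∀ η > 0, ∀ᶠ n in atTop, |u n| ≤ C * b n + η * |r n|) :
    ∃ R₁ R₂ : ℕ → ℝ, R₁ =O[atTop] b ∧ R₂ =o[atTop] r ∧ ∀ n, u n = R₁ n + R₂ n := by
  -- R₁ is u truncated to [-Cb, Cb]. The excess R₂ is at most η|r| eventually, for every η, because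
  -- C does not depend on η.
  refine ⟨fun n => max (-(C * b n)) (min (C * b n) (u n)),
    fun n => u n - max (-(C * b n)) (min (C * b n) (u n)), ?_, ?_, fun n => by ring⟩
  · refine IsBigO.of_bound C (Eventually.of_forall fun n => ?_)
    have h0 : 0 ≤ C * b n := mul_nonneg hC (hb n)
    rw [Real.norm_eq_abs, Real.norm_of_nonneg (hb n), abs_le]
    exact ⟨le_max_left _ _, max_le (by linarith) (min_le_left _ _)⟩
  · refine isLittleO_iff.2 fun η hη => ?_
    filter_upwards [h η hη] with n hn
    have h0 : 0 ≤ C * b n := mul_nonneg hC (hb n)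
    have h1 : 0 ≤ η * |r n| := by positivity
    rw [Real.norm_eq_abs, Real.norm_eq_abs]
    rw [abs_le] at hn ⊢
    rcases le_total (u n) (C * b n) with h2 | h2
    · rw [min_eq_right h2]
      rcases le_total (-(C * b n)) (u n) with h3 | h3
      · rw [max_eq_right h3]
        constructor <;> linarith
      · rw [max_eq_left h3]
        constructor <;> linarith
    · rw [min_eq_left h2, max_eq_right (by linarith)]
      constructor <;> linarith

theorem sq_div_factorial_mul (γ : ℝ) {k : ℕ} (hk : 1 ≤ k) :
    (γ / k.factorial) ^ 2 * (k * k.factorial) = γ ^ 2 / (k - 1).factorial := by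
  obtain ⟨m, rfl⟩ : ∃ m, k = m + 1 := ⟨k - 1, by omega⟩
  rw [Nat.add_sub_cancel, Nat.factorial_succ]
  have h1 : (m.factorial : ℝ) ≠ 0 := by exact_mod_cast m.factorial_ne_zero
  have h2 : ((m + 1 : ℕ) : ℝ) ≠ 0 := by exact_mod_cast m.succ_ne_zero
  push_cast at h2 ⊢
  field_simp

theorem corollary1p2 {Ω : Type*} [MeasurableSpace Ω] (P : Measure Ω) [IsProbabilityMeasure P]
    (X : ℕ → Ω → ℝ)
    (hindep : iIndepFun X P)
    (hident : ∀ i, IdentDistrib (X i) (X 0) P P)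
    (hmean : ∫ ω, X 0 ω ∂P = 0)
    (hvar : variance (X 0) P = 1)
    (s : ℕ) (hs : 4 ≤ s)
    (hmoment : Integrable (fun ω => |X 0 ω| ^ s) P)
    (n₀ : ℕ) (hn₀ : 1 ≤ n₀)
    (hfisher : fisherInfo (P.map (normalizedSum X n₀)) < ∞)
    (k : ℕ) (hk₃ : 3 ≤ k) (hks : k ≤ s)
    (hcumulant : ∀ j, 3 ≤ j → j < k → cumulant (P.map (X 0)) j = 0) :
    (∀ᶠ n : ℕ in atTop, relFisherInfo (P.map (normalizedSum X n)) 0 1 < ∞) ∧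
    ∃ R₁ R₂ : ℕ → ℝ,
      R₁ =O[atTop] (fun n : ℕ => 1 / (n : ℝ) ^ (k - 1)) ∧
      R₂ =o[atTop] (fun n : ℕ =>
        1 / ((n : ℝ) ^ (((s : ℝ) - 2) / 2) * Real.log n ^ (((s : ℝ) - 3) / 2))) ∧
      ∀ᶠ n : ℕ in atTop,
        (relFisherInfo (P.map (normalizedSum X n)) 0 1).toReal =
          cumulant (P.map (X 0)) k ^ 2 / ((k - 1).factorial : ℝ) * (1 / (n : ℝ) ^ (k - 2))
            + R₁ n + R₂ n := by
  have hX : ∀ i, AEMeasurable (X i) P := fun i => (hident i).aemeasurable_fst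
  set μ := P.map (X 0) with hμ
  have hμp : IsProbabilityMeasure μ := Measure.isProbabilityMeasure_map (hX 0)
  have hmom : MemLp id s μ := memLp_id_map_of_integrable_abs_pow (hX 0) (by omega) hmoment
  have hmean' : ∫ x, x ∂μ = 0 := by
    rw [hμ, integral_map (hX 0) (by fun_prop), hmean]
  have hvar' : ∫ x, x ^ 2 ∂μ = 1 := by
    rw [hμ, integral_map (hX 0) (by fun_prop), ← variance_of_integral_eq_zero (hX 0) hmean, hvar]
  have hνp : ∀ n, IsProbabilityMeasure (P.map (normalizedSum X n)) := fun n => by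
    rw [normalizedSum_eq]
    exact Measure.isProbabilityMeasure_map
      ((Finset.aemeasurable_fun_sum _ fun i _ => hX i).const_mul _)
  have hν : ∀ n t, charFun (P.map (normalizedSum X n)) t =
      charFun μ ((√(n : ℝ))⁻¹ * t) ^ n := fun n t => by
    rw [normalizedSum_eq]
    exact charFun_inv_sqrt_mul_sum hindep hident
  -- The characteristic function of the n₀-th normalized sum at √n₀ t is f(t)^{n₀}.
  have hdecay : ∃ C : ℝ, ∀ t : ℝ, |t| * ‖charFun μ t‖ ^ n₀ ≤ C := by
    have := hνp n₀
    obtain ⟨C, hC⟩ := exists_abs_mul_norm_charFun_le hfisher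
    have hq : 0 < √(n₀ : ℝ) := Real.sqrt_pos.2 (by exact_mod_cast hn₀)
    refine ⟨C / √(n₀ : ℝ), fun t => ?_⟩
    have h := hC (√(n₀ : ℝ) * t)
    rw [hν, inv_mul_cancel_left₀ hq.ne', norm_pow, abs_mul, abs_of_pos hq] at h
    rw [le_div_iff₀ hq]
    linarith
  obtain ⟨C₀, hC₀⟩ := hdecay
  obtain ⟨C, hC, hmain⟩ := exists_eventually_abs_relFisherInfo_sub_le hs hk₃ hks
    (fun j => cumulant μ j / j.factorial) (fun η hη => eventually_exists_isACDensity hk₃ hks hmom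
      hmean' hvar' hcumulant hC₀ hνp hν hη)
  have hinv : ∀ n : ℕ, ∀ m : ℕ, ((√(n : ℝ))⁻¹ ^ 2) ^ m = 1 / (n : ℝ) ^ m := fun n m => by
    rw [inv_pow, Real.sq_sqrt n.cast_nonneg, inv_pow, one_div]
  have hrate : ∀ᶠ n : ℕ in atTop, (√(n : ℝ))⁻¹ ^ (s - 2) / √(Real.log n) ^ (s - 3) =
      |1 / ((n : ℝ) ^ (((s : ℝ) - 2) / 2) * Real.log n ^ (((s : ℝ) - 3) / 2))| := by
    filter_upwards [eventually_ge_atTop 1] with n hn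
    have hlog : 0 ≤ Real.log n := Real.log_nonneg (by exact_mod_cast hn)
    have e2 : (s : ℝ) - 2 = ((s - 2 : ℕ) : ℝ) := by rw [Nat.cast_sub (by omega)]; norm_num
    have e3 : (s : ℝ) - 3 = ((s - 3 : ℕ) : ℝ) := by rw [Nat.cast_sub (by omega)]; norm_num
    rw [abs_of_nonneg (by positivity), Real.rpow_div_two_eq_sqrt _ n.cast_nonneg,
      Real.rpow_div_two_eq_sqrt _ hlog, e2, e3, Real.rpow_natCast, Real.rpow_natCast, inv_pow,
      one_div, mul_inv, div_eq_mul_inv]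
  refine ⟨(hmain 1 one_pos).mono fun n hn => hn.1, ?_⟩
  obtain ⟨R₁, R₂, h₁, h₂, h₃⟩ := exists_isBigO_isLittleO_of_forall_le
    (u := fun n => (relFisherInfo (P.map (normalizedSum X n)) 0 1).toReal -
      cumulant μ k ^ 2 / ((k - 1).factorial : ℝ) * (1 / (n : ℝ) ^ (k - 2)))
    (b := fun n => 1 / (n : ℝ) ^ (k - 1))
    (r := fun n => 1 / ((n : ℝ) ^ (((s : ℝ) - 2) / 2) * Real.log n ^ (((s : ℝ) - 3) / 2))) hC
    (fun n => by positivity) (fun η hη => by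
      filter_upwards [hmain η hη, hrate] with n hn hr
      have := hn.2
      rwa [hr, hinv, hinv, sq_div_factorial_mul _ (by omega)] at this)
  refine ⟨R₁, R₂, h₁, h₂, Eventually.of_forall fun n => ?_⟩
  rw [add_assoc, ← h₃ n]
  ring
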